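/- A deterministic transition graph $\mathcal T=(\Sigma,Q,\delta,q_0)$ consists of a finite alphabet $\Sigma$, a finite set $Q$ of states, a transition function $\delta:Q\times\Sigma\to Q$ and an initial state $q_0\in Q$ from which every state is reachable. For $\alpha\in\Sigma^\omega$ let $\mathrm{Inf}(\alpha)\subseteq Q$ be the set of states that occur infinitely often in the run on $\alpha$. A deterministic Büchi automaton (DBA) is a transition graph with a set $F\subseteq Q$ and accepts $\alpha$ iff $\mathrm{Inf}(\alpha)\cap F\neq\emptyset$; a deterministic co-Büchi automaton (DCA) is a transition graph with a set $F\subseteq Q$ and accepts $\alpha$ iff $\mathrm{Inf}(\alpha)\subseteq F$; a deterministic parity automaton (DPA) is a transition graph with a priority function $c:Q\to\mathbb N$ and accepts $\alpha$ iff $\max c(\mathrm{Inf}(\alpha))$ is even. $L(\mathcal A)$ denotes the set of accepted words. An automaton is minimal if no automaton of the same type (DBA, DCA, DPA) with fewer states accepts the same language. For $L\subseteq\Sigma^\omega$ and $u,v\in\Sigma^*$ let $u\sim_L v$ iff for all $\alpha\in\Sigma^\omega$: $u\alpha\in L\iff v\alpha\in L$. An automaton $\mathcal A$ has informative right-congruence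 if its transition graph is isomorphic to $\mathcal T_{\sim_{L(\mathcal A)}}$, where $\mathcal T_{\sim_L}$ has as states the classes $[u]$ of $\sim_L$, initial state $[\epsilon]$, and transitions $[u]\mapsto[u\sigma]$ for $\sigma\in\Sigma$. Let $\mathbb{IB}$, $\mathbb{IC}$, $\mathbb{IP}$ be the classes of languages accepted by a DBA, a DCA, a DPA, respectively, with informative right-congruence. **Corollary.** Automata are given by the list of alphabet size, number of states, initial state and, for each state, its priority (or acceptance bit) and its successors, all numbers being written in binary; time is the number of steps of a deterministic multi-stack Turing machine. 1. Given a DPA $\mathcal A$, each of the three properties $L(\mathcal A)\in\mathbb{IB}$, $L(\mathcal A)\in\mathbb{IC}$, $L(\mathcal A)\in\mathbb{IP}$ is decidable in polynomial time. 2. There is a polynomial-time algorithm that, given a DPA $\mathcal A$, outputs a DBA with informative right-congruence that accepts $L(\mathcal A)$ if $L(\mathcal A)\in\mathbb{IB}$, and reports that there is none otherwise. The same holds for DCAs and $\mathbb{IC}$, and for DPAs and $\mathbb{IP}$. 3. The automata constructed in 2 are minimal. In particular, DPAs $\mathcal A$ with $L(\mathcal A)\in\mathbb{IP}$ can be minimized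 in polynomial time. -/

import Mathlib

open Turing Filter

namespace OmegaAut

/-- A deterministic transition graph over the alphabet `α` with state set `Q`, in which every
state is reachable from the initial state. -/
structure DTS (α Q : Type) where
  init : Q
  step : Q → α → Q
  reachable : ∀ q, ∃ w : List α, w.foldl step init = q

/-- The run of a transition graph on an infinite word. -/
def DTS.run {α Q : Type} (T : DTS α Q) (a : Stream' α) : ℕ → Q
  | 0 => T.init
  | i + 1 => T.step (T.run a i) (a.get i)

/-- The set of states that occur infinitely often in the run on `a`. -/
def DTS.infs {α Q : Type} (T : DTS α Q) (a : Stream' α) : Set Q :=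
  {q | ∃ᶠ i in atTop, T.run a i = q}

/-- Isomorphism of transition graphs over the same alphabet. -/
def DTS.Isomorphic {α Q₁ Q₂ : Type} (T₁ : DTS α Q₁) (T₂ : DTS α Q₂) : Prop :=
  ∃ e : Q₁ ≃ Q₂, e T₁.init = T₂.init ∧ ∀ q a, e (T₁.step q a) = T₂.step (e q) a

/-- The canonical right-congruence of a language of infinite words. -/
def canonCongr {α : Type} (L : Set (Stream' α)) : Setoid (List α) where
  r u v := ∀ a : Stream' α, u ++ₛ a ∈ L ↔ v ++ₛ a ∈ L
  iseqv := ⟨fun _ _ => Iff.rfl, fun h a => (h a).symm, fun h h' a => (h a).trans (h' a)⟩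

theorem canonCongr_snoc {α : Type} (L : Set (Stream' α)) (s : α) {u v : List α}
    (h : (canonCongr L).r u v) : (canonCongr L).r (u ++ [s]) (v ++ [s]) := by
  intro a
  rw [Stream'.append_append_stream, Stream'.append_append_stream]
  exact h _

/-- The transition function on the classes of the canonical right-congruence,
`[u] ↦ [u s]`. -/
def canonStep {α : Type} (L : Set (Stream' α)) (q : Quotient (canonCongr L)) (s : α) :
    Quotient (canonCongr L) :=
  Quotient.map (fun u => u ++ [s]) (fun _ _ h => canonCongr_snoc L s h) q

theorem canonStep_foldl {α : Type} (L : Set (Stream' α)) (w u : List α) :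
    w.foldl (canonStep L) (Quotient.mk _ u) = Quotient.mk _ (u ++ w) := by
  induction w generalizing u with
  | nil => simp
  | cons s w ih =>
    have h := ih (u ++ [s])
    simp only [List.append_assoc, List.singleton_append] at h
    exact h

/-- The transition graph induced by the canonical right-congruence of `L`. -/
def canonDTS {α : Type} (L : Set (Stream' α)) : DTS α (Quotient (canonCongr L)) where
  init := Quotient.mk _ []
  step := canonStep L
  reachable q := by
    induction q using Quotient.ind with
    | _ u => exact ⟨u, canonStep_foldl L u []⟩

/-- Deterministic Büchi automata. -/
structure DBA (α Q : Type) extends DTS α Q where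
  acc : Set Q

/-- Deterministic co-Büchi automata; a run is accepting if only states in `acc` are visited
infinitely often. -/
structure DCA (α Q : Type) extends DTS α Q where
  acc : Set Q

/-- Deterministic parity automata. -/
structure DPA (α Q : Type) extends DTS α Q where
  prio : Q → ℕ

def DBA.language {α Q : Type} (A : DBA α Q) : Set (Stream' α) :=
  {a | (A.infs a ∩ A.acc).Nonempty}

def DCA.language {α Q : Type} (A : DCA α Q) : Set (Stream' α) :=
  {a | A.infs a ⊆ A.acc}

/-- The highest priority visited infinitely often is even. -/
def DPA.language {α Q : Type} (A : DPA α Q) : Set (Stream' α) :=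
  {a | ∃ m, IsGreatest (A.prio '' A.infs a) m ∧ Even m}

/-- Informative right-congruence: the transition graph is isomorphic to the one induced by the
canonical right-congruence of the accepted language. -/
def DBA.HasIRC {α Q : Type} (A : DBA α Q) : Prop := A.toDTS.Isomorphic (canonDTS A.language)

def DCA.HasIRC {α Q : Type} (A : DCA α Q) : Prop := A.toDTS.Isomorphic (canonDTS A.language)

def DPA.HasIRC {α Q : Type} (A : DPA α Q) : Prop := A.toDTS.Isomorphic (canonDTS A.language)

/-- Minimality: no automaton of the same type with fewer states accepts the same language. -/
def DBA.IsMinimal {α Q : Type} (A : DBA α Q) : Prop :=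
  ∀ (Q' : Type) [Finite Q'] (B : DBA α Q'), B.language = A.language → Nat.card Q ≤ Nat.card Q'

def DCA.IsMinimal {α Q : Type} (A : DCA α Q) : Prop :=
  ∀ (Q' : Type) [Finite Q'] (B : DCA α Q'), B.language = A.language → Nat.card Q ≤ Nat.card Q'

def DPA.IsMinimal {α Q : Type} (A : DPA α Q) : Prop :=
  ∀ (Q' : Type) [Finite Q'] (B : DPA α Q'), B.language = A.language → Nat.card Q ≤ Nat.card Q'

/-- The class of languages over `α` accepted by a (finite) DBA with informative
right-congruence. -/
def IB (α : Type) : Set (Set (Stream' α)) :=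
  {L | ∃ (Q : Type) (_ : Finite Q) (A : DBA α Q), A.language = L ∧ A.HasIRC}

/-- The class of languages over `α` accepted by a (finite) DCA with informative
right-congruence. -/
def IC (α : Type) : Set (Set (Stream' α)) :=
  {L | ∃ (Q : Type) (_ : Finite Q) (A : DCA α Q), A.language = L ∧ A.HasIRC}

/-- The class of languages over `α` accepted by a (finite) DPA with informative
right-congruence. -/
def IP (α : Type) : Set (Set (Stream' α)) :=
  {L | ∃ (Q : Type) (_ : Finite Q) (A : DPA α Q), A.language = L ∧ A.HasIRC}

/-! Finite automata as inputs and outputs of algorithms: the alphabet is `Fin k`, the states are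
`Fin n`. -/

/-- A DBA with alphabet `Fin k` and some state set `Fin n`. -/
abbrev FinDBA (k : ℕ) : Type := Σ n : ℕ, DBA (Fin k) (Fin n)

/-- A DCA with alphabet `Fin k` and some state set `Fin n`. -/
abbrev FinDCA (k : ℕ) : Type := Σ n : ℕ, DCA (Fin k) (Fin n)

/-- A DPA with alphabet `Fin k` and some state set `Fin n`. -/
abbrev FinDPA (k : ℕ) : Type := Σ n : ℕ, DPA (Fin k) (Fin n)

/-- The string describing a transition graph whose states `q` carry numbers `mark q`: the size of
the alphabet, the number of states, the initial state, and then, for each state, its mark followed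
by its successors under the letters. `PartrecToTM2.trList` writes every number of a list in binary
and ends it with a separator. -/
def encodeMarked {k n : ℕ} (T : DTS (Fin k) (Fin n)) (mark : Fin n → ℕ) :
    List PartrecToTM2.Γ' :=
  PartrecToTM2.trList <| k :: n :: (T.init : ℕ) ::
    (List.finRange n).flatMap fun q =>
      mark q :: (List.finRange k).map fun s => (T.step q s : ℕ)

open Classical in
/-- The number `1` on `F`, the number `0` elsewhere. -/
noncomputable def bit {Q : Type} (F : Set Q) (q : Q) : ℕ := if q ∈ F then 1 else 0

noncomputable def encodeDBA {k : ℕ} (A : FinDBA k) : List PartrecToTM2.Γ' :=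
  encodeMarked A.2.toDTS (bit A.2.acc)

noncomputable def encodeDCA {k : ℕ} (A : FinDCA k) : List PartrecToTM2.Γ' :=
  encodeMarked A.2.toDTS (bit A.2.acc)

def encodeDPA {k : ℕ} (A : FinDPA k) : List PartrecToTM2.Γ' :=
  encodeMarked A.2.toDTS A.2.prio

/-- The string for an optional automaton: the empty string stands for `none`. -/
def encodeOption {β : Type} (e : β → List PartrecToTM2.Γ') : Option β → List PartrecToTM2.Γ'
  | none => []
  | some b => e b

/-- The function `f` is computed by a Turing machine (with finitely many stacks) in time
polynomial in the length of the encoded input. -/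
def PolyTimeComputable {X Y Γ₀ Γ₁ : Type} (ex : X → List Γ₀) (ey : Y → List Γ₁) (f : X → Y) :
    Prop :=
  Nonempty (TM2ComputableInPolyTime ex ey f)

open Classical in
/-- The property `P` is decided by a Turing machine (with finitely many stacks) in time polynomial
in the length of the encoded input. -/
def PolyTimeDecidable {X Γ₀ : Type} (ex : X → List Γ₀) (P : X → Prop) : Prop :=
  PolyTimeComputable ex Computability.encodeBool fun x => decide (P x)

end OmegaAut

open OmegaAut

/-! Call the set of states that a word visits infinitely often a loop; it is accepting or rejecting
according to the parity of its highest priority. An automaton with informative right-congruence for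
the language of `A` has, up to isomorphism, the quotient of `A` by language equivalence of states as
its transition graph, and its loops are the images of those of `A` (`exists_hom`). So membership in
the three classes asks whether this one graph carries a suitable acceptance condition.

The question is settled by peeling. Let `W₀` be the set of all states of `A`, and let `Wᵣ₊₁` consist
of those states of `Wᵣ` whose class meets a loop inside `Wᵣ` of a prescribed kind. For `e = False`
the kind is rejecting when `r` is even and accepting when `r` is odd; for `e = True` it is the other
way round. All `Wᵣ` are unions of classes. Suppose that some layer is empty, and mark a state with
the index of the last layer that contains it. Then the parity of the least mark on a loop tells
whether the loop is accepting: otherwise the loop itself would have kept its least marked states for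
the next layer (`mem_language_iff_mark`). Reversing the order of the marks gives priorities on the
quotient. Conversely, suppose that a rank function, constant on classes, decides acceptance by its
least value in the same way. Then a state in `Wᵣ` has rank at least `r` (`le_rank_of_mem_layer`), so
the layers die out. Büchi and co-Büchi conditions are ranks with values 0 and 1, so the criterion is
`W₂ = ∅`, with `e = False` and `e = True` respectively. For parity conditions the ranks are
unbounded, but the chain is constant once two consecutive steps remove nothing, so with `n` states
it is enough to look at the layer of index `2 * n` (`layer_two_mul_eq_nil`).

Each step is a reachability problem. A loop of known acceptance is a cycle through a state whose
priority bounds the others (`hasLoop_iff`), and two states are inequivalent iff the product of `A`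
with itself reaches a cycle on which the highest priorities of the two components have different
parities (`ineq_iff`).

Minimality is the Myhill–Nerode count: words that lead to the same state of any automaton for the
language are congruent, so there are at most as many classes as states (`card_le_of_isomorphic`).

For the time bounds, a small language of stack programs is compiled to Turing machines, data are
binary trees in prefix code on one stack, and `PT` is the class of functions computed on them in
polynomial time. It is closed under composition, pairing, case distinction and folds whose
intermediate values stay polynomially small; graph reachability is such a fold. Priorities may be
exponentially large in the length of the input. They are therefore kept in binary and only compared
and tested for parity; all other numbers are at most the length of the input and are handled in
unary. -/

namespace StackProg

/-! ### Structured stack programs and their compilation to `TM2` machines -/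

/-- Structured programs acting on finitely many stacks. -/
inductive Prog {K : Type} (Γ : K → Type) : Type
  | skip : Prog Γ
  | push (k : K) (x : Γ k) : Prog Γ
  | pop (k : K) : Prog Γ
  | seq (p q : Prog Γ) : Prog Γ
  | ite (k : K) (f : Option (Γ k) → Bool) (p q : Prog Γ) : Prog Γ
  | loop (k : K) (f : Option (Γ k) → Bool) (p : Prog Γ) : Prog Γ

infixr:60 " ;; " => Prog.seq

section Compile

variable {K : Type} [DecidableEq K] {Γ : K → Type}

/-- Big-step semantics: `Exec p S S' t` says that `p` turns the stacks `S` into `S'` in `t`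
steps. -/
inductive Exec : Prog Γ → (∀ k, List (Γ k)) → (∀ k, List (Γ k)) → ℕ → Prop
  | skip (S) : Exec .skip S S 1
  | push (S) (k : K) (x : Γ k) : Exec (.push k x) S (Function.update S k (x :: S k)) 1
  | pop (S) (k : K) : Exec (.pop k) S (Function.update S k (S k).tail) 1
  | seq {p q S S' S'' t t'} : Exec p S S' t → Exec q S' S'' t' → Exec (.seq p q) S S'' (t + t')
  | ite_true {k f p q S S' t} : f (S k).head? = true → Exec p S S' t →
      Exec (.ite k f p q) S S' (t + 1)
  | ite_false {k f p q S S' t} : f (S k).head? = false → Exec q S S' t →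
      Exec (.ite k f p q) S S' (t + 1)
  | loop_true {k f p S S' S'' t t'} : f (S k).head? = true → Exec p S S' t →
      Exec (.loop k f p) S' S'' t' → Exec (.loop k f p) S S'' (t + t' + 1)
  | loop_false {k f p S} : f (S k).head? = false → Exec (.loop k f p) S S 1

/-- The labels of a compiled program. -/
def Lab : Prog Γ → Type
  | .skip => Unit
  | .push _ _ => Unit
  | .pop _ => Unit
  | .seq p q => Lab p ⊕ Lab q
  | .ite _ _ p q => Option (Lab p ⊕ Lab q)
  | .loop _ _ p => Option (Lab p)

@[reducible] def labFintype : ∀ p : Prog Γ, Fintype (Lab p)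
  | .skip => inferInstanceAs (Fintype Unit)
  | .push _ _ => inferInstanceAs (Fintype Unit)
  | .pop _ => inferInstanceAs (Fintype Unit)
  | .seq p q => @instFintypeSum _ _ (labFintype p) (labFintype q)
  | .ite _ _ p q => @instFintypeOption _ (@instFintypeSum _ _ (labFintype p) (labFintype q))
  | .loop _ _ p => @instFintypeOption _ (labFintype p)

/-- The label at which a compiled program starts. -/
def entry : ∀ p : Prog Γ, Lab p
  | .skip => ()
  | .push _ _ => ()
  | .pop _ => ()
  | .seq p _ => Sum.inl (entry p)
  | .ite _ _ _ _ => none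
  | .loop _ _ _ => none

/-- A conditional jump on the top of a stack, leaving the internal state unchanged. -/
def testStmt {Λ : Type} (k : K) (f : Option (Γ k) → Bool) (l₁ l₂ : Λ) : TM2.Stmt Γ Λ Bool :=
  .peek k (fun _ o => f o) <| .branch id
    (.load (fun _ => false) <| .goto fun _ => l₁) (.load (fun _ => false) <| .goto fun _ => l₂)

/-- The statement at each label of a compiled program; `emb` embeds the labels into those of the
whole machine and `out` is the label to be reached after termination. -/
def code {Λ : Type} : ∀ p : Prog Γ, (Lab p → Λ) → Λ → Lab p → TM2.Stmt Γ Λ Bool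
  | .skip, _, out, _ => .goto fun _ => out
  | .push k x, _, out, _ => .push k (fun _ => x) <| .goto fun _ => out
  | .pop k, _, out, _ => .pop k (fun v _ => v) <| .goto fun _ => out
  | .seq p q, emb, out, l => match l with
    | Sum.inl l => code p (fun l => emb (Sum.inl l)) (emb (Sum.inr (entry q))) l
    | Sum.inr l => code q (fun l => emb (Sum.inr l)) out l
  | .ite k f p q, emb, out, l => match l with
    | none => testStmt k f (emb (some (Sum.inl (entry p)))) (emb (some (Sum.inr (entry q))))
    | some (Sum.inl l) => code p (fun l => emb (some (Sum.inl l))) out l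
    | some (Sum.inr l) => code q (fun l => emb (some (Sum.inr l))) out l
  | .loop k f p, emb, out, l => match l with
    | none => testStmt k f (emb (some (entry p))) out
    | some l => code p (fun l => emb (some l)) (emb none) l

/-- `Steps M c c' t`: the machine `M` goes from `c` to `c'` in `t` steps. -/
def Steps {Λ : Type} (M : Λ → TM2.Stmt Γ Λ Bool) (c c' : TM2.Cfg Γ Λ Bool) (t : ℕ) : Prop :=
  (flip Bind.bind (TM2.step M))^[t] (some c) = some c'

theorem Steps.trans {Λ : Type} {M : Λ → TM2.Stmt Γ Λ Bool} {c c' c'' : TM2.Cfg Γ Λ Bool}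
    {t t' : ℕ} (h : Steps M c c' t) (h' : Steps M c' c'' t') : Steps M c c'' (t + t') := by
  unfold Steps at *
  rw [Nat.add_comm, Function.iterate_add_apply, h, h']

theorem Steps.one {Λ : Type} {M : Λ → TM2.Stmt Γ Λ Bool} {c c' : TM2.Cfg Γ Λ Bool}
    (h : TM2.step M c = some c') : Steps M c c' 1 := h

/-- The internal bit is used only between the test and the jump and is then reset, so it is `false`
whenever a label is reached. No invariant about the internal state has to be carried along. -/
theorem steps_testStmt {Λ : Type} {M : Λ → TM2.Stmt Γ Λ Bool} {l l₁ l₂ : Λ} {k : K}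
    {f : Option (Γ k) → Bool} (h : M l = testStmt k f l₁ l₂) (S : ∀ k, List (Γ k)) :
    Steps M ⟨some l, false, S⟩ ⟨some (bif f (S k).head? then l₁ else l₂), false, S⟩ 1 := by
  apply Steps.one
  rw [TM2.step, h, testStmt]
  cases hf : f (S k).head? <;> simp [hf]

/-- The embedding of labels and the exit label are arbitrary, so that the induction hypothesis
applies to a subprogram placed anywhere in a larger machine. Every instruction and every test costs
exactly one machine step, hence the two notions of time agree. -/
theorem Exec.steps {Λ : Type} {M : Λ → TM2.Stmt Γ Λ Bool} {p : Prog Γ}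
    {S S' : ∀ k, List (Γ k)} {t : ℕ} (h : Exec p S S' t) :
    ∀ (emb : Lab p → Λ) (out : Λ), (∀ l, M (emb l) = code p emb out l) →
      Steps M ⟨some (emb (entry p)), false, S⟩ ⟨some out, false, S'⟩ t := by
  induction h with
  | skip S =>
    intro emb out hM
    apply Steps.one
    rw [TM2.step, hM]; rfl
  | push S k x =>
    intro emb out hM
    apply Steps.one
    rw [TM2.step, hM]; rfl
  | pop S k =>
    intro emb out hM
    apply Steps.one
    rw [TM2.step, hM]; rfl
  | seq _ _ ih ih' =>
    intro emb out hM
    exact (ih (fun l => emb (Sum.inl l)) _ fun l => hM (Sum.inl l)).trans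
      (ih' (fun l => emb (Sum.inr l)) _ fun l => hM (Sum.inr l))
  | @ite_true k f p q S S' t hf _ ih =>
    intro emb out hM
    have h := (steps_testStmt (hM none) S)
    rw [hf] at h
    rw [Nat.add_comm]
    exact h.trans (ih (fun l => emb (some (Sum.inl l))) _ fun l => hM (some (Sum.inl l)))
  | @ite_false k f p q S S' t hf _ ih =>
    intro emb out hM
    have h := (steps_testStmt (hM none) S)
    rw [hf] at h
    rw [Nat.add_comm]
    exact h.trans (ih (fun l => emb (some (Sum.inr l))) _ fun l => hM (some (Sum.inr l)))
  | @loop_true k f p S S' S'' t t' hf _ _ ih ih' =>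
    intro emb out hM
    have h := (steps_testStmt (hM none) S)
    rw [hf] at h
    rw [Nat.add_comm]
    exact h.trans ((ih (fun l => emb (some l)) _ fun l => hM (some l)).trans (ih' emb out hM))
  | @loop_false k f p S hf =>
    intro emb out hM
    have h := (steps_testStmt (hM none) S)
    rw [hf] at h
    exact h

/-- Termination within a number of steps. -/
def Runs (p : Prog Γ) (S S' : ∀ k, List (Γ k)) (T : ℕ) : Prop := ∃ t ≤ T, Exec p S S' t

theorem Runs.mono {p : Prog Γ} {S S' : ∀ k, List (Γ k)} {T T' : ℕ} (h : Runs p S S' T)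
    (hT : T ≤ T') : Runs p S S' T' :=
  let ⟨t, ht, he⟩ := h; ⟨t, ht.trans hT, he⟩

theorem Runs.seq {p q : Prog Γ} {S S' S'' : ∀ k, List (Γ k)} {T T' : ℕ} (h : Runs p S S' T)
    (h' : Runs q S' S'' T') : Runs (p ;; q) S S'' (T + T') :=
  let ⟨_, ht, he⟩ := h; let ⟨_, ht', he'⟩ := h'; ⟨_, Nat.add_le_add ht ht', he.seq he'⟩

theorem Runs.ite_true {k : K} {f : Option (Γ k) → Bool} {p q : Prog Γ} {S S' : ∀ k, List (Γ k)}
    {T : ℕ} (hf : f (S k).head? = true) (h : Runs p S S' T) : Runs (.ite k f p q) S S' (T + 1) :=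
  let ⟨_, ht, he⟩ := h; ⟨_, Nat.add_le_add_right ht 1, .ite_true hf he⟩

theorem Runs.ite_false {k : K} {f : Option (Γ k) → Bool} {p q : Prog Γ} {S S' : ∀ k, List (Γ k)}
    {T : ℕ} (hf : f (S k).head? = false) (h : Runs q S S' T) : Runs (.ite k f p q) S S' (T + 1) :=
  let ⟨_, ht, he⟩ := h; ⟨_, Nat.add_le_add_right ht 1, .ite_false hf he⟩

theorem Runs.loop_true {k : K} {f : Option (Γ k) → Bool} {p : Prog Γ}
    {S S' S'' : ∀ k, List (Γ k)} {T T' : ℕ} (hf : f (S k).head? = true) (h : Runs p S S' T)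
    (h' : Runs (.loop k f p) S' S'' T') : Runs (.loop k f p) S S'' (T + T' + 1) :=
  let ⟨_, ht, he⟩ := h; let ⟨_, ht', he'⟩ := h'
  ⟨_, Nat.add_le_add_right (Nat.add_le_add ht ht') 1, .loop_true hf he he'⟩

theorem Runs.loop_false {k : K} {f : Option (Γ k) → Bool} {p : Prog Γ} {S : ∀ k, List (Γ k)}
    (hf : f (S k).head? = false) : Runs (.loop k f p) S S 1 := ⟨1, le_rfl, .loop_false hf⟩

theorem Runs.skip {S : ∀ k, List (Γ k)} : Runs .skip S S 1 := ⟨1, le_rfl, .skip S⟩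

theorem Runs.push {S : ∀ k, List (Γ k)} {k : K} {x : Γ k} :
    Runs (.push k x) S (Function.update S k (x :: S k)) 1 := ⟨1, le_rfl, .push S k x⟩

theorem Runs.pop {S : ∀ k, List (Γ k)} {k : K} :
    Runs (.pop k) S (Function.update S k (S k).tail) 1 := ⟨1, le_rfl, .pop S k⟩

/-- A step pushes at most one symbol. This turns time bounds into bounds on the size of results. -/
theorem Exec.length_le {p : Prog Γ} {S S' : ∀ k, List (Γ k)} {t : ℕ} (h : Exec p S S' t) (k : K) :
    (S' k).length ≤ (S k).length + t := by
  induction h with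
  | skip S => omega
  | push S k' x =>
    by_cases hk : k = k'
    · subst hk; simp
    · rw [Function.update_of_ne hk]; omega
  | pop S k' =>
    by_cases hk : k = k'
    · subst hk; simp; omega
    · rw [Function.update_of_ne hk]; omega
  | seq _ _ ih ih' => omega
  | ite_true _ _ ih => omega
  | ite_false _ _ ih => omega
  | loop_true _ _ _ ih ih' => omega
  | loop_false => omega

/-- The machine that runs a program and halts. -/
def machine [Fintype K] (k₀ k₁ : K) [Fintype (Γ k₀)] (p : Prog Γ) : FinTM2 where
  K := K
  k₀ := k₀
  k₁ := k₁
  Γ := Γ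
  Λ := Option (Lab p)
  main := some (entry p)
  ΛFin := @instFintypeOption _ (labFintype p)
  σ := Bool
  initialState := false
  m l := match l with
    | none => .halt
    | some l => code p some none l

theorem Runs.machine_evals [Fintype K] (k₀ k₁ : K) [Fintype (Γ k₀)] {p : Prog Γ}
    {S S' : ∀ k, List (Γ k)} {T : ℕ} (h : Runs p S S' T) :
    ∃ t ≤ T + 1, (flip Bind.bind (machine k₀ k₁ p).step)^[t]
      (some (⟨some (some (entry p)), false, S⟩ : TM2.Cfg Γ (Option (Lab p)) Bool)) =
      some (⟨none, false, S'⟩ : TM2.Cfg Γ (Option (Lab p)) Bool) := by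
  obtain ⟨t, ht, he⟩ := h
  -- The additional step executes `halt` at the label `none`.
  refine ⟨t + 1, by omega, ?_⟩
  exact (he.steps (M := (machine k₀ k₁ p).m) some none fun l => rfl).trans (Steps.one rfl)

end Compile

/-! ### Trees on a stack -/

/-- The stacks: one for input and output, the main stack of values, and three work stacks. -/
inductive Stk
  | io | main | a | b | c
  deriving DecidableEq

instance : Fintype Stk := ⟨{.io, .main, .a, .b, .c}, by intro x; cases x <;> simp⟩

/-- The alphabets of the stacks. -/
abbrev Sym : Stk → Type
  | .io => PartrecToTM2.Γ'
  | .main => Bool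
  | .a => Bool
  | .b => Bool
  | .c => Bool

abbrev Stks : Type := ∀ k, List (Sym k)

def mk (i : List PartrecToTM2.Γ') (m a b c : List Bool) : Stks
  | .io => i
  | .main => m
  | .a => a
  | .b => b
  | .c => c

section
variable (i x : List PartrecToTM2.Γ') (m a b c y : List Bool)

@[simp] theorem update_io : Function.update (mk i m a b c) .io x = mk x m a b c := by
  funext k; cases k <;> simp [mk]
@[simp] theorem update_main : Function.update (mk i m a b c) .main y = mk i y a b c := by
  funext k; cases k <;> simp [mk]
@[simp] theorem update_a : Function.update (mk i m a b c) .a y = mk i m y b c := by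
  funext k; cases k <;> simp [mk]
@[simp] theorem update_b : Function.update (mk i m a b c) .b y = mk i m a y c := by
  funext k; cases k <;> simp [mk]
@[simp] theorem update_c : Function.update (mk i m a b c) .c y = mk i m a b y := by
  funext k; cases k <;> simp [mk]
@[simp] theorem mk_io : mk i m a b c .io = i := rfl
@[simp] theorem mk_main : mk i m a b c .main = m := rfl
@[simp] theorem mk_a : mk i m a b c .a = a := rfl
@[simp] theorem mk_b : mk i m a b c .b = b := rfl
@[simp] theorem mk_c : mk i m a b c .c = c := rfl
end

abbrev SProg : Type := Prog Sym

/-- Binary trees, the universal data type. -/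
inductive Tr
  | leaf : Tr
  | node (l r : Tr) : Tr

/-- The prefix code of a tree. -/
def Tr.code : Tr → List Bool
  | .leaf => [false]
  | .node l r => true :: (l.code ++ r.code)

def Tr.size : Tr → ℕ
  | .leaf => 1
  | .node l r => l.size + r.size + 1

theorem Tr.length_code (t : Tr) : t.code.length = t.size := by
  induction t with
  | leaf => rfl
  | node l r ihl ihr => simp [Tr.code, Tr.size, ihl, ihr]

theorem Tr.size_pos (t : Tr) : 0 < t.size := by cases t <;> simp [Tr.size]

/-- The stacks between operations. -/
def st (s : List Bool) : Stks := mk [] s [] [] []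

def isT : Option Bool → Bool
  | some x => x
  | none => false

/-- Pour a work stack onto the main stack, reversing it. -/
def pourA : SProg := .loop .a Option.isSome
  (.ite .a isT (.pop .a ;; .push .main true) (.pop .a ;; .push .main false))

def pourB : SProg := .loop .b Option.isSome
  (.ite .b isT (.pop .b ;; .push .main true) (.pop .b ;; .push .main false))

/-- Pour the first work stack onto both the main stack and the second work stack. -/
def pourAB : SProg := .loop .a Option.isSome
  (.ite .a isT (.pop .a ;; .push .main true ;; .push .b true)
    (.pop .a ;; .push .main false ;; .push .b false))

def pourBA : SProg := .loop .b Option.isSome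
  (.ite .b isT (.pop .b ;; .push .a true) (.pop .b ;; .push .a false))

def clearA : SProg := .loop .a Option.isSome (.pop .a)

section
variable {i : List PartrecToTM2.Γ'} {m a b c : List Bool}

theorem push_io (x : PartrecToTM2.Γ') : Runs (.push .io x : SProg) (mk i m a b c) (mk (x :: i) m a b c) 1 := by
  simpa using Runs.push (Γ := Sym) (S := mk i m a b c) (k := .io) (x := x)
theorem pop_io : Runs (.pop .io : SProg) (mk i m a b c) (mk i.tail m a b c) 1 := by
  simpa using Runs.pop (Γ := Sym) (S := mk i m a b c) (k := .io)
theorem push_main (x : Bool) : Runs (.push .main x : SProg) (mk i m a b c) (mk i (x :: m) a b c) 1 := by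
  simpa using Runs.push (Γ := Sym) (S := mk i m a b c) (k := .main) (x := x)
theorem pop_main : Runs (.pop .main : SProg) (mk i m a b c) (mk i m.tail a b c) 1 := by
  simpa using Runs.pop (Γ := Sym) (S := mk i m a b c) (k := .main)
theorem push_a (x : Bool) : Runs (.push .a x : SProg) (mk i m a b c) (mk i m (x :: a) b c) 1 := by
  simpa using Runs.push (Γ := Sym) (S := mk i m a b c) (k := .a) (x := x)
theorem pop_a : Runs (.pop .a : SProg) (mk i m a b c) (mk i m a.tail b c) 1 := by
  simpa using Runs.pop (Γ := Sym) (S := mk i m a b c) (k := .a)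
theorem push_b (x : Bool) : Runs (.push .b x : SProg) (mk i m a b c) (mk i m a (x :: b) c) 1 := by
  simpa using Runs.push (Γ := Sym) (S := mk i m a b c) (k := .b) (x := x)
theorem pop_b : Runs (.pop .b : SProg) (mk i m a b c) (mk i m a b.tail c) 1 := by
  simpa using Runs.pop (Γ := Sym) (S := mk i m a b c) (k := .b)
theorem push_c (x : Bool) : Runs (.push .c x : SProg) (mk i m a b c) (mk i m a b (x :: c)) 1 := by
  simpa using Runs.push (Γ := Sym) (S := mk i m a b c) (k := .c) (x := x)
theorem pop_c : Runs (.pop .c : SProg) (mk i m a b c) (mk i m a b c.tail) 1 := by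
  simpa using Runs.pop (Γ := Sym) (S := mk i m a b c) (k := .c)

theorem runs_pourA : Runs pourA (mk i m a b c) (mk i (a.reverse ++ m) [] b c)
    (4 * a.length + 1) := by
  induction a generalizing m with
  | nil => exact Runs.loop_false rfl
  | cons x a ih =>
    have h := ih (m := x :: m)
    have hb : Runs (.ite .a isT (.pop .a ;; .push .main true) (.pop .a ;; .push .main false) : SProg)
        (mk i m (x :: a) b c) (mk i (x :: m) a b c) 3 := by
      cases x
      · exact Runs.ite_false rfl (pop_a.seq (push_main _))
      · exact Runs.ite_true rfl (pop_a.seq (push_main _))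
    have := (Runs.loop_true (f := Option.isSome) rfl hb h).mono
      (T' := 4 * (x :: a).length + 1) (by simp; omega)
    simpa [pourA] using this

theorem runs_pourB : Runs pourB (mk i m a b c) (mk i (b.reverse ++ m) a [] c)
    (4 * b.length + 1) := by
  induction b generalizing m with
  | nil => exact Runs.loop_false rfl
  | cons x b ih =>
    have h := ih (m := x :: m)
    have hb : Runs (.ite .b isT (.pop .b ;; .push .main true) (.pop .b ;; .push .main false) : SProg)
        (mk i m a (x :: b) c) (mk i (x :: m) a b c) 3 := by
      cases x
      · exact Runs.ite_false rfl (pop_b.seq (push_main _))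
      · exact Runs.ite_true rfl (pop_b.seq (push_main _))
    have := (Runs.loop_true (f := Option.isSome) rfl hb h).mono
      (T' := 4 * (x :: b).length + 1) (by simp; omega)
    simpa [pourB] using this

theorem runs_pourBA : Runs pourBA (mk i m a b c) (mk i m (b.reverse ++ a) [] c)
    (4 * b.length + 1) := by
  induction b generalizing a with
  | nil => exact Runs.loop_false rfl
  | cons x b ih =>
    have h := ih (a := x :: a)
    have hb : Runs (.ite .b isT (.pop .b ;; .push .a true) (.pop .b ;; .push .a false) : SProg)
        (mk i m a (x :: b) c) (mk i m (x :: a) b c) 3 := by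
      cases x
      · exact Runs.ite_false rfl (pop_b.seq (push_a _))
      · exact Runs.ite_true rfl (pop_b.seq (push_a _))
    have := (Runs.loop_true (f := Option.isSome) rfl hb h).mono
      (T' := 4 * (x :: b).length + 1) (by simp; omega)
    simpa [pourBA] using this

theorem runs_pourAB : Runs pourAB (mk i m a b c) (mk i (a.reverse ++ m) [] (a.reverse ++ b) c)
    (5 * a.length + 1) := by
  induction a generalizing m b with
  | nil => exact Runs.loop_false rfl
  | cons x a ih =>
    have h := ih (m := x :: m) (b := x :: b)
    have hb : Runs (.ite .a isT (.pop .a ;; .push .main true ;; .push .b true)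
        (.pop .a ;; .push .main false ;; .push .b false) : SProg)
        (mk i m (x :: a) b c) (mk i (x :: m) a (x :: b) c) 4 := by
      cases x
      · exact Runs.ite_false rfl (pop_a.seq ((push_main _).seq (push_b _)))
      · exact Runs.ite_true rfl (pop_a.seq ((push_main _).seq (push_b _)))
    have := (Runs.loop_true (f := Option.isSome) rfl hb h).mono
      (T' := 5 * (x :: a).length + 1) (by simp; omega)
    simpa [pourAB] using this

theorem runs_clearA : Runs clearA (mk i m a b c) (mk i m [] b c) (2 * a.length + 1) := by
  induction a with
  | nil => exact Runs.loop_false rfl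
  | cons x a ih =>
    have hb : Runs (.pop .a : SProg) (mk i m (x :: a) b c) (mk i m a b c) 1 := pop_a
    have := (Runs.loop_true (f := Option.isSome) rfl hb ih).mono
      (T' := 2 * (x :: a).length + 1) (by simp; omega)
    simpa [clearA] using this

/-- The height of stack `c` is the number of subtrees still to be read. The symbol `true` replaces
one awaited subtree by two, `false` completes one, so the loop ends exactly at the end of the first
tree: the prefix code delimits itself. -/
def mvALoop : SProg := .loop .c Option.isSome
  (.ite .main isT (.pop .main ;; .push .a true ;; .push .c true)
    (.pop .main ;; .push .a false ;; .pop .c))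

/-- Move the tree on top of the main stack to the first work stack, reversing it. -/
def mvA : SProg := .push .c true ;; mvALoop

def mvBLoop : SProg := .loop .c Option.isSome
  (.ite .main isT (.pop .main ;; .push .b true ;; .push .c true)
    (.pop .main ;; .push .b false ;; .pop .c))

/-- Move the tree on top of the main stack to the second work stack, reversing it. -/
def mvB : SProg := .push .c true ;; mvBLoop

/-- The hypothesis concerns the continuation of the loop after the tree has been moved. In this form
the induction hypotheses for the two subtrees of a node can be chained. Each symbol costs four steps
for the body and one for the test. -/
theorem runs_mvALoop (t : Tr) {S : Stks} {T : ℕ}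
    (h : Runs mvALoop (mk i m (t.code.reverse ++ a) b c) S T) :
    Runs mvALoop (mk i (t.code ++ m) a b (true :: c)) S (T + 5 * t.size) := by
  induction t generalizing m a c T with
  | leaf =>
    have hb : Runs (.ite .main isT (.pop .main ;; .push .a true ;; .push .c true)
        (.pop .main ;; .push .a false ;; .pop .c) : SProg)
        (mk i (false :: m) a b (true :: c)) (mk i m (false :: a) b c) 4 :=
      Runs.ite_false rfl (pop_main.seq ((push_a _).seq pop_c))
    exact (Runs.loop_true (f := Option.isSome) rfl hb h).mono (by simp [Tr.size]; omega)
  | node l r ihl ihr =>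
    have hb : Runs (.ite .main isT (.pop .main ;; .push .a true ;; .push .c true)
        (.pop .main ;; .push .a false ;; .pop .c) : SProg)
        (mk i (true :: (l.code ++ (r.code ++ m))) a b (true :: c))
        (mk i (l.code ++ (r.code ++ m)) (true :: a) b (true :: true :: c)) 4 :=
      Runs.ite_true rfl (pop_main.seq ((push_a _).seq (push_c _)))
    have h2 := ihl (m := r.code ++ m) (a := true :: a) (c := true :: c)
      (ihr (m := m) (a := l.code.reverse ++ true :: a) (c := c)
        (T := T) (by simpa [Tr.code] using h))
    have := (Runs.loop_true (f := Option.isSome) rfl hb h2).mono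
      (T' := T + 5 * (Tr.node l r).size) (by simp [Tr.size]; omega)
    simpa [Tr.code, mvALoop] using this

theorem runs_mvBLoop (t : Tr) {S : Stks} {T : ℕ}
    (h : Runs mvBLoop (mk i m a (t.code.reverse ++ b) c) S T) :
    Runs mvBLoop (mk i (t.code ++ m) a b (true :: c)) S (T + 5 * t.size) := by
  induction t generalizing m b c T with
  | leaf =>
    have hb : Runs (.ite .main isT (.pop .main ;; .push .b true ;; .push .c true)
        (.pop .main ;; .push .b false ;; .pop .c) : SProg)
        (mk i (false :: m) a b (true :: c)) (mk i m a (false :: b) c) 4 :=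
      Runs.ite_false rfl (pop_main.seq ((push_b _).seq pop_c))
    exact (Runs.loop_true (f := Option.isSome) rfl hb h).mono (by simp [Tr.size]; omega)
  | node l r ihl ihr =>
    have hb : Runs (.ite .main isT (.pop .main ;; .push .b true ;; .push .c true)
        (.pop .main ;; .push .b false ;; .pop .c) : SProg)
        (mk i (true :: (l.code ++ (r.code ++ m))) a b (true :: c))
        (mk i (l.code ++ (r.code ++ m)) a (true :: b) (true :: true :: c)) 4 :=
      Runs.ite_true rfl (pop_main.seq ((push_b _).seq (push_c _)))
    have h2 := ihl (m := r.code ++ m) (b := true :: b) (c := true :: c)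
      (ihr (m := m) (b := l.code.reverse ++ true :: b) (c := c)
        (T := T) (by simpa [Tr.code] using h))
    have := (Runs.loop_true (f := Option.isSome) rfl hb h2).mono
      (T' := T + 5 * (Tr.node l r).size) (by simp [Tr.size]; omega)
    simpa [Tr.code, mvBLoop] using this

theorem runs_mvA (t : Tr) : Runs mvA (mk i (t.code ++ m) a b []) (mk i m (t.code.reverse ++ a) b [])
    (5 * t.size + 2) :=
  ((push_c _).seq (runs_mvALoop t (T := 1) (Runs.loop_false rfl))).mono (by omega)

theorem runs_mvB (t : Tr) : Runs mvB (mk i (t.code ++ m) a b []) (mk i m a (t.code.reverse ++ b) [])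
    (5 * t.size + 2) :=
  ((push_c _).seq (runs_mvBLoop t (T := 1) (Runs.loop_false rfl))).mono (by omega)

end

/-- Remove the top tree. -/
def dropP : SProg := mvA ;; clearA

/-- Duplicate the top tree. -/
def dupP : SProg := mvA ;; pourAB ;; pourBA ;; pourA

/-- Swap the two top trees. -/
def swapP : SProg := mvA ;; mvB ;; pourA ;; pourB

/-- Turn the top trees `x, y, z` into `x, z, y`. -/
def rotP : SProg := mvA ;; mvB ;; mvA ;; pourB ;; pourA

theorem runs_dropP (t : Tr) (s : List Bool) :
    Runs dropP (st (t.code ++ s)) (st s) (7 * t.size + 3) :=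
  ((runs_mvA t).seq runs_clearA).mono (by simp [Tr.length_code]; omega)

theorem runs_dupP (t : Tr) (s : List Bool) :
    Runs dupP (st (t.code ++ s)) (st (t.code ++ (t.code ++ s))) (18 * t.size + 5) := by
  have := ((runs_mvA t).seq (runs_pourAB.seq (runs_pourBA.seq runs_pourA)) :
    Runs dupP (st (t.code ++ s)) _ _)
  simp only [List.append_nil, List.reverse_reverse] at this
  exact this.mono (by simp [Tr.length_code]; omega)

theorem runs_swapP (x y : Tr) (s : List Bool) :
    Runs swapP (st (x.code ++ (y.code ++ s))) (st (y.code ++ (x.code ++ s)))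
      (9 * x.size + 9 * y.size + 6) := by
  have := ((runs_mvA x).seq ((runs_mvB y).seq (runs_pourA.seq runs_pourB)) :
    Runs swapP (st (x.code ++ (y.code ++ s))) _ _)
  simp only [List.append_nil, List.reverse_reverse] at this
  exact this.mono (by simp [Tr.length_code]; omega)

theorem runs_rotP (x y z : Tr) (s : List Bool) :
    Runs rotP (st (x.code ++ (y.code ++ (z.code ++ s)))) (st (x.code ++ (z.code ++ (y.code ++ s))))
      (9 * x.size + 9 * y.size + 9 * z.size + 8) := by
  have := ((runs_mvA x).seq ((runs_mvB y).seq ((runs_mvA z).seq (runs_pourB.seq runs_pourA))) :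
    Runs rotP (st (x.code ++ (y.code ++ (z.code ++ s)))) _ _)
  simp only [List.append_nil, List.reverse_reverse, List.reverse_append, List.append_assoc] at this
  exact this.mono (by simp [Tr.length_code]; omega)

/-- Push a constant string; its last symbol ends up deepest. -/
def pushP : List Bool → SProg
  | [] => .skip
  | x :: l => pushP l ;; .push .main x

theorem runs_pushP (l : List Bool) (s : List Bool) :
    Runs (pushP l) (st s) (st (l ++ s)) (l.length + 1) := by
  induction l with
  | nil => exact Runs.skip
  | cons x l ih => exact ih.seq (push_main x)

/-! ### Polynomial time functions between encoded types -/

/-- Types whose elements are encoded by trees. -/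
class Enc (α : Type) where
  enc : α → Tr

open Enc

def natTr : ℕ → Tr
  | 0 => .leaf
  | n + 1 => .node .leaf (natTr n)

def listTr {α : Type} [Enc α] : List α → Tr
  | [] => .leaf
  | a :: l => .node (enc a) (listTr l)

instance : Enc Tr := ⟨id⟩
instance : Enc Unit := ⟨fun _ => .leaf⟩
-- Propositions are data like any other, so a decidable predicate is a polynomial time function with
-- values in `Prop`.
open Classical in
noncomputable instance : Enc Prop := ⟨fun p => if p then .node .leaf .leaf else .leaf⟩
instance : Enc Bool := ⟨fun b => bif b then .node .leaf .leaf else .leaf⟩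
instance : Enc ℕ := ⟨natTr⟩
instance {α : Type} [Enc α] : Enc (List α) := ⟨listTr⟩
instance {α β : Type} [Enc α] [Enc β] : Enc (α × β) := ⟨fun p => .node (enc p.1) (enc p.2)⟩

section
variable {α β γ σ : Type} [Enc α] [Enc β] [Enc γ] [Enc σ]

theorem enc_true {p : Prop} (h : p) : enc p = .node .leaf .leaf := if_pos h
theorem enc_false {p : Prop} (h : ¬ p) : enc p = .leaf := if_neg h
theorem enc_cons (a : α) (l : List α) : enc (a :: l) = .node (enc a) (enc l) := rfl
theorem enc_pair (p : α × β) : enc p = .node (enc p.1) (enc p.2) := rfl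

/-- The size of an encoded element. -/
def sz (a : α) : ℕ := (enc a).size

theorem sz_pos (a : α) : 0 < sz a := Tr.size_pos _
theorem sz_pair (a : α) (b : β) : sz (a, b) = sz a + sz b + 1 := rfl
theorem sz_nil : sz ([] : List α) = 1 := rfl
theorem sz_cons (a : α) (l : List α) : sz (a :: l) = sz a + sz l + 1 := rfl
theorem sz_nat (n : ℕ) : sz n = 2 * n + 1 := by
  induction n with
  | zero => rfl
  | succ n ih =>
    have : sz (n + 1) = 1 + sz n + 1 := rfl
    omega
theorem sz_prop (p : Prop) : sz p ≤ 3 := by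
  by_cases h : p
  · rw [sz, enc_true h]; simp [Tr.size]
  · rw [sz, enc_false h]; simp [Tr.size]
theorem sz_bool (p : Bool) : sz p ≤ 3 := by cases p <;> simp [sz, enc, Tr.size]
theorem sz_append (l l' : List α) : sz (l ++ l') + 1 = sz l + sz l' := by
  induction l with
  | nil => simp [sz_nil]; omega
  | cons a l ih => simp only [List.cons_append, sz_cons]; omega
theorem length_lt_sz (l : List α) : l.length < sz l := by
  induction l with
  | nil => simp [sz_nil]
  | cons a l ih => simp only [List.length_cons, sz_cons]; have := sz_pos a; omega
theorem sz_le_of_mem {a : α} {l : List α} (h : a ∈ l) : sz a < sz l := by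
  induction l with
  | nil => simp at h
  | cons b l ih =>
    rw [sz_cons]
    rcases List.mem_cons.1 h with rfl | h
    · omega
    · have := ih h; omega
theorem sz_le_mul {l : List α} {m : ℕ} (h : ∀ a ∈ l, sz a ≤ m) :
    sz l ≤ l.length * (m + 1) + 1 := by
  induction l with
  | nil => simp [sz_nil]
  | cons b l ih =>
    rw [sz_cons, List.length_cons, Nat.succ_mul]
    have h1 := h b (by simp)
    have h2 := ih fun a ha => h a (by simp [ha])
    omega

theorem eval_mono (p : Polynomial ℕ) {x y : ℕ} (h : x ≤ y) : p.eval x ≤ p.eval y := by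
  rw [Polynomial.eval_eq_sum_range, Polynomial.eval_eq_sum_range]
  gcongr

/-- Polynomially bounded functions. -/
def Bd (g : α → ℕ) : Prop := ∃ p : Polynomial ℕ, ∀ a, g a ≤ p.eval (sz a)

theorem Bd.mono {g g' : α → ℕ} (h : Bd g) (hg : ∀ a, g' a ≤ g a) : Bd g' :=
  let ⟨p, hp⟩ := h; ⟨p, fun a => (hg a).trans (hp a)⟩
theorem Bd.const (c : ℕ) : Bd fun _ : α => c := ⟨Polynomial.C c, fun a => by simp⟩
theorem Bd.sz : Bd fun a : α => sz a := ⟨Polynomial.X, fun a => by simp⟩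
theorem Bd.add {g g' : α → ℕ} (h : Bd g) (h' : Bd g') : Bd fun a => g a + g' a :=
  let ⟨p, hp⟩ := h; let ⟨p', hp'⟩ := h'
  ⟨p + p', fun a => by rw [Polynomial.eval_add]; exact Nat.add_le_add (hp a) (hp' a)⟩
theorem Bd.mul {g g' : α → ℕ} (h : Bd g) (h' : Bd g') : Bd fun a => g a * g' a :=
  let ⟨p, hp⟩ := h; let ⟨p', hp'⟩ := h'
  ⟨p * p', fun a => by rw [Polynomial.eval_mul]; exact Nat.mul_le_mul (hp a) (hp' a)⟩
theorem Bd.eval {g : α → ℕ} (h : Bd g) (q : Polynomial ℕ) : Bd fun a => q.eval (g a) :=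
  let ⟨p, hp⟩ := h
  ⟨q.comp p, fun a => by rw [Polynomial.eval_comp]; exact eval_mono _ (hp a)⟩

/-- Polynomial time computability by stack programs. -/
@[fun_prop]
def PT (f : α → β) : Prop :=
  ∃ (P : SProg) (T : α → ℕ), Bd T ∧
    ∀ a s, Runs P (st ((enc a).code ++ s)) (st ((enc (f a)).code ++ s)) (T a)

/-- A result cannot be longer than the input plus the running time. Bounds on sizes thus come for
free, and composition needs no separate hypothesis on them. -/
theorem PT.bd {f : α → β} (h : PT f) : Bd fun a => sz (f a) := by
  obtain ⟨P, T, hT, h⟩ := h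
  refine (Bd.sz.add hT).mono fun a => ?_
  obtain ⟨t, ht, he⟩ := h a []
  have := he.length_le .main
  simp only [st, mk_main, List.append_nil, Tr.length_code] at this
  exact this.trans (Nat.add_le_add_left ht _)

theorem Bd.comp {g : β → ℕ} (h : Bd g) {f : α → β} (hf : PT f) : Bd fun a => g (f a) :=
  let ⟨p, hp⟩ := h
  (hf.bd.eval p).mono fun a => hp (f a)

/-- A function that does not change the encoding. -/
theorem PT.of_enc_eq {f : α → β} (h : ∀ a, enc (f a) = enc a) : PT f :=
  ⟨.skip, fun _ => 1, Bd.const 1, fun a s => by rw [h]; exact Runs.skip⟩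

@[fun_prop]
theorem PT.id : PT fun a : α => a := .of_enc_eq fun _ => rfl

@[fun_prop]
theorem PT.const (b : β) : PT fun _ : α => b :=
  ⟨dropP ;; pushP (enc b).code, _, ((Bd.sz.mul (.const 7)).add (.const (3 + ((enc b).code.length + 1)))),
    fun a s => ((runs_dropP _ _).seq (runs_pushP _ _)).mono (by simp only [StackProg.sz]; omega)⟩

@[fun_prop]
theorem PT.comp {g : β → γ} {f : α → β} (hg : PT g) (hf : PT f) : PT fun a => g (f a) := by
  have hf' := hf
  obtain ⟨P, T, hT, hf⟩ := hf
  obtain ⟨P', T', hT', hg⟩ := hg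
  exact ⟨P ;; P', _, hT.add (hT'.comp hf'), fun a s => (hf a s).seq (hg (f a) s)⟩

@[fun_prop]
theorem PT.fst : PT fun p : α × β => p.1 :=
  ⟨.pop .main ;; swapP ;; dropP, _, (Bd.sz.mul (.const 16)).add (.const 10), fun p s => by
    have := (pop_main (i := []) (m := true :: ((enc p.1).code ++ ((enc p.2).code ++ s)))
      (a := []) (b := []) (c := [])).seq ((runs_swapP (enc p.1) (enc p.2) s).seq (runs_dropP _ _))
    simp only [enc_pair, Tr.code, List.cons_append, List.append_assoc]
    refine this.mono ?_
    rcases p with ⟨a, b⟩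
    simp only [sz_pair]; simp only [sz]; omega⟩

@[fun_prop]
theorem PT.snd : PT fun p : α × β => p.2 :=
  ⟨.pop .main ;; dropP, _, (Bd.sz.mul (.const 16)).add (.const 10), fun p s => by
    have := (pop_main (i := []) (m := true :: ((enc p.1).code ++ ((enc p.2).code ++ s)))
      (a := []) (b := []) (c := [])).seq (runs_dropP (enc p.1) _)
    simp only [enc_pair, Tr.code, List.cons_append, List.append_assoc]
    refine this.mono ?_
    rcases p with ⟨a, b⟩
    simp only [sz_pair]; simp only [sz]; omega⟩

/-- The encodings of two results side by side on the main stack. -/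
theorem runs_both {f : α → β} {g : α → γ} (hf : PT f) (hg : PT g) :
    ∃ (P : SProg) (T : α → ℕ), Bd T ∧ ∀ a s, Runs P (st ((enc a).code ++ s))
      (st ((enc (f a)).code ++ ((enc (g a)).code ++ s))) (T a) := by
  have hg' := hg
  obtain ⟨P, T, hT, hf⟩ := hf
  obtain ⟨P', T', hT', hg⟩ := hg
  refine ⟨dupP ;; P' ;; swapP ;; P, _, (((Bd.sz.mul (.const 27)).add
    ((hT.add hT').add (hg'.bd.mul (.const 9)))).add (.const 20)), fun a s => ?_⟩
  refine ((runs_dupP _ _).seq ((hg a _).seq ((runs_swapP _ _ _).seq (hf a _)))).mono ?_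
  simp only [sz]; omega

@[fun_prop]
theorem PT.pair {f : α → β} {g : α → γ} (hf : PT f) (hg : PT g) : PT fun a => (f a, g a) := by
  obtain ⟨P, T, hT, h⟩ := runs_both hf hg
  refine ⟨P ;; .push .main true, _, hT.add (.const 1), fun a s => ?_⟩
  simp only [enc_pair, Tr.code, List.cons_append, List.append_assoc]
  exact (h a s).seq (push_main true)

/-- Case distinction. -/
@[fun_prop]
theorem PT.ite {c : α → Prop} [∀ a, Decidable (c a)] {f g : α → β} (hc : PT c) (hf : PT f)
    (hg : PT g) : PT fun a => if c a then f a else g a := by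
  obtain ⟨P, T, hT, hc⟩ := hc
  obtain ⟨Q, T', hT', hf⟩ := hf
  obtain ⟨R, T'', hT'', hg⟩ := hg
  -- A true proposition is encoded by three symbols and a false one by a single symbol, which
  -- accounts for the pops in the two branches.
  refine ⟨dupP ;; P ;; .ite .main isT (.pop .main ;; .pop .main ;; .pop .main ;; Q)
    (.pop .main ;; R), _, (((hT.add hT').add hT'').add ((Bd.sz.mul (.const 18)).add (.const 10))),
    fun a s => ?_⟩
  have h1 := (runs_dupP _ _).seq (hc a ((enc a).code ++ s))
  by_cases h : c a
  · rw [enc_true h] at h1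
    have h2 := Runs.ite_true (k := .main) (f := isT) (q := .pop .main ;; R) rfl
      ((pop_main (i := []) (m := true :: false :: false :: ((enc a).code ++ s))
        (a := []) (b := []) (c := [])).seq (pop_main.seq (pop_main.seq (hf a s))))
    simp only [if_pos h]
    refine ((runs_dupP _ _).seq ((hc a ((enc a).code ++ s)).seq ?_)).mono
      (T := (18 * (enc a).size + 5) + (T a + ((1 + (1 + (1 + T' a))) + 1))) ?_
    · rw [enc_true h]; exact h2
    · simp only [sz]; omega
  · have h2 := Runs.ite_false (k := .main) (f := isT)
      (p := .pop .main ;; .pop .main ;; .pop .main ;; Q) rfl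
      ((pop_main (i := []) (m := false :: ((enc a).code ++ s))
        (a := []) (b := []) (c := [])).seq (hg a s))
    simp only [if_neg h]
    refine ((runs_dupP _ _).seq ((hc a ((enc a).code ++ s)).seq ?_)).mono
      (T := (18 * (enc a).size + 5) + (T a + ((1 + T'' a) + 1))) ?_
    · rw [enc_false h]; exact h2
    · simp only [sz]; omega

/-- The encoding is not a leaf. -/
def Tr.IsNode : Tr → Prop
  | .leaf => False
  | .node _ _ => True

def Tr.left : Tr → Tr
  | .leaf => .leaf
  | .node l _ => l

def Tr.right : Tr → Tr
  | .leaf => .leaf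
  | .node _ r => r

theorem runs_pop_node (x y : Tr) (s : List Bool) : Runs (.pop .main : SProg)
    (st ((Tr.node x y).code ++ s)) (st (x.code ++ (y.code ++ s))) 1 := by
  have := pop_main (i := []) (m := true :: (x.code ++ (y.code ++ s))) (a := []) (b := []) (c := [])
  simp only [Tr.code, List.cons_append, List.append_assoc]
  exact this

theorem runs_ite_node {x y : Tr} {s : List Bool} {P Q : SProg} {S : Stks} {T : ℕ}
    (h : Runs P (st ((Tr.node x y).code ++ s)) S T) :
    Runs (.ite .main isT P Q) (st ((Tr.node x y).code ++ s)) S (T + 1) :=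
  Runs.ite_true rfl h

theorem runs_ite_leaf {s : List Bool} {P Q : SProg} {S : Stks} {T : ℕ}
    (h : Runs Q (st (Tr.leaf.code ++ s)) S T) :
    Runs (.ite .main isT P Q) (st (Tr.leaf.code ++ s)) S (T + 1) :=
  Runs.ite_false rfl h

theorem PT.isNode : PT Tr.IsNode := by
  refine ⟨.ite .main isT (dropP ;; pushP [true, false, false]) .skip, _,
    ((Bd.sz.mul (.const 7)).add (.const 10)), fun t s => ?_⟩
  cases t with
  | leaf =>
    rw [enc_false (p := Tr.IsNode Tr.leaf) (fun h => h)]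
    exact (runs_ite_leaf Runs.skip).mono (by omega)
  | node l r =>
    rw [enc_true (p := Tr.IsNode (.node l r)) trivial]
    exact (runs_ite_node ((runs_dropP (.node l r) s).seq (runs_pushP _ _))).mono
      (by simp [sz, enc]; omega)

theorem PT.left : PT Tr.left := by
  refine ⟨.ite .main isT (.pop .main ;; swapP ;; dropP) .skip, _,
    ((Bd.sz.mul (.const 16)).add (.const 12)), fun t s => ?_⟩
  cases t with
  | leaf => exact (runs_ite_leaf Runs.skip).mono (by omega)
  | node l r =>
    exact (runs_ite_node ((runs_pop_node l r s).seq ((runs_swapP _ _ _).seq (runs_dropP _ _)))).mono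
      (by simp [sz, enc, Tr.size]; omega)

theorem PT.right : PT Tr.right := by
  refine ⟨.ite .main isT (.pop .main ;; dropP) .skip, _,
    ((Bd.sz.mul (.const 16)).add (.const 12)), fun t s => ?_⟩
  cases t with
  | leaf => exact (runs_ite_leaf Runs.skip).mono (by omega)
  | node l r =>
    exact (runs_ite_node ((runs_pop_node l r s).seq (runs_dropP _ _))).mono
      (by simp [sz, enc, Tr.size]; omega)

/-- A function that acts on encodings as a polynomial time function of trees. -/
theorem PT.of_tr {F : Tr → Tr} (hF : PT F) {f : α → β} (h : ∀ a, enc (f a) = F (enc a)) : PT f := by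
  have h1 : PT fun a : α => (enc a : Tr) := .of_enc_eq fun _ => rfl
  obtain ⟨P, T, hT, hP⟩ := hF.comp h1
  exact ⟨P, T, hT, fun a s => by rw [h]; exact hP a s⟩

theorem PT.of_isNode {f : α → Prop} (h : ∀ a, f a ↔ Tr.IsNode (enc a)) : PT f := by
  have : f = fun a => Tr.IsNode (enc a) := funext fun a => propext (h a)
  rw [this]
  exact PT.isNode.comp (.of_enc_eq (f := fun a : α => (enc a : Tr)) fun _ => rfl)

/-- Folding over a list, as long as the intermediate results stay small. -/
theorem PT.foldl_of_bd {h : β × σ → σ} (hh : PT h) {f : α → List β} {g : α → σ} (hf : PT f)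
    (hg : PT g) {B : α → ℕ} (hB : Bd B)
    (H : ∀ a l₁ l₂, f a = l₁ ++ l₂ → sz (l₁.foldl (fun s b => h (b, s)) (g a)) ≤ B a) :
    PT fun a => (f a).foldl (fun s b => h (b, s)) (g a) := by
  obtain ⟨P, T, hT, hP⟩ := runs_both hf hg
  obtain ⟨Q, T', ⟨p, hp⟩, hQ⟩ := hh
  -- On the stack lie the rest of the list and below it the accumulator `v`. Popping the node symbol
  -- leaves `b, l₂, v`, rotating gives `b, v, l₂`, and the pushed symbol joins `b` and `v` into the
  -- argument of `Q`. The swap brings the rest of the list back to the top; the loop stops at the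
  -- leaf that encodes the empty list.
  set L : SProg := .loop .main isT (.pop .main ;; rotP ;; .push .main true ;; Q ;; swapP) with hL
  -- `D a` bounds the cost of one round: the moves are linear in the list and the accumulator, and
  -- the last summand bounds `Q` on a pair of such sizes.
  set D : α → ℕ := fun a => sz (f a) * 18 + B a * 18 + 20 + p.eval (sz (f a) + B a + 1) with hD
  have hDB : Bd D := (((hf.bd.mul (.const 18)).add (hB.mul (.const 18))).add (.const 20)).add
    (((hf.bd.add hB).add (.const 1)).eval p)
  refine ⟨P ;; L ;; .pop .main, _, hT.add (((hf.bd.mul hDB).add (.const 1)).add (.const 1)),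
    fun a s => (hP a s).seq ?_⟩
  have key : ∀ l₂ l₁ : List β, f a = l₁ ++ l₂ →
      Runs L (st ((enc l₂).code ++ ((enc (l₁.foldl (fun s b => h (b, s)) (g a))).code ++ s)))
        (st (false :: ((enc ((f a).foldl (fun s b => h (b, s)) (g a))).code ++ s)))
        (l₂.length * D a + 1) := by
    intro l₂
    induction l₂ with
    | nil =>
      intro l₁ h1
      rw [h1, List.append_nil]
      exact (Runs.loop_false rfl).mono (by simp)
    | cons b l₂ ih =>
      intro l₁ h1
      have h2 := ih (l₁ ++ [b]) (by simp [h1])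
      set v := l₁.foldl (fun s b => h (b, s)) (g a) with hv
      have hv' : (l₁ ++ [b]).foldl (fun s b => h (b, s)) (g a) = h (b, v) := by simp [hv]
      have hs := H a l₁ _ h1
      have hs' := H a (l₁ ++ [b]) l₂ (by simp [h1])
      rw [hv'] at h2 hs'
      rw [← hv] at hs
      have hQ' : ∀ s, Runs Q (st (true :: ((enc b).code ++ ((enc v).code ++ s))))
          (st ((enc (h (b, v))).code ++ s)) (T' (b, v)) := fun s => by
        simpa [enc_pair, Tr.code] using hQ (b, v) s
      have hbody : Runs (.pop .main ;; rotP ;; .push .main true ;; Q ;; swapP)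
          (st ((enc (b :: l₂)).code ++ ((enc v).code ++ s)))
          (st ((enc l₂).code ++ ((enc (h (b, v))).code ++ s))) _ :=
        (runs_pop_node _ _ _).seq ((runs_rotP _ _ _ _).seq ((push_main true).seq
          (Runs.seq (hQ' ((enc l₂).code ++ s))
            (runs_swapP _ _ _))))
      refine (Runs.loop_true rfl hbody h2).mono ?_
      have hsz : sz b + sz l₂ + sz l₁ ≤ sz (f a) := by
        have := sz_append l₁ (b :: l₂)
        rw [← h1, sz_cons] at this; omega
      have hp1 := hp (b, v)
      have hp2 := eval_mono p (x := sz (b, v)) (y := sz (f a) + B a + 1)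
        (by rw [sz_pair]; omega)
      have := sz_pos l₁
      rw [show listTr l₂ = enc l₂ from rfl]
      simp only [List.length_cons, Nat.succ_mul]
      simp only [sz, hD] at *
      omega
  have h0 := key (f a) [] rfl
  have h3 := h0.seq (q := .pop .main) (pop_main (i := []) (a := []) (b := []) (c := []))
  refine h3.mono ?_
  have : (f a).length * D a ≤ sz (f a) * D a :=
    Nat.mul_le_mul_right _ (length_lt_sz _).le
  simpa using this

end

/-! ### A library of polynomial time functions -/

section
variable {α β γ σ : Type} [Enc α] [Enc β] [Enc γ] [Enc σ]

/-- The step function may depend on the input `a`, which is carried along inside the accumulator. -/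
theorem PT.foldl {h : α → σ → β → σ} (hh : PT fun x : α × σ × β => h x.1 x.2.1 x.2.2)
    {f : α → List β} {g : α → σ} (hf : PT f) (hg : PT g) {B : α → ℕ} (hB : Bd B)
    (H : ∀ a l₁ l₂, f a = l₁ ++ l₂ → sz (l₁.foldl (h a) (g a)) ≤ B a) :
    PT fun a => (f a).foldl (h a) (g a) := by
  have key : ∀ a (l : List β) s,
      l.foldl (fun (s : α × σ) b => (s.1, h s.1 s.2 b)) (a, s) = (a, l.foldl (h a) s) := by
    intro a l
    induction l with
    | nil => intro s; rfl
    | cons b l ih => intro s; exact ih _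
  have hh' : PT fun x : β × α × σ => (x.2.1, h x.2.1 x.2.2 x.1) :=
    PT.pair (by fun_prop) (hh.comp (f := fun x : β × α × σ => (x.2.1, x.2.2, x.1)) (by fun_prop))
  have := PT.foldl_of_bd hh' hf (PT.pair PT.id hg) ((Bd.sz.add hB).add (.const 1))
    (fun a l₁ l₂ hl => by
      have := H a l₁ l₂ hl
      simp only [key, sz_pair]
      omega)
  have h2 := PT.snd.comp this
  simpa only [key] using h2

/-- A common bound for the results of a function on the elements of a list. -/
theorem PT.bd_mem {h : α → β → γ} (hh : PT fun x : α × β => h x.1 x.2) {f : α → List β}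
    (hf : PT f) : ∃ B : α → ℕ, Bd B ∧ ∀ a, ∀ b ∈ f a, sz (h a b) ≤ B a := by
  obtain ⟨p, hp⟩ := hh.bd
  refine ⟨fun a => p.eval (sz a + sz (f a) + 1), ((Bd.sz.add hf.bd).add (.const 1)).eval p,
    fun a b hb => (hp (a, b)).trans (eval_mono _ ?_)⟩
  have := sz_le_of_mem hb
  rw [sz_pair]; omega

@[fun_prop]
theorem PT.not {p : α → Prop} (hp : PT p) : PT fun a => ¬ p a := by
  classical
  have h : PT fun a => if p a then False else True := by fun_prop
  refine cast (congrArg PT (funext fun a => ?_)) h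
  by_cases h : p a <;> simp [h]

@[fun_prop]
theorem PT.and {p q : α → Prop} (hp : PT p) (hq : PT q) : PT fun a => p a ∧ q a := by
  classical
  have h : PT fun a => if p a then q a else False := by fun_prop
  refine cast (congrArg PT (funext fun a => ?_)) h
  by_cases h : p a <;> simp [h]

@[fun_prop]
theorem PT.or {p q : α → Prop} (hp : PT p) (hq : PT q) : PT fun a => p a ∨ q a := by
  classical
  have h : PT fun a => if p a then True else q a := by fun_prop
  refine cast (congrArg PT (funext fun a => ?_)) h
  by_cases h : p a <;> simp [h]

@[fun_prop]
theorem PT.iff {p q : α → Prop} (hp : PT p) (hq : PT q) : PT fun a => p a ↔ q a := by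
  classical
  have h : PT fun a => if p a then q a else ¬ q a := by fun_prop
  refine cast (congrArg PT (funext fun a => ?_)) h
  by_cases h : p a <;> simp [h]

theorem enc_decide (p : Prop) [Decidable p] : enc (decide p) = enc p := by
  by_cases h : p
  · rw [enc_true h, decide_eq_true h]; rfl
  · rw [enc_false h, decide_eq_false h]; rfl

@[fun_prop]
theorem PT.decide {p : α → Prop} [∀ a, Decidable (p a)] (hp : PT p) :
    PT fun a => decide (p a) :=
  (PT.of_enc_eq (f := fun p : Prop => @Decidable.decide p (Classical.dec p))
    fun p => @enc_decide p (Classical.dec p)).comp hp |> cast (by congr!)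

@[fun_prop]
theorem PT.eq_true {f : α → Bool} (hf : PT f) : PT fun a => f a = true :=
  (PT.of_enc_eq (f := fun b : Bool => b = true) fun b => by
    cases b
    · rw [enc_false (by simp)]; rfl
    · rw [enc_true rfl]; rfl).comp hf

@[fun_prop]
theorem PT.cons {f : α → β} {g : α → List β} (hf : PT f) (hg : PT g) :
    PT fun a => f a :: g a :=
  (PT.of_enc_eq (f := fun p : β × List β => p.1 :: p.2) fun _ => rfl).comp (hf.pair hg)

@[fun_prop]
theorem PT.tail {f : α → List β} (hf : PT f) : PT fun a => (f a).tail :=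
  (PT.of_tr PT.right (f := fun l : List β => l.tail) fun l => by cases l <;> rfl).comp hf

/-- Taking the left subtree sends the leaf, which encodes the empty list, to a leaf. This forces the
encoding of the default value. -/
theorem PT.headD {d : β} (hd : enc d = .leaf) {f : α → List β} (hf : PT f) :
    PT fun a => (f a).headD d :=
  (PT.of_tr PT.left (f := fun l : List β => l.headD d) fun l => by
    cases l
    · exact hd
    · rfl).comp hf

@[fun_prop]
theorem PT.ne_nil {f : α → List β} (hf : PT f) : PT fun a => f a ≠ [] :=
  (PT.of_isNode (f := fun l : List β => l ≠ []) fun l => by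
    cases l <;> simp [enc, listTr, Tr.IsNode]).comp hf

@[fun_prop]
theorem PT.reverse {f : α → List β} (hf : PT f) : PT fun a => (f a).reverse := by
  have h : PT fun l : List β => l.foldl (fun s b => b :: s) [] :=
    PT.foldl (h := fun _ s b => b :: s) (by fun_prop) PT.id (PT.const []) Bd.sz
      fun l l₁ l₂ hl => by
        have h1 : ∀ (l s : List β), sz (l.foldl (fun s b => b :: s) s) + 1 = sz l + sz s := by
          intro l
          induction l with
          | nil => intro s; simp [sz_nil]; omega
          | cons a l ih => intro s; have := ih (a :: s); simp only [List.foldl_cons, sz_cons] at *; omega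
        have h2 := h1 l₁ []
        have h3 := sz_append l₁ l₂
        have h4 := sz_pos l₂
        rw [← hl] at h3
        rw [sz_nil] at h2
        omega
  simpa using h.comp hf

@[fun_prop]
theorem PT.append {f g : α → List β} (hf : PT f) (hg : PT g) : PT fun a => f a ++ g a := by
  have h : PT fun p : List β × List β => p.1.reverse.foldl (fun s b => b :: s) p.2 :=
    PT.foldl (h := fun _ s b => b :: s) (by fun_prop) (by fun_prop) (by fun_prop)
      (((PT.reverse PT.fst).bd.add Bd.sz)) fun l l₁ l₂ hl => by
        have h1 : ∀ (l s : List β), sz (l.foldl (fun s b => b :: s) s) + 1 = sz l + sz s := by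
          intro l
          induction l with
          | nil => intro s; simp [sz_nil]; omega
          | cons a l ih => intro s; have := ih (a :: s); simp only [List.foldl_cons, sz_cons] at *; omega
        have h2 := h1 l₁ l.2
        have h3 := sz_append l₁ l₂
        have h4 := sz_pos l₂
        rw [← hl] at h3
        rcases l with ⟨l, l'⟩
        rw [sz_pair]
        dsimp only at *
        omega
  simpa using h.comp (hf.pair hg)

theorem PT.flatMap {h : α → β → List γ} (hh : PT fun x : α × β => h x.1 x.2) {f : α → List β}
    (hf : PT f) : PT fun a => (f a).flatMap (h a) := by
  obtain ⟨B, hB, hh'⟩ := hh.bd_mem hf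
  have key : ∀ a (l : List β) s, l.foldl (fun s b => s ++ h a b) s = s ++ l.flatMap (h a) := by
    intro a l
    induction l with
    | nil => intro s; simp
    | cons b l ih => intro s; simp [ih]
  have hB' : ∀ a (l : List β), (∀ b ∈ l, sz (h a b) ≤ B a) →
      sz (l.flatMap (h a)) ≤ l.length * B a + 1 := by
    intro a l
    induction l with
    | nil => intro _; simp [sz_nil]
    | cons b l ih =>
      intro hl
      have h1 := ih fun b hb => hl b (by simp [hb])
      have h2 := hl b (by simp)
      have h3 := sz_append (h a b) (l.flatMap (h a))
      rw [List.flatMap_cons, List.length_cons, Nat.succ_mul]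
      omega
  have := PT.foldl (h := fun a s b => s ++ h a b)
    (PT.append (by fun_prop) (hh.comp (f := fun x : α × List γ × β => (x.1, x.2.2)) (by fun_prop)))
    hf (PT.const []) ((hf.bd.mul hB).add (.const 1)) fun a l₁ l₂ hl => by
      rw [key, List.nil_append]
      refine (hB' a l₁ fun b hb => hh' a b (by simp [hl, hb])).trans ?_
      have h1 := length_lt_sz (f a)
      rw [hl, List.length_append, ← hl] at h1
      exact Nat.add_le_add_right (Nat.mul_le_mul_right _ (by omega)) 1
  simpa only [key, List.nil_append] using this

theorem PT.map {h : α → β → γ} (hh : PT fun x : α × β => h x.1 x.2) {f : α → List β}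
    (hf : PT f) : PT fun a => (f a).map (h a) := by
  have := PT.flatMap (h := fun a b => [h a b]) (by fun_prop) hf
  simpa only [List.flatMap_singleton', List.flatMap_pure_eq_map, ← List.map_eq_flatMap] using this

theorem PT.filter {p : α → β → Prop} [∀ a b, Decidable (p a b)]
    (hp : PT fun x : α × β => p x.1 x.2) {f : α → List β} (hf : PT f) :
    PT fun a => (f a).filter fun b => p a b := by
  have := PT.flatMap (h := fun a b => if p a b then [b] else []) (by fun_prop) hf
  refine cast (congrArg PT (funext fun a => ?_)) this
  induction f a with
  | nil => rfl
  | cons b l ih => by_cases h : p a b <;> simp [h, ih]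

@[fun_prop]
theorem PT.exists_mem {p : α → β → Prop} (hp : PT fun x : α × β => p x.1 x.2) {f : α → List β}
    (hf : PT f) : PT fun a => ∃ b ∈ f a, p a b := by
  classical
  have := (PT.filter hp hf).ne_nil
  refine cast (congrArg PT (funext fun a => ?_)) this
  simp [List.filter_eq_nil_iff]

@[fun_prop]
theorem PT.forall_mem {p : α → β → Prop} (hp : PT fun x : α × β => p x.1 x.2) {f : α → List β}
    (hf : PT f) : PT fun a => ∀ b ∈ f a, p a b := by
  have : PT fun a => ¬ ∃ b ∈ f a, ¬ p a b := by fun_prop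
  refine cast (congrArg PT (funext fun a => ?_)) this
  simp

/-- Numbers are encoded in unary, that is, exactly like lists of units; arithmetic thereby reduces
to list operations. -/
theorem enc_replicate (n : ℕ) : enc (List.replicate n ()) = enc n := by
  induction n with
  | zero => rfl
  | succ n ih => rw [List.replicate_succ, enc_cons, ih]; rfl

@[fun_prop]
theorem PT.units {f : α → ℕ} (hf : PT f) : PT fun a => List.replicate (f a) () :=
  (PT.of_enc_eq enc_replicate).comp hf

@[fun_prop]
theorem PT.length {f : α → List β} (hf : PT f) : PT fun a => (f a).length := by
  have h : PT fun l : List Unit => l.length := .of_enc_eq fun l => by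
    rw [← enc_replicate]; congr; exact (List.eq_replicate_of_mem fun _ _ => rfl).symm
  simpa using h.comp (PT.map (h := fun _ _ => ()) (by fun_prop) hf)

@[fun_prop]
theorem PT.add {f g : α → ℕ} (hf : PT f) (hg : PT g) : PT fun a => f a + g a := by
  have : PT fun a => (List.replicate (f a) () ++ List.replicate (g a) ()).length := by fun_prop
  simpa using this

@[fun_prop]
theorem PT.mul {f g : α → ℕ} (hf : PT f) (hg : PT g) : PT fun a => f a * g a := by
  have : PT fun a => ((List.replicate (f a) ()).flatMap fun _ => List.replicate (g a) ()).length :=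
    (PT.flatMap (by fun_prop) (by fun_prop)).length
  refine cast (congrArg PT (funext fun a => ?_)) this
  simp

@[fun_prop]
theorem PT.sub {f g : α → ℕ} (hf : PT f) (hg : PT g) : PT fun a => f a - g a := by
  have hp : PT fun n : ℕ => n - 1 := PT.of_tr PT.right fun n => by cases n <;> rfl
  have key : ∀ (l : List Unit) m, l.foldl (fun s _ => s - 1) m = m - l.length := by
    intro l
    induction l with
    | nil => intro m; rfl
    | cons a l ih => intro m; rw [List.foldl_cons, ih, List.length_cons]; omega
  have : PT fun a => (List.replicate (g a) ()).foldl (fun s _ => s - 1) (f a) :=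
    PT.foldl (h := fun _ s _ => s - 1)
      (hp.comp (f := fun x : α × ℕ × Unit => x.2.1) (by fun_prop)) (by fun_prop) hf hf.bd
      fun a l₁ l₂ hl => by
        rw [key, sz_nat, sz_nat]; omega
  simpa only [key, List.length_replicate] using this

theorem PT.ne_zero : PT fun n : ℕ => n ≠ 0 :=
  PT.of_isNode fun n => by cases n <;> simp [enc, natTr, Tr.IsNode]

@[fun_prop]
theorem PT.lt {f g : α → ℕ} (hf : PT f) (hg : PT g) : PT fun a => f a < g a := by
  have := PT.ne_zero.comp (hg.sub hf)
  refine cast (congrArg PT (funext fun a => ?_)) this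
  rw [Ne, Nat.sub_eq_zero_iff_le, not_le]

@[fun_prop]
theorem PT.le {f g : α → ℕ} (hf : PT f) (hg : PT g) : PT fun a => f a ≤ g a := by
  have := (hg.lt hf).not
  simpa only [not_lt] using this

@[fun_prop]
theorem PT.eq {f g : α → ℕ} (hf : PT f) (hg : PT g) : PT fun a => f a = g a := by
  have := (hf.le hg).and (hg.le hf)
  simpa only [le_antisymm_iff] using this

@[fun_prop]
theorem PT.even {f : α → ℕ} (hf : PT f) : PT fun a => Even (f a) := by
  have key : ∀ n, (List.replicate n ()).foldl (fun (s : Prop) _ => ¬ s) True = Even n := by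
    intro n
    induction n with
    | zero => simp
    | succ n ih =>
      rw [List.replicate_succ', List.foldl_append, ih]
      simp [Nat.even_add_one]
  have : PT fun a => (List.replicate (f a) ()).foldl (fun (s : Prop) _ => ¬ s) True :=
    PT.foldl (h := fun _ s _ => ¬ s) (by fun_prop) (by fun_prop) (PT.const True) (Bd.const 3)
      fun _ _ _ _ => sz_prop _
  simpa only [key] using this

theorem sz_range (n : ℕ) : sz (List.range n) ≤ n * (2 * n + 2) + 1 := by
  have := sz_le_mul (l := List.range n) (m := 2 * n + 1) fun a ha => by
    rw [sz_nat]; have := List.mem_range.1 ha; omega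
  simpa using this

@[fun_prop]
theorem PT.range {f : α → ℕ} (hf : PT f) : PT fun a => List.range (f a) := by
  have key : ∀ n, (List.replicate n ()).foldl (fun (s : List ℕ) _ => s ++ [s.length]) [] =
      List.range n := by
    intro n
    induction n with
    | zero => rfl
    | succ n ih => rw [List.replicate_succ', List.foldl_append, ih, List.range_succ]; simp
  have : PT fun n : ℕ =>
      (List.replicate n ()).foldl (fun (s : List ℕ) _ => s ++ [s.length]) [] :=
    PT.foldl (h := fun _ s _ => s ++ [s.length]) (by fun_prop) (by fun_prop) (PT.const [])
      ((Bd.sz.mul ((Bd.sz).add (.const 1))).add (.const 1))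
      fun n l₁ l₂ hl => by
        have h1 : l₁ = List.replicate l₁.length () := List.eq_replicate_of_mem fun _ _ => rfl
        have h2 := congrArg List.length hl
        rw [h1, key]
        refine (sz_range _).trans ?_
        rw [sz_nat]
        simp only [List.length_replicate, List.length_append] at h2
        refine Nat.add_le_add_right (Nat.mul_le_mul (by omega) (by omega)) 1
  simpa only [key] using this.comp hf

@[fun_prop]
theorem PT.drop {f : α → List β} {g : α → ℕ} (hf : PT f) (hg : PT g) :
    PT fun a => (f a).drop (g a) := by
  have key : ∀ (l : List Unit) (m : List β), l.foldl (fun s _ => s.tail) m = m.drop l.length := by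
    intro l
    induction l with
    | nil => intro m; rfl
    | cons a l ih => intro m; rw [List.foldl_cons, ih]; simp
  have : PT fun a => (List.replicate (g a) ()).foldl (fun s _ => s.tail) (f a) :=
    PT.foldl (h := fun _ s _ => s.tail) (by fun_prop) (by fun_prop) hf hf.bd
      fun a l₁ l₂ hl => by
        rw [key]
        have := sz_append ((f a).take l₁.length) ((f a).drop l₁.length)
        rw [List.take_append_drop] at this
        have := sz_pos ((f a).take l₁.length)
        omega
  simpa only [key, List.length_replicate] using this

theorem PT.getD {d : β} (hd : enc d = .leaf) {f : α → List β} {g : α → ℕ} (hf : PT f)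
    (hg : PT g) : PT fun a => (f a).getD (g a) d := by
  have := PT.headD hd (hf.drop hg)
  refine cast (congrArg PT (funext fun a => ?_)) this
  rw [List.headD_eq_head?_getD, List.head?_drop, List.getD_eq_getElem?_getD]

@[fun_prop]
theorem PT.getD_zero {f : α → List ℕ} {g : α → ℕ} (hf : PT f) (hg : PT g) :
    PT fun a => (f a).getD (g a) 0 := PT.getD rfl hf hg

@[fun_prop]
theorem PT.getD_nil {f : α → List (List β)} {g : α → ℕ} (hf : PT f) (hg : PT g) :
    PT fun a => (f a).getD (g a) [] := PT.getD rfl hf hg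

theorem PT.eq_pair : PT fun p : (ℕ × ℕ) × (ℕ × ℕ) => p.1 = p.2 := by
  have : PT fun p : (ℕ × ℕ) × (ℕ × ℕ) => p.1.1 = p.2.1 ∧ p.1.2 = p.2.2 := by fun_prop
  simpa only [Prod.ext_iff] using this

@[fun_prop]
theorem PT.mem_nat {f : α → ℕ} {g : α → List ℕ} (hf : PT f) (hg : PT g) :
    PT fun a => f a ∈ g a := by
  have : PT fun a => ∃ b ∈ g a, b = f a := by fun_prop
  simpa using this

@[fun_prop]
theorem PT.exists_lt {p : α → ℕ → Prop} (hp : PT fun x : α × ℕ => p x.1 x.2) {f : α → ℕ}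
    (hf : PT f) : PT fun a => ∃ b < f a, p a b := by
  have : PT fun a => ∃ b ∈ List.range (f a), p a b := by fun_prop
  simpa only [List.mem_range] using this

@[fun_prop]
theorem PT.forall_lt {p : α → ℕ → Prop} (hp : PT fun x : α × ℕ => p x.1 x.2) {f : α → ℕ}
    (hf : PT f) : PT fun a => ∀ b < f a, p a b := by
  have : PT fun a => ∀ b ∈ List.range (f a), p a b := by fun_prop
  simpa only [List.mem_range] using this

end

/-! ### Reachability in finite graphs -/

/-- A sublist of the same length is the whole list, so the length grows at every step that changes
the list, and this can happen at most `N` times. -/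
theorem exists_stable {β : Type} {S : ℕ → List β} (h : ∀ i, (S i).Sublist (S (i + 1))) {N : ℕ}
    (hN : ∀ i, (S i).length ≤ N) : ∃ i ≤ N, S (i + 1) = S i := by
  by_contra! hc
  have key : ∀ i ≤ N + 1, i ≤ (S i).length := by
    intro i
    induction i with
    | zero => intro _; omega
    | succ i ih =>
      intro hi
      have h1 := ih (by omega)
      have h2 := (h i).length_le
      have h3 : (S i).length ≠ (S (i + 1)).length :=
        fun he => hc i (by omega) ((h i).eq_of_length he).symm
      omega
  have := key (N + 1) le_rfl
  have := hN (N + 1)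
  omega

section
variable {α β : Type}

open Classical in
/-- Add the successors within `V` to a list. -/
noncomputable def reachStep (V : List β) (r : β → β → Prop) (S : List β) : List β :=
  V.filter fun y => y ∈ S ∨ ∃ z ∈ S, r z y

open Classical in
/-- The elements of `V` that are reachable from `x` in at most `n + 1` steps. -/
noncomputable def reachIn (V : List β) (r : β → β → Prop) (x : β) (n : ℕ) : List β :=
  (List.replicate n ()).foldl (fun S _ => reachStep V r S) (V.filter fun y => r x y)

theorem reachIn_succ (V : List β) (r : β → β → Prop) (x : β) (n : ℕ) :
    reachIn V r x (n + 1) = reachStep V r (reachIn V r x n) := by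
  rw [reachIn, List.replicate_succ', List.foldl_append]; rfl

theorem reachIn_eq_filter (V : List β) (r : β → β → Prop) (x : β) (n : ℕ) :
    ∃ p : β → Bool, reachIn V r x n = V.filter p := by
  cases n with
  | zero => exact ⟨_, rfl⟩
  | succ n => rw [reachIn_succ]; exact ⟨_, rfl⟩

theorem reachIn_length_le (V : List β) (r : β → β → Prop) (x : β) (n : ℕ) :
    (reachIn V r x n).length ≤ V.length := by
  obtain ⟨p, hp⟩ := reachIn_eq_filter V r x n
  rw [hp]; exact List.length_filter_le _ _

theorem reachIn_sublist (V : List β) (r : β → β → Prop) (x : β) (n : ℕ) :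
    (reachIn V r x n).Sublist (reachIn V r x (n + 1)) := by
  classical
  obtain ⟨p, hp⟩ := reachIn_eq_filter V r x n
  rw [reachIn_succ, hp, reachStep]
  have : V.filter p = V.filter fun y => y ∈ V.filter p := by
    apply List.filter_congr
    intro y hy
    simp [hy]
  conv_lhs => rw [this]
  apply List.monotone_filter_right
  intro y
  simp +contextual

/-- The stages increase inside `V`, so one of the first `V.length` steps changes nothing, and from
there on nothing changes any more. The last stage computed is therefore closed under successors. The
process starts with the successors of `x` and not with `x`, hence the transitive closure without
reflexivity. -/
theorem mem_reachIn_iff {V : List β} {r : β → β → Prop} (hr : ∀ x y, r x y → y ∈ V) (x y : β) :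
    y ∈ reachIn V r x V.length ↔ Relation.TransGen r x y := by
  constructor
  · intro h
    have : ∀ n, ∀ y ∈ reachIn V r x n, Relation.TransGen r x y := by
      intro n
      induction n with
      | zero =>
        intro y hy
        exact .single (by simpa using (List.mem_filter.1 hy).2)
      | succ n ih =>
        intro y hy
        rw [reachIn_succ, reachStep, List.mem_filter] at hy
        rcases (by simpa using hy.2 : _ ∨ ∃ z ∈ _, r z y) with hy | ⟨z, hz, hzy⟩
        · exact ih y hy
        · exact (ih z hz).tail hzy
    exact this _ y h
  · intro h
    obtain ⟨i, hi, hs⟩ := exists_stable (reachIn_sublist V r x) (reachIn_length_le V r x)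
    have hstab : ∀ j, reachIn V r x (i + j) = reachIn V r x i := by
      intro j
      induction j with
      | zero => rfl
      | succ j ih => rw [← Nat.add_assoc, reachIn_succ, ih, ← reachIn_succ, hs]
    have h1 := hstab (V.length - i)
    rw [Nat.add_sub_cancel' hi] at h1
    have h2 := hstab (V.length - i + 1)
    rw [← Nat.add_assoc, Nat.add_sub_cancel' hi, ← h1] at h2
    have h0 : ∀ n, ∀ y ∈ reachIn V r x 0, y ∈ reachIn V r x n := by
      intro n
      induction n with
      | zero => exact fun _ h => h
      | succ n ih => exact fun y hy => (reachIn_sublist V r x n).subset (ih y hy)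
    induction h with
    | single h => exact h0 _ _ (List.mem_filter.2 ⟨hr _ _ h, by simpa using h⟩)
    | tail _ h ih =>
      rw [← h2, reachIn_succ, reachStep, List.mem_filter]
      exact ⟨hr _ _ h, by simpa using Or.inr ⟨_, ih, h⟩⟩

theorem sz_sublist [Enc β] {l l' : List β} (h : l.Sublist l') : sz l ≤ sz l' := by
  induction h with
  | slnil => rfl
  | cons a _ ih => rw [sz_cons]; omega
  | cons_cons a _ ih => rw [sz_cons, sz_cons]; omega

/-- Every stage is a filtered copy of `V` and so is no larger than `V`; this is the bound that the
fold requires. Equality of vertices is needed to test membership in a stage. -/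
theorem PT.transGen [Enc α] [Enc β] {V : α → List β} (hV : PT V) {r : α → β → β → Prop}
    (hr : PT fun x : α × β × β => r x.1 x.2.1 x.2.2) (hrV : ∀ a x y, r a x y → y ∈ V a)
    (heq : PT fun p : β × β => p.1 = p.2) {x y : α → β} (hx : PT x) (hy : PT y) :
    PT fun a => Relation.TransGen (r a) (x a) (y a) := by
  classical
  have hmem : PT fun p : β × List β => p.1 ∈ p.2 := by
    have : PT fun p : β × List β => ∃ b ∈ p.2, b = p.1 :=
      PT.exists_mem (p := fun (p : β × List β) b => b = p.1)
        (heq.comp (f := fun q : (β × List β) × β => (q.2, q.1.1)) (by fun_prop)) (by fun_prop)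
    simpa using this
  have h1 : PT fun x : α × List β × Unit => reachStep (V x.1) (r x.1) x.2.1 := by
    refine PT.filter (p := fun (x : α × List β × Unit) y => y ∈ x.2.1 ∨ ∃ z ∈ x.2.1, r x.1 z y)
      ?_ (by fun_prop)
    refine PT.or ?_ ?_
    · exact hmem.comp (f := fun q : (α × List β × Unit) × β => (q.2, q.1.2.1)) (by fun_prop)
    · refine PT.exists_mem (p := fun (q : (α × List β × Unit) × β) z => r q.1.1 z q.2) ?_
        (by fun_prop)
      exact hr.comp (f := fun q : ((α × List β × Unit) × β) × β => (q.1.1.1, q.2, q.1.2))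
        (by fun_prop)
  have h0 : PT fun a => (V a).filter fun y => r a (x a) y :=
    PT.filter (p := fun a y => r a (x a) y)
      (hr.comp (f := fun q : α × β => (q.1, x q.1, q.2)) (by fun_prop)) hV
  have h2 : PT fun a => reachIn (V a) (r a) (x a) (V a).length :=
    PT.foldl (h := fun a S (_ : Unit) => reachStep (V a) (r a) S) h1 (by fun_prop) h0 hV.bd
      fun a l₁ l₂ hl => by
        have h3 : l₁ = List.replicate l₁.length () := List.eq_replicate_of_mem fun _ _ => rfl
        rw [h3]
        change sz (reachIn (V a) (r a) (x a) l₁.length) ≤ _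
        obtain ⟨p, hp⟩ := reachIn_eq_filter (V a) (r a) (x a) l₁.length
        rw [hp]
        exact sz_sublist List.filter_sublist
  have h3 := hmem.comp (hy.pair h2)
  simpa only [mem_reachIn_iff (hrV _)] using h3

end

/-! ### Input and output -/

open PartrecToTM2

/-- A number for each symbol. -/
def symNat : Γ' → ℕ
  | .bit0 => 0
  | .bit1 => 1
  | .cons => 2
  | .consₗ => 3

instance : Enc Γ' := ⟨fun x => enc (symNat x)⟩

def isSym (x : Γ') (o : Option Γ') : Bool := decide (o = some x)

/-- Move a symbol from the input to the main stack. -/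
def readSym : SProg :=
  .ite .io (isSym .bit0) (.pop .io ;; pushP (enc Γ'.bit0).code) <|
  .ite .io (isSym .bit1) (.pop .io ;; pushP (enc Γ'.bit1).code) <|
  .ite .io (isSym .cons) (.pop .io ;; pushP (enc Γ'.cons).code) <|
  .pop .io ;; pushP (enc Γ'.consₗ).code

/-- Move a symbol from the main stack to the output. -/
def writeSym : SProg :=
  .ite .main isT (.pop .main ;; .pop .main ;; .ite .main isT (.pop .main ;; .pop .main ;;
    .ite .main isT (.pop .main ;; .pop .main ;; .pop .main ;; .push .io Γ'.consₗ)
    (.pop .main ;; .push .io Γ'.cons)) (.pop .main ;; .push .io Γ'.bit1))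
    (.pop .main ;; .push .io Γ'.bit0)

theorem runs_pushP' (i : List Γ') (l s : List Bool) :
    Runs (pushP l) (mk i s [] [] []) (mk i (l ++ s) [] [] []) (l.length + 1) := by
  induction l with
  | nil => exact Runs.skip
  | cons x l ih => exact ih.seq (push_main x)

theorem runs_readSym (x : Γ') (i : List Γ') (s : List Bool) :
    Runs readSym (mk (x :: i) s [] [] []) (mk i ((enc x).code ++ s) [] [] []) 20 := by
  cases x with
  | bit0 =>
    exact (Runs.ite_true rfl (pop_io.seq (runs_pushP' _ _ _))).mono
      (by simp [enc, symNat, natTr, Tr.code])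
  | bit1 =>
    exact (Runs.ite_false rfl (Runs.ite_true rfl (pop_io.seq (runs_pushP' _ _ _)))).mono
      (by simp [enc, symNat, natTr, Tr.code])
  | cons =>
    exact (Runs.ite_false rfl (Runs.ite_false rfl (Runs.ite_true rfl
      (pop_io.seq (runs_pushP' _ _ _))))).mono (by simp [enc, symNat, natTr, Tr.code])
  | consₗ =>
    exact (Runs.ite_false rfl (Runs.ite_false rfl (Runs.ite_false rfl
      (pop_io.seq (runs_pushP' _ _ _))))).mono (by simp [enc, symNat, natTr, Tr.code])

theorem runs_writeSym (x : Γ') (i : List Γ') (s : List Bool) :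
    Runs writeSym (mk i ((enc x).code ++ s) [] [] []) (mk (x :: i) s [] [] []) 20 := by
  cases x with
  | bit0 => exact (Runs.ite_false rfl (pop_main.seq (push_io _))).mono (by simp)
  | bit1 =>
    exact (Runs.ite_true rfl (pop_main.seq (pop_main.seq
      (Runs.ite_false rfl (pop_main.seq (push_io _)))))).mono (by simp)
  | cons =>
    exact (Runs.ite_true rfl (pop_main.seq (pop_main.seq (Runs.ite_true rfl
      (pop_main.seq (pop_main.seq (Runs.ite_false rfl (pop_main.seq (push_io _))))))))).mono
      (by simp)
  | consₗ =>
    exact (Runs.ite_true rfl (pop_main.seq (pop_main.seq (Runs.ite_true rfl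
      (pop_main.seq (pop_main.seq (Runs.ite_true rfl
        (pop_main.seq (pop_main.seq (pop_main.seq (push_io _))))))))))).mono (by simp)

def readLoop : SProg := .loop .io Option.isSome (readSym ;; .push .main true)

def writeLoop : SProg := .loop .main isT (.pop .main ;; writeSym)

/-- Each symbol is put in front of those read before, so the string arrives reversed. -/
theorem runs_readLoop (l acc : List Γ') : Runs readLoop (mk l (enc acc).code [] [] [])
    (mk [] (enc (l.reverse ++ acc)).code [] [] []) (22 * l.length + 1) := by
  induction l generalizing acc with
  | nil => exact Runs.loop_false rfl
  | cons x l ih =>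
    have hb : Runs (readSym ;; .push .main true) (mk (x :: l) (enc acc).code [] [] [])
        (mk l (enc (x :: acc)).code [] [] []) 21 :=
      (runs_readSym x l _).seq (push_main true)
    have := (Runs.loop_true (f := Option.isSome) rfl hb (ih (x :: acc))).mono
      (T' := 22 * (x :: l).length + 1) (by simp; omega)
    simpa [readLoop] using this

theorem runs_writeLoop (l i : List Γ') : Runs writeLoop (mk i (enc l).code [] [] [])
    (mk (l.reverse ++ i) [false] [] [] []) (22 * l.length + 1) := by
  induction l generalizing i with
  | nil => exact Runs.loop_false rfl
  | cons x l ih =>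
    have hb : Runs (.pop .main ;; writeSym) (mk i (enc (x :: l)).code [] [] [])
        (mk (x :: i) (enc l).code [] [] []) 21 :=
      (pop_main (m := (enc (x :: l)).code)).seq (runs_writeSym x i _)
    have h : Runs (.loop .main isT (.pop .main ;; writeSym) : SProg) (mk (x :: i) (enc l).code [] [] [])
      (mk (l.reverse ++ x :: i) [false] [] [] []) (22 * l.length + 1) := ih (x :: i)
    have h3 := Runs.loop_true (Γ := Sym) (k := .main) (f := isT) rfl hb h
    have := h3.mono (T' := 22 * (x :: l).length + 1) (by simp; omega)
    simpa [writeLoop] using this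

instance : Fintype (Sym Stk.io) := inferInstanceAs (Fintype Γ')

theorem initList_machine (k₁ : Stk) (P : SProg) (l : List Γ') :
    initList (machine (Γ := Sym) .io k₁ P) (List.map id l) =
      (⟨some (some (entry P)), false, mk l [] [] [] []⟩ : TM2.Cfg Sym (Option (Lab P)) Bool) :=
  congrArg (TM2.Cfg.mk (Γ := Sym) (Λ := Option (Lab P)) (σ := Bool) (some (some (entry P))) false)
    (funext fun k => by
      cases k
      · exact List.map_id l
      all_goals rfl)

theorem haltList_machine_io (P : SProg) (l : List Γ') :
    haltList (machine (Γ := Sym) .io .io P) (List.map id l) =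
      (⟨none, false, mk l [] [] [] []⟩ : TM2.Cfg Sym (Option (Lab P)) Bool) :=
  congrArg (TM2.Cfg.mk (Γ := Sym) (Λ := Option (Lab P)) (σ := Bool) none false)
    (funext fun k => by
      cases k
      · exact List.map_id l
      all_goals rfl)

theorem haltList_machine_main (P : SProg) (l : List Bool) :
    haltList (machine (Γ := Sym) .io .main P) (List.map id l) =
      (⟨none, false, mk [] l [] [] []⟩ : TM2.Cfg Sym (Option (Lab P)) Bool) :=
  congrArg (TM2.Cfg.mk (Γ := Sym) (Λ := Option (Lab P)) (σ := Bool) none false)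
    (funext fun k => by
      cases k
      case main => exact List.map_id l
      all_goals rfl)

section
variable {X : Type} [Enc X] {ex : X → List Γ'}

theorem bd_length (hX : ∀ x, enc x = enc (ex x).reverse) {T : X → ℕ} (hT : Bd T) :
    ∃ p : Polynomial ℕ, ∀ x, T x ≤ p.eval (ex x).length := by
  obtain ⟨p, hp⟩ := hT
  -- A symbol is encoded by a tree with at most 7 nodes and a list of `n` symbols by at most `8 * n
  -- + 1` nodes, so `9 * n + 1` leaves some slack.
  refine ⟨p.comp (Polynomial.C 9 * Polynomial.X + Polynomial.C 1), fun x => (hp x).trans ?_⟩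
  rw [Polynomial.eval_comp]
  apply eval_mono
  have h1 : sz x = sz (ex x).reverse := by rw [sz, hX]; rfl
  have h2 := sz_le_mul (l := (ex x).reverse) (m := 7) fun a _ => by
    have h : sz a = sz (symNat a) := rfl
    rw [h, sz_nat]; cases a <;> simp [symNat]
  simp at h2 ⊢
  omega

/-- Read the input and run a program. -/
theorem runs_read (hX : ∀ x, enc x = enc (ex x).reverse) {Y : Type} [Enc Y] {f : X → Y}
    (hf : PT f) : ∃ (P : SProg) (T : X → ℕ), Bd T ∧ ∀ x,
      Runs P (mk (ex x) [] [] [] []) (mk [] (enc (f x)).code [] [] []) (T x) := by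
  obtain ⟨P, T, hT, h⟩ := hf
  refine ⟨.push .main false ;; readLoop ;; P, _, hT.add ((Bd.sz.mul (.const 22)).add (.const 2)),
    fun x => ?_⟩
  have h1 := h x []
  rw [hX, List.append_nil, List.append_nil] at h1
  have h2 := runs_readLoop (ex x) []
  rw [List.append_nil] at h2
  refine ((push_main false).seq (h2.seq h1)).mono ?_
  have h3 : sz x = sz (ex x).reverse := by rw [sz, hX]; rfl
  have h4 := length_lt_sz (ex x).reverse
  rw [List.length_reverse] at h4
  omega

/-- Reading and writing both reverse a string. Hence the tree of an input has to be that of the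
reversed input string, and the reversed output string has to be computed. -/
theorem polyTimeComputable_of_PT (hX : ∀ x, enc x = enc (ex x).reverse) {Y : Type}
    {ey : Y → List Γ'} {f : X → Y} (hf : PT fun x => (ey (f x)).reverse) :
    PolyTimeComputable ex ey f := by
  obtain ⟨P, T, hT, h⟩ := runs_read hX hf
  obtain ⟨p, hp⟩ := bd_length hX ((hT.add (hf.bd.mul (.const 22))).add (.const 3))
  have key : ∀ x, ∃ t ≤ p.eval (ex x).length, (flip Bind.bind
      (machine (Γ := Sym) .io .io (P ;; writeLoop ;; .pop .main)).step)^[t]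
      (some (initList (machine (Γ := Sym) .io .io (P ;; writeLoop ;; .pop .main))
        (List.map id (ex x)))) =
      some (haltList (machine (Γ := Sym) .io .io (P ;; writeLoop ;; .pop .main))
        (List.map id (ey (f x)))) := by
    intro x
    have h1 := runs_writeLoop (ey (f x)).reverse []
    rw [List.append_nil, List.reverse_reverse] at h1
    obtain ⟨t, ht, he⟩ := Runs.machine_evals .io .io ((h x).seq (h1.seq pop_main))
    refine ⟨t, ht.trans (le_trans ?_ (hp x)), ?_⟩
    · have := length_lt_sz (ey (f x)).reverse
      omega
    · exact (congrArg (fun c => (flip Bind.bind _)^[t] (some c)) (initList_machine _ _ _)).trans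
        (he.trans (congrArg some (haltList_machine_io _ _).symm))
  choose t ht he using key
  exact ⟨{ tm := machine (Γ := Sym) .io .io (P ;; writeLoop ;; .pop .main)
           inputAlphabet := Equiv.refl Γ'
           outputAlphabet := Equiv.refl Γ'
           time := p
           outputsFun := fun x => ⟨⟨t x, he x⟩, ht x⟩ }⟩

theorem polyTimeDecidable_of_PT (hX : ∀ x, enc x = enc (ex x).reverse) {P : X → Prop}
    (hP : PT P) : PolyTimeDecidable ex P := by
  classical
  obtain ⟨Q, T, hT, h⟩ := runs_read hX hP
  obtain ⟨p, hp⟩ := bd_length hX (hT.add (.const 6))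
  -- The three symbols that encode truth are replaced by one output symbol; the code of falsity
  -- already is the required output.
  set R : SProg := .ite .main isT (.pop .main ;; .pop .main ;; .pop .main ;; .push .main true)
    .skip with hR
  have hR' : ∀ x, Runs R (mk [] (enc (P x)).code [] [] []) (mk [] [decide (P x)] [] [] []) 5 := by
    intro x
    by_cases hx : P x
    · rw [enc_true hx, decide_eq_true hx]
      exact Runs.ite_true rfl (pop_main.seq (pop_main.seq (pop_main.seq (push_main true))))
    · rw [enc_false hx, decide_eq_false hx]
      exact (Runs.ite_false rfl Runs.skip).mono (by omega)
  have key : ∀ x, ∃ t ≤ p.eval (ex x).length, (flip Bind.bind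
      (machine (Γ := Sym) .io .main (Q ;; R)).step)^[t]
      (some (initList (machine (Γ := Sym) .io .main (Q ;; R)) (List.map id (ex x)))) =
      some (haltList (machine (Γ := Sym) .io .main (Q ;; R)) (List.map id [decide (P x)])) := by
    intro x
    obtain ⟨t, ht, he⟩ := Runs.machine_evals .io .main ((h x).seq (hR' x))
    refine ⟨t, ht.trans (le_trans ?_ (hp x)), ?_⟩
    · omega
    · exact (congrArg (fun c => (flip Bind.bind _)^[t] (some c)) (initList_machine _ _ _)).trans
        (he.trans (congrArg some (haltList_machine_main _ _).symm))
  choose t ht he using key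
  exact ⟨{ tm := machine (Γ := Sym) .io .main (Q ;; R)
           inputAlphabet := Equiv.refl Γ'
           outputAlphabet := Equiv.refl Bool
           time := p
           outputsFun := fun x => ⟨⟨t x, he x⟩, ht x⟩ }⟩

end

/-! ### Binary numbers -/

/-- The number with the given binary digits, least significant digit first. -/
def bitVal : List Bool → ℕ
  | [] => 0
  | b :: l => b.toNat + 2 * bitVal l

/-- The binary digits of a number, least significant digit first. -/
def bitsOf (n : ℕ) : List Bool := (trNat n).map fun x => decide (symNat x = 1)

theorem bitVal_trPosNum (p : PosNum) :
    bitVal ((trPosNum p).map fun x => decide (symNat x = 1)) = p := by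
  induction p with
  | one => rfl
  | bit0 p ih =>
    rw [trPosNum, List.map_cons, bitVal, ih, PosNum.cast_bit0]
    simp [symNat]; omega
  | bit1 p ih =>
    rw [trPosNum, List.map_cons, bitVal, ih, PosNum.cast_bit1]
    simp [symNat]; omega

theorem bitVal_bitsOf (n : ℕ) : bitVal (bitsOf n) = n := by
  rw [bitsOf, trNat]
  conv_rhs => rw [← Num.to_of_nat n]
  cases (n : Num) with
  | zero => rfl
  | pos p => exact bitVal_trPosNum p

theorem symNat_le_one (n : ℕ) : ∀ x ∈ trNat n, symNat x ≤ 1 := by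
  have h : ∀ (p : PosNum), ∀ x ∈ trPosNum p, symNat x ≤ 1 := by
    intro p
    induction p with
    | one => simp [trPosNum, symNat]
    | bit0 p ih => simpa [trPosNum, symNat] using ih
    | bit1 p ih => simpa [trPosNum, symNat] using ih
  rw [trNat]
  cases (n : Num) with
  | zero => simp [trNum]
  | pos p => exact h p

@[fun_prop]
theorem PT.symNat {α : Type} [Enc α] {f : α → Γ'} (hf : PT f) : PT fun a => symNat (f a) :=
  (PT.of_enc_eq (f := fun x => StackProg.symNat x) fun _ => rfl).comp hf

/-- Read one more symbol, from the right, of a list of binary numbers. -/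
def parseStep (L : List (List Bool)) (x : Γ') : List (List Bool) :=
  if symNat x = 2 then [] :: L
  else if symNat x = 3 then L
  else (decide (symNat x = 1) :: L.headD []) :: L.tail

/-- Read a list of binary numbers, given in reverse. -/
def parse (l : List Γ') : List (List Bool) := l.foldl parseStep []

/-- Read from the right, the separator comes before the digits of its number and opens an empty
list. The digits then arrive most significant first and are put in front of each other, which leaves
the least significant one at the head. -/
theorem parse_trList (v : List ℕ) : parse (trList v).reverse = v.map bitsOf := by
  rw [parse, List.foldl_reverse]
  induction v with
  | nil => rfl
  | cons n v ih =>
    rw [trList, List.foldr_append, List.foldr_cons, ih]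
    have h : ∀ (l : List Γ') (L : List (List Bool)), (∀ x ∈ l, symNat x ≤ 1) →
        l.foldr (fun x y => parseStep y x) ([] :: L) =
          (l.map fun x => decide (symNat x = 1)) :: L := by
      intro l L
      induction l with
      | nil => intro _; rfl
      | cons x l ih =>
        intro hl
        rw [List.foldr_cons, ih fun x hx => hl x (by simp [hx])]
        have := hl x (by simp)
        simp [parseStep, show symNat x ≠ 2 by omega, show symNat x ≠ 3 by omega]
    exact h _ _ (symNat_le_one n)

theorem PT.parse : PT parse := by
  have hstep : PT fun x : List (List Bool) × Γ' => parseStep x.1 x.2 := by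
    unfold parseStep
    refine PT.ite (by fun_prop) (by fun_prop) (PT.ite (by fun_prop) (by fun_prop)
      (PT.cons (PT.cons (by fun_prop) (PT.headD rfl (by fun_prop))) (by fun_prop)))
  have hsz : ∀ x L, sz (parseStep L x) ≤ sz L + 8 := by
    intro x L
    unfold parseStep
    split_ifs
    · rw [sz_cons, sz_nil]; omega
    · omega
    · have := sz_bool (Decidable.decide (StackProg.symNat x = 1))
      cases L with
      | nil => simp only [sz_cons, List.headD_nil, List.tail_nil, sz_nil]; omega
      | cons a L => simp only [sz_cons, List.headD_cons, List.tail_cons]; omega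
  refine PT.foldl (h := fun _ L x => parseStep L x) (f := fun l : List Γ' => l)
    (hstep.comp (f := fun x : List Γ' × List (List Bool) × Γ' => x.2) (by fun_prop))
    (by fun_prop) (PT.const []) ((Bd.sz.mul (.const 8)).add (.const 1)) fun l l₁ l₂ hl => ?_
  have : ∀ (l : List Γ') (L : List (List Bool)),
      sz (l.foldl parseStep L) ≤ sz L + l.length * 8 := by
    intro l
    induction l with
    | nil => intro L; simp
    | cons x l ih =>
      intro L
      have h1 := ih (parseStep L x)
      have h2 := hsz x L
      simp only [List.foldl_cons, List.length_cons]
      omega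
  have h2 := length_lt_sz l
  rw [hl, List.length_append, ← hl] at h2
  refine (this l₁ []).trans ?_
  rw [sz_nil]
  omega

/-- The value of a binary number, as long as it is small. -/
theorem PT.min_bitVal {α : Type} [Enc α] {c : α → ℕ} {l : α → List Bool} (hc : PT c) (hl : PT l) :
    PT fun a => min (c a) (bitVal (l a)) := by
  -- Horner's scheme from the most significant digit, truncated at `c` in every step. Truncation is
  -- harmless because a value that has reached `c` never falls below it again, and it keeps the
  -- unary accumulator small.
  have key : ∀ c (l : List Bool),
      l.reverse.foldl (fun v b => min c ((if b = true then 1 else 0) + 2 * v)) 0 =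
        min c (bitVal l) := by
    intro c l
    rw [List.foldl_reverse]
    induction l with
    | nil => simp [bitVal]
    | cons b l ih =>
      rw [List.foldr_cons, ih, bitVal]
      cases b <;> simp <;> omega
  have hmin : PT fun p : ℕ × ℕ => min p.1 p.2 := by
    have : PT fun p : ℕ × ℕ => if p.1 ≤ p.2 then p.1 else p.2 := by fun_prop
    simpa only [min_def] using this
  have := PT.foldl (h := fun a v b => min (c a) ((if b = true then 1 else 0) + 2 * v))
    (f := fun a => (l a).reverse) (g := fun _ => 0) (B := fun a => 2 * c a + 1)
    (hmin.comp (f := fun x : α × ℕ × Bool =>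
      (c x.1, (if x.2.2 = true then 1 else 0) + 2 * x.2.1)) (by fun_prop)) (by fun_prop)
    (by fun_prop) (hc.bd.mono fun a => (sz_nat _).ge) fun a l₁ l₂ _ => by
      rw [← List.reverse_reverse l₁, key, sz_nat]; omega
  simpa only [key] using this

theorem bitVal_take_lt (l : List Bool) (i : ℕ) : bitVal (l.take i) < 2 ^ i := by
  induction i generalizing l with
  | zero => simp [bitVal]
  | succ i ih =>
    cases l with
    | nil => simp [bitVal]
    | cons b l =>
      have := ih l
      have := Bool.toNat_le b
      rw [List.take_succ_cons, bitVal, Nat.pow_succ]; omega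

theorem bitVal_take_succ (l : List Bool) (i : ℕ) :
    bitVal (l.take (i + 1)) = bitVal (l.take i) + 2 ^ i * (l.getD i false).toNat := by
  induction i generalizing l with
  | zero => cases l <;> simp [bitVal]
  | succ i ih =>
    cases l with
    | nil => simp [bitVal]
    | cons b l =>
      rw [List.take_succ_cons, bitVal, ih l, List.take_succ_cons, bitVal, List.getD_cons_succ,
        Nat.pow_succ]
      ring

/-- The digit in position `i` outweighs all lower digits together, so it decides the comparison
unless the two digits agree. This recursion compares numbers without leaving binary notation. -/
theorem bitVal_take_succ_le (l l' : List Bool) (i : ℕ) :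
    bitVal (l.take (i + 1)) ≤ bitVal (l'.take (i + 1)) ↔
      (l.getD i false = true ∧ l'.getD i false = true ∧ bitVal (l.take i) ≤ bitVal (l'.take i)) ∨
      (¬ l.getD i false = true ∧
        (l'.getD i false = true ∨ bitVal (l.take i) ≤ bitVal (l'.take i))) := by
  have h1 := bitVal_take_lt l i
  have h2 := bitVal_take_lt l' i
  rw [bitVal_take_succ, bitVal_take_succ]
  cases l.getD i false <;> cases l'.getD i false <;> simp <;> omega

theorem PT.bitVal_le {α : Type} [Enc α] {l l' : α → List Bool} (hl : PT l) (hl' : PT l') :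
    PT fun a => bitVal (l a) ≤ bitVal (l' a) := by
  have key : ∀ (l l' : List Bool) n, (List.range n).foldl (fun (s : Prop) i =>
      (l.getD i false = true ∧ l'.getD i false = true ∧ s) ∨
        (¬ l.getD i false = true ∧ (l'.getD i false = true ∨ s))) True =
      (bitVal (l.take n) ≤ bitVal (l'.take n)) := by
    intro l l' n
    induction n with
    | zero => simp
    | succ n ih =>
      rw [List.range_succ, List.foldl_append, ih, bitVal_take_succ_le]; rfl
  have hg : ∀ {l : α → List Bool}, PT l → PT fun x : α × Prop × ℕ => (l x.1).getD x.2.2 false :=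
    fun hl => PT.getD rfl (hl.comp PT.fst) (by fun_prop)
  have h1 := hg hl
  have h2 := hg hl'
  -- The comparison runs from the least significant digit upwards. The sum of the lengths covers
  -- both numbers, and missing digits are read as `false`, that is, as zeros.
  have := PT.foldl (h := fun a (s : Prop) i =>
      ((l a).getD i false = true ∧ (l' a).getD i false = true ∧ s) ∨
        (¬ (l a).getD i false = true ∧ ((l' a).getD i false = true ∨ s)))
    (f := fun a => List.range ((l a).length + (l' a).length)) (g := fun _ => True)
    (by fun_prop) (by fun_prop) (by fun_prop) (Bd.const 3) fun _ _ _ _ => sz_prop _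
  simpa only [key, List.take_of_length_le (Nat.le_add_right _ _),
    List.take_of_length_le (Nat.le_add_left _ _)] using this

theorem PT.even_bitVal {α : Type} [Enc α] {l : α → List Bool} (hl : PT l) :
    PT fun a => Even (bitVal (l a)) := by
  have h1 : PT fun a => (l a).headD false := PT.headD rfl hl
  have h2 : PT fun a => ¬ (l a).headD false = true := by fun_prop
  refine cast (congrArg PT (funext fun a => ?_)) h2
  cases l a with
  | nil => simp [bitVal]
  | cons b l => cases b <;> simp [bitVal, Nat.even_add_one, Nat.even_add]

/-! ### Writing binary numbers -/

/-- The successor of a binary number. -/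
def incBits : List Γ' → List Γ'
  | [] => [.bit1]
  | x :: l => if symNat x = 0 then .bit1 :: l else .bit0 :: incBits l

theorem incBits_trPosNum (p : PosNum) : incBits (trPosNum p) = trPosNum p.succ := by
  induction p with
  | one => rfl
  | bit0 p ih => rfl
  | bit1 p ih =>
    change Γ'.bit0 :: incBits (trPosNum p) = Γ'.bit0 :: trPosNum p.succ
    rw [ih]

theorem trNat_succ (n : ℕ) : trNat (n + 1) = incBits (trNat n) := by
  rw [trNat, trNat, Nat.cast_succ, Num.add_one]
  cases (n : Num) with
  | zero => rfl
  | pos p => exact (incBits_trPosNum p).symm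

theorem length_incBits (l : List Γ') : (incBits l).length ≤ l.length + 1 := by
  induction l with
  | nil => simp [incBits]
  | cons x l ih =>
    rw [incBits]
    split_ifs
    · simp
    · simpa using ih

theorem length_trNat_le (n : ℕ) : (trNat n).length ≤ n := by
  induction n with
  | zero => simp
  | succ n ih => rw [trNat_succ]; exact (length_incBits _).trans (by omega)

theorem sz_sym (x : Γ') : sz x ≤ 7 := by
  have h : sz x = sz (symNat x) := rfl
  rw [h, sz_nat]; cases x <;> simp [symNat]

theorem sz_syms (l : List Γ') : sz l ≤ l.length * 8 + 1 := sz_le_mul fun x _ => sz_sym x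

theorem PT.incBits : PT incBits := by
  -- The first component is the pending carry, the second the digits already produced, in reverse
  -- order.
  let F : Bool × List Γ' → Γ' → Bool × List Γ' := fun q x =>
    if q.1 = true then
      if StackProg.symNat x = 0 then (false, Γ'.bit1 :: q.2) else (true, Γ'.bit0 :: q.2)
    else (false, x :: q.2)
  have key : ∀ (l : List Γ') (q : Bool × List Γ'),
      (l.foldl F q).2.reverse ++ (if (l.foldl F q).1 = true then [Γ'.bit1] else []) =
        q.2.reverse ++ (if q.1 = true then StackProg.incBits l else l) := by
    intro l
    induction l with
    | nil => intro q; rfl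
    | cons x l ih =>
      rintro ⟨c, s⟩
      rw [List.foldl_cons, ih]
      by_cases hx : StackProg.symNat x = 0 <;> cases c <;> simp [F, hx, StackProg.incBits]
  have hlen : ∀ (l : List Γ') (q : Bool × List Γ'), (l.foldl F q).2.length = q.2.length + l.length := by
    intro l
    induction l with
    | nil => intro q; rfl
    | cons x l ih =>
      rintro ⟨c, s⟩
      rw [List.foldl_cons, ih]
      by_cases hx : StackProg.symNat x = 0 <;> cases c <;> simp [F, hx] <;> omega
  have h : PT fun l : List Γ' => l.foldl F (true, []) :=
    PT.foldl (h := fun _ => F) (f := fun l : List Γ' => l)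
      (by simp only [F]; fun_prop) (by fun_prop) (by fun_prop) ((Bd.sz.mul (.const 8)).add (.const 5))
      fun l l₁ l₂ hl => by
        have h1 := sz_syms (l₁.foldl F (true, [])).2
        rw [hlen] at h1
        have h2 := length_lt_sz l
        rw [hl, List.length_append, ← hl] at h2
        have h3 := sz_bool (l₁.foldl F (true, [])).1
        change sz ((l₁.foldl F (true, [])).1, (l₁.foldl F (true, [])).2) ≤ _
        rw [sz_pair]
        simp only [List.length_nil] at h1
        omega
  have h2 : PT fun l : List Γ' => (l.foldl F (true, [])).2.reverse ++
      (if (l.foldl F (true, [])).1 = true then [Γ'.bit1] else []) := by fun_prop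
  simpa only [key, List.reverse_nil, List.nil_append, if_true] using h2

/-- Counting up from zero takes as many increments as the value of the number, which is admissible
because the number is given in unary. -/
theorem PT.trNat {α : Type} [Enc α] {f : α → ℕ} (hf : PT f) : PT fun a => trNat (f a) := by
  have key : ∀ n, (List.replicate n ()).foldl (fun s _ => StackProg.incBits s) [] =
      PartrecToTM2.trNat n := by
    intro n
    induction n with
    | zero => simp
    | succ n ih => rw [List.replicate_succ', List.foldl_append, ih, trNat_succ]; rfl
  have : PT fun n : ℕ => (List.replicate n ()).foldl (fun s _ => StackProg.incBits s) [] :=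
    PT.foldl (h := fun _ s _ => StackProg.incBits s)
      (PT.incBits.comp (f := fun x : ℕ × List Γ' × Unit => x.2.1) (by fun_prop)) (by fun_prop)
      (PT.const []) ((Bd.sz.mul (.const 8)).add (.const 1)) fun n l₁ l₂ hl => by
        have h1 : l₁ = List.replicate l₁.length () := List.eq_replicate_of_mem fun _ _ => rfl
        have h2 := congrArg List.length hl
        simp only [List.length_replicate, List.length_append] at h2
        rw [h1, key]
        have h3 := length_trNat_le l₁.length
        refine (sz_syms _).trans ?_
        rw [sz_nat]; omega
  simpa only [key] using this.comp hf

theorem PT.trList {α : Type} [Enc α] {f : α → List ℕ} (hf : PT f) : PT fun a => trList (f a) := by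
  have h : ∀ l : List ℕ, PartrecToTM2.trList l =
      l.flatMap fun n => PartrecToTM2.trNat n ++ [Γ'.cons] := by
    intro l
    induction l with
    | nil => rfl
    | cons n l ih => rw [PartrecToTM2.trList, ih]; simp
  simp only [h]
  exact PT.flatMap (h := fun _ n => PartrecToTM2.trNat n ++ [Γ'.cons])
    (PT.append (PT.trNat (f := fun x : α × ℕ => x.2) (by fun_prop)) (by fun_prop)) hf

/-! ### Parity automata as inputs -/

/-- Parity automata with alphabet `Fin A.1` and states `Fin A.2.1`. -/
abbrev Aut : Type := Σ k, FinDPA k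

/-- This is the tree that the reading loop leaves on the stack, so the requirement on inputs holds
by definition. -/
instance : Enc Aut := ⟨fun A => enc (encodeDPA A.2).reverse⟩

/-- The numbers that describe an automaton. -/
def flat (A : Aut) : List ℕ :=
  A.1 :: A.2.1 :: (A.2.2.init : ℕ) :: (List.finRange A.2.1).flatMap fun q =>
    A.2.2.prio q :: (List.finRange A.1).map fun s => (A.2.2.step q s : ℕ)

/-- Three numbers precede the rows of the states, and each row consists of the priority and one
successor per letter. -/
def prioN (A : Aut) (q : ℕ) : ℕ := (flat A).getD (3 + q * (A.1 + 1)) 0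

/-- The minimum changes nothing at genuine states and letters, since state numbers are below the
length of the description. It makes the function computable for all arguments: an arbitrary entry,
such as a priority, may be too large to be converted to unary. -/
def stepN (A : Aut) (q s : ℕ) : ℕ :=
  min (flat A).length ((flat A).getD (3 + q * (A.1 + 1) + 1 + s) 0)

theorem length_flatMap_of_length {α β : Type} {g : α → List β} {m : ℕ}
    (hg : ∀ a, (g a).length = m) (l : List α) : (l.flatMap g).length = l.length * m := by
  simp [List.length_flatMap, hg]

theorem getD_flatMap {α β : Type} {g : α → List β} {m : ℕ} (hg : ∀ a, (g a).length = m)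
    (l : List α) (i j : ℕ) (hi : i < l.length) (hj : j < m) (d : β) :
    (l.flatMap g).getD (i * m + j) d = (g l[i]).getD j d := by
  induction l generalizing i with
  | nil => simp at hi
  | cons a l ih =>
    rw [List.flatMap_cons]
    cases i with
    | zero => rw [Nat.zero_mul, Nat.zero_add, List.getD_append _ _ _ _ (by rw [hg]; exact hj)]; rfl
    | succ i =>
      rw [List.getD_append_right _ _ _ _ (by rw [hg, Nat.succ_mul]; omega), hg]
      have : (i + 1) * m + j - m = i * m + j := by rw [Nat.succ_mul]; omega
      rw [this, ih i (by simpa using hi)]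
      rfl

theorem length_flat (A : Aut) : (flat A).length = 3 + A.2.1 * (A.1 + 1) := by
  simp only [flat, List.length_cons]
  rw [length_flatMap_of_length (m := A.1 + 1) (by simp)]
  simp; omega

theorem getD_flat (A : Aut) (q : Fin A.2.1) (j : ℕ) (hj : j < A.1 + 1) :
    (flat A).getD (3 + q * (A.1 + 1) + j) 0 =
      (A.2.2.prio q :: (List.finRange A.1).map fun s => (A.2.2.step q s : ℕ)).getD j 0 := by
  rw [flat, show 3 + (q : ℕ) * (A.1 + 1) + j = (q * (A.1 + 1) + j) + 1 + 1 + 1 by omega,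
    List.getD_cons_succ, List.getD_cons_succ, List.getD_cons_succ,
    getD_flatMap (m := A.1 + 1) (by simp) _ _ _ (by simp) hj]
  simp

theorem prioN_val (A : Aut) (q : Fin A.2.1) : prioN A q = A.2.2.prio q := by
  have := getD_flat A q 0 (by omega)
  simpa [prioN] using this

theorem val_lt_length_flat (A : Aut) (q : Fin A.2.1) : (q : ℕ) < (flat A).length := by
  have := q.2
  rw [length_flat]
  nlinarith

theorem stepN_val (A : Aut) (q : Fin A.2.1) (s : Fin A.1) : stepN A q s = A.2.2.step q s := by
  have := getD_flat A q (s + 1) (by omega)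
  rw [stepN, Nat.add_right_comm, Nat.add_assoc, this]
  have h := val_lt_length_flat A (A.2.2.step q s)
  rw [List.getD_cons_succ, List.getD_eq_getElem?_getD]
  simp
  omega

section
variable {α : Type} [Enc α]

/-- An entry of the description can be exponential in the length of the input, so only its binary
digits are provided. -/
theorem PT.digits {f : α → Aut} {i : α → ℕ} (hf : PT f) (hi : PT i) :
    ∃ l : α → List Bool, PT l ∧ ∀ a, bitVal (l a) = (flat (f a)).getD (i a) 0 := by
  have h1 : PT fun A : Aut => (encodeDPA A.2).reverse := .of_enc_eq fun _ => rfl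
  have h2 : PT fun A : Aut => (flat A).map bitsOf := by
    have := PT.parse.comp h1
    refine cast (congrArg PT (funext fun A => ?_)) this
    exact parse_trList (flat A)
  refine ⟨fun a => ((flat (f a)).map bitsOf).getD (i a) [], (h2.comp hf).getD_nil hi, fun a => ?_⟩
  beta_reduce
  rw [List.getD_eq_getElem?_getD, List.getD_eq_getElem?_getD, List.getElem?_map]
  cases (flat (f a))[i a]? with
  | none => rfl
  | some n => exact bitVal_bitsOf n

@[fun_prop]
theorem PT.length_flat {f : α → Aut} (hf : PT f) : PT fun a => (flat (f a)).length := by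
  have h1 : PT fun A : Aut => (encodeDPA A.2).reverse := .of_enc_eq fun _ => rfl
  have h2 : PT fun A : Aut => (StackProg.parse (encodeDPA A.2).reverse).length :=
    (PT.parse.comp h1).length
  have h3 : ∀ A : Aut, (StackProg.parse (encodeDPA A.2).reverse).length = (flat A).length := by
    intro A
    have : StackProg.parse (encodeDPA A.2).reverse = _ := parse_trList (flat A)
    rw [this, List.length_map]
  simp only [h3] at h2
  exact h2.comp hf

theorem PT.entry {f : α → Aut} {i : α → ℕ} (hf : PT f) (hi : PT i) :
    PT fun a => min (flat (f a)).length ((flat (f a)).getD (i a) 0) := by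
  obtain ⟨l, hl, h⟩ := PT.digits hf hi
  simp only [← h]
  exact PT.min_bitVal (by fun_prop) hl

@[fun_prop]
theorem PT.numLetters {f : α → Aut} (hf : PT f) : PT fun a => (f a).1 := by
  have := PT.entry hf (PT.const 0)
  refine cast (congrArg PT (funext fun a => ?_)) this
  -- The initial state shows that there is at least one row, so the description is longer than the
  -- number of letters and the truncation is void.
  have h : 0 < (f a).2.1 := Fin.pos (f a).2.2.init
  rw [StackProg.length_flat]
  change min _ (f a).1 = _
  apply min_eq_right
  nlinarith

@[fun_prop]
theorem PT.numStates {f : α → Aut} (hf : PT f) : PT fun a => (f a).2.1 := by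
  have := PT.entry hf (PT.const 1)
  refine cast (congrArg PT (funext fun a => ?_)) this
  rw [StackProg.length_flat]
  change min _ (f a).2.1 = _
  apply min_eq_right
  nlinarith

@[fun_prop]
theorem PT.init {f : α → Aut} (hf : PT f) : PT fun a => ((f a).2.2.init : ℕ) := by
  have := PT.entry hf (PT.const 2)
  refine cast (congrArg PT (funext fun a => ?_)) this
  exact min_eq_right (val_lt_length_flat _ _).le

@[fun_prop]
theorem PT.stepN {f : α → Aut} {q s : α → ℕ} (hf : PT f) (hq : PT q) (hs : PT s) :
    PT fun a => stepN (f a) (q a) (s a) :=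
  PT.entry hf (i := fun a => 3 + q a * ((f a).1 + 1) + 1 + s a) (by fun_prop)

@[fun_prop]
theorem PT.prioN_le {f g : α → Aut} {q q' : α → ℕ} (hf : PT f) (hg : PT g) (hq : PT q)
    (hq' : PT q') : PT fun a => prioN (f a) (q a) ≤ prioN (g a) (q' a) := by
  obtain ⟨l, hl, h⟩ := PT.digits hf (i := fun a => 3 + q a * ((f a).1 + 1)) (by fun_prop)
  obtain ⟨l', hl', h'⟩ := PT.digits hg (i := fun a => 3 + q' a * ((g a).1 + 1)) (by fun_prop)
  simp only [prioN, ← h, ← h']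
  exact PT.bitVal_le hl hl'

@[fun_prop]
theorem PT.even_prioN {f : α → Aut} {q : α → ℕ} (hf : PT f) (hq : PT q) :
    PT fun a => Even (prioN (f a) (q a)) := by
  obtain ⟨l, hl, h⟩ := PT.digits hf (i := fun a => 3 + q a * ((f a).1 + 1)) (by fun_prop)
  simp only [prioN, ← h]
  exact PT.even_bitVal hl

end

/-! ### Runs of deterministic transition systems -/

section
variable {V V' α : Type}

/-- The run from the state `v` on an infinite word. -/
def runF (step : V → α → V) (v : V) (a : Stream' α) : ℕ → V
  | 0 => v
  | i + 1 => step (runF step v a i) (a.get i)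

/-- The states that occur infinitely often in the run from `v`. -/
def infF (step : V → α → V) (v : V) (a : Stream' α) : Set V :=
  {q | ∃ᶠ i in atTop, runF step v a i = q}

/-- The parity condition for the set of states occurring infinitely often. -/
def Acc (prio : V → ℕ) (S : Set V) : Prop := ∃ m, IsGreatest (prio '' S) m ∧ Even m

theorem run_eq_runF {Q : Type} (T : DTS α Q) (a : Stream' α) (i : ℕ) :
    T.run a i = runF T.step T.init a i := by
  induction i with
  | zero => rfl
  | succ i ih => rw [DTS.run, ih]; rfl

theorem infs_eq_infF {Q : Type} (T : DTS α Q) (a : Stream' α) :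
    T.infs a = infF T.step T.init a := by
  ext q; simp only [DTS.infs, infF, run_eq_runF]

theorem runF_map {step : V → α → V} {step' : V' → α → V'} {φ : V → V'} {a : Stream' α} {v : V}
    (h : ∀ i, φ (step (runF step v a i) (a.get i)) = step' (φ (runF step v a i)) (a.get i)) (i : ℕ) :
    runF step' (φ v) a i = φ (runF step v a i) := by
  induction i with
  | zero => rfl
  | succ i ih => rw [runF, ih, runF, h]

theorem infF_subset_range (step : V → α → V) (v : V) (a : Stream' α) :
    infF step v a ⊆ Set.range (runF step v a) := fun _ hq =>
  let ⟨i, hi⟩ := hq.exists; ⟨i, hi⟩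

variable {step : V → α → V} {v : V} {a : Stream' α}

/-- Only finitely many states are visited, and each of those visited finitely often is left behind
at some time. -/
theorem eventually_mem_infF (hfin : (Set.range (runF step v a)).Finite) :
    ∀ᶠ i in atTop, runF step v a i ∈ infF step v a := by
  have h1 : ∀ q ∈ Set.range (runF step v a) \ infF step v a,
      ∀ᶠ i in atTop, runF step v a i ≠ q := fun q hq => not_frequently.1 hq.2
  have h2 := ((hfin.subset Set.sdiff_subset).eventually_all (l := atTop)
    (p := fun q i => runF step v a i ≠ q)).2 h1
  filter_upwards [h2] with i hi
  by_contra hc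
  exact hi _ ⟨⟨i, rfl⟩, hc⟩ rfl

theorem infF_nonempty (hfin : (Set.range (runF step v a)).Finite) : (infF step v a).Nonempty :=
  let ⟨_, hi⟩ := (eventually_mem_infF hfin).exists; ⟨_, hi⟩

theorem infF_finite (hfin : (Set.range (runF step v a)).Finite) : (infF step v a).Finite :=
  hfin.subset (infF_subset_range _ _ _)

/-- Finiteness is needed for one inclusion: a state of the image might otherwise be visited
infinitely often through ever new preimages. -/
theorem infF_map {step' : V' → α → V'} {φ : V → V'}
    (hfin : (Set.range (runF step v a)).Finite)
    (h : ∀ i, φ (step (runF step v a i) (a.get i)) = step' (φ (runF step v a i)) (a.get i)) :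
    infF step' (φ v) a = φ '' infF step v a := by
  ext w
  constructor
  · intro hw
    have h1 := (Filter.Frequently.and_eventually hw (eventually_mem_infF hfin))
    obtain ⟨i, hi, hi'⟩ := h1.exists
    rw [runF_map h] at hi
    exact ⟨_, hi', hi⟩
  · rintro ⟨q, hq, rfl⟩
    exact Filter.Frequently.mono hq fun i hi => by rw [runF_map h, hi]

/-- The edges between states that satisfy `P`. -/
def Edge (step : V → α → V) (P : V → Prop) (x y : V) : Prop := P x ∧ P y ∧ ∃ s, step x s = y

theorem transGen_runF {P : V → Prop} {N : ℕ} (hN : ∀ i, N ≤ i → P (runF step v a i)) {i : ℕ}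
    (hi : N ≤ i) {j : ℕ} (hj : i < j) :
    Relation.TransGen (Edge step P) (runF step v a i) (runF step v a j) := by
  induction j, hj using Nat.le_induction with
  | base => exact .single ⟨hN _ hi, hN _ (by omega), _, rfl⟩
  | succ j hj ih => exact ih.tail ⟨hN _ (by omega), hN _ (by omega), _, rfl⟩

/-- From some time on the run stays among the states that it visits infinitely often, and it returns
to each of them. They therefore form a strongly connected subgraph, and the connecting paths are
nonempty. -/
theorem transGen_infF (hfin : (Set.range (runF step v a)).Finite) {p q : V}
    (hp : p ∈ infF step v a) (hq : q ∈ infF step v a) :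
    Relation.TransGen (Edge step (· ∈ infF step v a)) p q := by
  obtain ⟨N, hN⟩ := eventually_atTop.1 (eventually_mem_infF hfin)
  obtain ⟨i, hi, rfl⟩ := frequently_atTop.1 hp N
  obtain ⟨j, hj, rfl⟩ := frequently_atTop.1 hq (i + 1)
  exact transGen_runF hN hi hj

theorem runF_append (u : List α) (a : Stream' α) (v : V) (i : ℕ) :
    runF step v (u ++ₛ a) (u.length + i) = runF step (u.foldl step v) a i := by
  induction i with
  | zero =>
    induction u generalizing v with
    | nil => rfl
    | cons s u ih =>
      have : ∀ (w : Stream' α) j, runF step v (Stream'.cons s w) (j + 1) = runF step (step v s) w j := by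
        intro w j
        induction j with
        | zero => rfl
        | succ j ih => rw [runF, ih]; rfl
      rw [List.foldl_cons, ← ih, List.length_cons]
      exact this _ _
  | succ i ih =>
    rw [← Nat.add_assoc, runF, ih, runF, Stream'.get_append_right]

theorem infF_append (u : List α) (a : Stream' α) (v : V) :
    infF step v (u ++ₛ a) = infF step (u.foldl step v) a := by
  ext q
  simp only [infF, Set.mem_ofPred_eq, ← runF_append, frequently_atTop]
  constructor
  · intro h N
    obtain ⟨i, hi, h⟩ := h (u.length + N)
    exact ⟨i - u.length, by omega, by rwa [Nat.add_sub_cancel' (by omega)]⟩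
  · intro h N
    obtain ⟨i, hi, h⟩ := h N
    exact ⟨_, by omega, h⟩

theorem exists_word_of_transGen {P : V → Prop} {p r : V}
    (h : Relation.TransGen (Edge step P) p r) :
    ∃ w : List α, w ≠ [] ∧ w.foldl step p = r ∧ ∀ j ≤ w.length, P ((w.take j).foldl step p) := by
  induction h with
  | single h =>
    obtain ⟨h1, h2, s, rfl⟩ := h
    refine ⟨[s], by simp, rfl, fun j hj => ?_⟩
    rcases j with _ | _ | j
    · exact h1
    · exact h2
    · simp at hj
  | tail _ h ih =>
    obtain ⟨w, hw, rfl, hP⟩ := ih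
    obtain ⟨h1, h2, s, rfl⟩ := h
    refine ⟨w ++ [s], by simp, by simp, fun j hj => ?_⟩
    rcases Nat.lt_or_ge w.length j with h | h
    · rw [List.take_of_length_le (by simp; omega)]; simpa using h2
    · rw [List.take_append_of_le_length h]; exact hP j h

/-- A cycle can be run through forever. -/
theorem exists_infF_of_cycle {P : V → Prop} {p r : V} (h : Relation.TransGen (Edge step P) p r)
    (h' : Relation.TransGen (Edge step P) r p) (v : V) (u : List α) (hu : u.foldl step v = p) :
    ∃ a : Stream' α, p ∈ infF step v a ∧ r ∈ infF step v a ∧ ∀ x ∈ infF step v a, P x := by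
  obtain ⟨w₁, hw₁, h₁, hP₁⟩ := exists_word_of_transGen h
  obtain ⟨w₂, hw₂, h₂, hP₂⟩ := exists_word_of_transGen h'
  set w := w₁ ++ w₂ with hwdef
  have hlen : 0 < w.length := by
    rw [hwdef, List.length_append]; have := List.length_pos_iff.2 hw₁; omega
  have hwp : w.foldl step p = p := by rw [hwdef, List.foldl_append, h₁, h₂]
  have hP : ∀ j ≤ w.length, P ((w.take j).foldl step p) := by
    intro j hj
    rcases Nat.le_total j w₁.length with h | h
    · rw [hwdef, List.take_append_of_le_length h]; exact hP₁ j h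
    · rw [hwdef, List.take_append, List.take_of_length_le h, List.foldl_append, h₁]
      refine hP₂ _ ?_
      rw [hwdef, List.length_append] at hj; omega
  -- The closed walk `w` repeated forever: at time `i` the run from `p` is where the first `i %
  -- w.length` letters of `w` lead.
  let a : Stream' α := fun i => w[i % w.length]'(Nat.mod_lt _ hlen)
  have hrun : ∀ i, runF step p a i = (w.take (i % w.length)).foldl step p := by
    intro i
    induction i with
    | zero => simp [runF]
    | succ i ih =>
      have hlt := Nat.mod_lt i hlen
      have hstep : runF step p a (i + 1) = (w.take (i % w.length + 1)).foldl step p := by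
        rw [runF, ih, List.take_succ_eq_append_getElem hlt, List.foldl_append]; rfl
      rw [hstep]
      rcases Nat.lt_or_ge (i % w.length + 1) w.length with h | h
      · rw [Nat.add_mod, Nat.mod_eq_of_lt (b := w.length) (a := i % w.length + 1 % w.length)]
        · rw [Nat.mod_eq_of_lt (a := 1)]; omega
        · rw [Nat.mod_eq_of_lt (a := 1)]
          · exact h
          · omega
      · have h1 : i % w.length + 1 = w.length := by omega
        have h2 : (i + 1) % w.length = 0 := by
          rw [← Nat.mod_add_mod, h1, Nat.mod_self]
        rw [h1, h2, List.take_length, hwp]; rfl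
  have hinf : ∀ j < w.length, (w.take j).foldl step p ∈ infF step p a := by
    intro j hj
    refine frequently_atTop.2 fun N => ⟨j + N * w.length, ?_, ?_⟩
    · nlinarith
    · rw [hrun, Nat.add_mul_mod_self_right, Nat.mod_eq_of_lt hj]
  refine ⟨u ++ₛ a, ?_⟩
  rw [infF_append, hu]
  refine ⟨hinf 0 hlen, ?_, ?_⟩
  · have := hinf w₁.length (by
      rw [hwdef, List.length_append]; have := List.length_pos_iff.2 hw₂; omega)
    rwa [hwdef, List.take_left, h₁] at this
  · intro x hx
    obtain ⟨i, rfl⟩ := infF_subset_range _ _ _ hx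
    rw [hrun]
    exact hP _ (Nat.mod_lt _ hlen).le

theorem exists_top {S : Set V} (hS : S.Finite) (hne : S.Nonempty) (f : V → ℕ) :
    ∃ p ∈ S, ∀ x ∈ S, f x ≤ f p := Set.exists_max_image S f hS hne

theorem acc_iff {prio : V → ℕ} {S : Set V} {p : V} (hp : p ∈ S) (h : ∀ x ∈ S, prio x ≤ prio p) :
    Acc prio S ↔ Even (prio p) := by
  have h1 : IsGreatest (prio '' S) (prio p) :=
    ⟨⟨p, hp, rfl⟩, by rintro _ ⟨x, hx, rfl⟩; exact h x hx⟩
  constructor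
  · rintro ⟨m, hm, he⟩
    rwa [← hm.unique h1]
  · exact fun he => ⟨_, h1, he⟩

end

/-! ### Graph characterizations for parity automata -/

theorem transGen_mono {V : Type} {r s : V → V → Prop} {x y : V} (h : Relation.TransGen r x y)
    (hrs : ∀ x y, r x y → s x y) : Relation.TransGen s x y := by
  induction h with
  | single h => exact .single (hrs _ _ h)
  | tail _ h ih => exact ih.tail (hrs _ _ h)

section
variable (A : Aut)

/-- The transition function on natural numbers. -/
def sN (q : ℕ) (s : Fin A.1) : ℕ := stepN A q s

/-- The words accepted from a state. -/
def langN (q : ℕ) : Set (Stream' (Fin A.1)) := {a | Acc (prioN A) (infF (sN A) q a)}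

theorem sN_val (q : Fin A.2.1) (s : Fin A.1) : sN A q s = A.2.2.step q s := stepN_val A q s

theorem sN_lt {q : ℕ} (hq : q < A.2.1) (s : Fin A.1) : sN A q s < A.2.1 := by
  have := sN_val A ⟨q, hq⟩ s
  dsimp only at this
  rw [this]; exact Fin.is_lt _

theorem runF_sN_lt {q : ℕ} (hq : q < A.2.1) (a : Stream' (Fin A.1)) (i : ℕ) :
    runF (sN A) q a i < A.2.1 := by
  induction i with
  | zero => exact hq
  | succ i ih => exact sN_lt A ih _

theorem finite_range_runF {q : ℕ} (hq : q < A.2.1) (a : Stream' (Fin A.1)) :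
    (Set.range (runF (sN A) q a)).Finite :=
  (Set.finite_lt_nat A.2.1).subset (by rintro _ ⟨i, rfl⟩; exact runF_sN_lt A hq a i)

theorem infF_lt {q : ℕ} (hq : q < A.2.1) (a : Stream' (Fin A.1)) :
    ∀ x ∈ infF (sN A) q a, x < A.2.1 := fun x hx => by
  obtain ⟨i, rfl⟩ := infF_subset_range _ _ _ hx
  exact runF_sN_lt A hq a i

theorem foldl_sN (u : List (Fin A.1)) (q : Fin A.2.1) :
    u.foldl (sN A) q = (u.foldl A.2.2.step q : Fin A.2.1) := by
  induction u generalizing q with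
  | nil => rfl
  | cons s u ih => rw [List.foldl_cons, List.foldl_cons, sN_val, ih]

theorem infF_sN (q : Fin A.2.1) (a : Stream' (Fin A.1)) :
    infF (sN A) q a = Fin.val '' infF A.2.2.step q a :=
  infF_map (φ := Fin.val) (Set.toFinite _) fun _ => (sN_val A _ _).symm

theorem langN_init : langN A A.2.2.init = A.2.2.language := by
  ext a
  simp only [langN, DPA.language, Acc, Set.mem_ofPred_eq, infF_sN, infs_eq_infF, Set.image_image,
    prioN_val]

/-- Two states accept the same words. -/
def Eqv (p q : ℕ) : Prop := ∀ a, a ∈ langN A p ↔ a ∈ langN A q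

theorem langN_append (q : ℕ) (u : List (Fin A.1)) (a : Stream' (Fin A.1)) :
    u ++ₛ a ∈ langN A q ↔ a ∈ langN A (u.foldl (sN A) q) := by
  simp only [langN, Set.mem_ofPred_eq, infF_append]

theorem Eqv.step {p q : ℕ} (h : Eqv A p q) (s : Fin A.1) : Eqv A (sN A p s) (sN A q s) := by
  intro a
  have := h ([s] ++ₛ a)
  rwa [langN_append, langN_append] at this

/-- Edges of the product of the automaton with itself. -/
def pairEdge (x y : ℕ × ℕ) : Prop :=
  (x.1 < A.2.1 ∧ x.2 < A.2.1) ∧ ∃ s < A.1, stepN A x.1 s = y.1 ∧ stepN A x.2 s = y.2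

/-- Edges of the product along which the priorities are bounded by those of given states. -/
def pairEdgeLE (p r x y : ℕ × ℕ) : Prop :=
  pairEdge A x y ∧ (prioN A x.1 ≤ prioN A p.1 ∧ prioN A x.2 ≤ prioN A r.2) ∧
    (prioN A y.1 ≤ prioN A p.1 ∧ prioN A y.2 ≤ prioN A r.2)

/-- The pairs of states. -/
def statePairs : List (ℕ × ℕ) :=
  (List.range A.2.1).flatMap fun i => (List.range A.2.1).map fun j => (i, j)

theorem mem_statePairs {x : ℕ × ℕ} : x ∈ statePairs A ↔ x.1 < A.2.1 ∧ x.2 < A.2.1 := by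
  rcases x with ⟨i, j⟩
  simp [statePairs]

/-- The graph-theoretic criterion for inequivalence. -/
def Ineq (x : ℕ × ℕ) : Prop :=
  ∃ p ∈ statePairs A, ∃ r ∈ statePairs A, Relation.TransGen (pairEdge A) x p ∧
    (Even (prioN A p.1) ↔ ¬ Even (prioN A r.2)) ∧
    Relation.TransGen (pairEdgeLE A p r) p r ∧ Relation.TransGen (pairEdgeLE A p r) r p

def sP (x : ℕ × ℕ) (s : Fin A.1) : ℕ × ℕ := (sN A x.1 s, sN A x.2 s)

theorem pairEdge_mem {x y : ℕ × ℕ} (h : pairEdge A x y) : y ∈ statePairs A := by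
  obtain ⟨⟨h1, h2⟩, s, hs, h3, h4⟩ := h
  rw [mem_statePairs, ← h3, ← h4]
  exact ⟨sN_lt A h1 ⟨s, hs⟩, sN_lt A h2 ⟨s, hs⟩⟩

theorem edge_sP_of_pairEdge {x y : ℕ × ℕ} (h : pairEdge A x y) : ∃ s, sP A x s = y := by
  obtain ⟨_, s, hs, h3, h4⟩ := h
  exact ⟨⟨s, hs⟩, Prod.ext h3 h4⟩

theorem pairEdge_of_sP {x y : ℕ × ℕ} (hx : x.1 < A.2.1 ∧ x.2 < A.2.1) (h : ∃ s, sP A x s = y) :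
    pairEdge A x y := by
  obtain ⟨s, rfl⟩ := h
  exact ⟨hx, s, s.2, rfl, rfl⟩

theorem runF_sP (x : ℕ × ℕ) (a : Stream' (Fin A.1)) (i : ℕ) :
    runF (sP A) x a i = (runF (sN A) x.1 a i, runF (sN A) x.2 a i) := by
  induction i with
  | zero => rfl
  | succ i ih => rw [runF, ih]; rfl

theorem runF_sP_lt {x : ℕ × ℕ} (hx : x.1 < A.2.1 ∧ x.2 < A.2.1) (a : Stream' (Fin A.1)) (i : ℕ) :
    (runF (sP A) x a i).1 < A.2.1 ∧ (runF (sP A) x a i).2 < A.2.1 := by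
  rw [runF_sP]; exact ⟨runF_sN_lt A hx.1 a i, runF_sN_lt A hx.2 a i⟩

theorem finite_range_sP {x : ℕ × ℕ} (hx : x.1 < A.2.1 ∧ x.2 < A.2.1) (a : Stream' (Fin A.1)) :
    (Set.range (runF (sP A) x a)).Finite :=
  (((Set.finite_lt_nat A.2.1).prod (Set.finite_lt_nat A.2.1))).subset
    (by rintro _ ⟨i, rfl⟩; exact runF_sP_lt A hx a i)

/-- The runs from `x.1` and `x.2` on a word are the projections of one run of the product. Its
infinitely visited pairs are strongly connected, and the two acceptances are read off from pairs `p`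
and `r` with maximal priority in the first and in the second component. Conversely, a cycle through
`p` and `r` that respects both bounds can be reached and repeated forever, and the resulting word
separates the two states. -/
theorem ineq_iff {x : ℕ × ℕ} (hx : x.1 < A.2.1 ∧ x.2 < A.2.1) :
    Ineq A x ↔ ¬ Eqv A x.1 x.2 := by
  have hfst := fun a => infF_map (φ := Prod.fst) (step' := sN A) (finite_range_sP A hx a)
    (fun _ => rfl)
  have hsnd := fun a => infF_map (φ := Prod.snd) (step' := sN A) (finite_range_sP A hx a)
    (fun _ => rfl)
  constructor
  · rintro ⟨p, hp, r, hr, hxp, hpar, hpr, hrp⟩ heq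
    obtain ⟨u, -, hu, -⟩ := exists_word_of_transGen
      (transGen_mono (s := Edge (sP A) fun _ => True) hxp
        fun x y h => ⟨trivial, trivial, edge_sP_of_pairEdge A h⟩)
    have hm : ∀ x y, pairEdgeLE A p r x y → Edge (sP A)
        (fun y => prioN A y.1 ≤ prioN A p.1 ∧ prioN A y.2 ≤ prioN A r.2) x y :=
      fun x y h => ⟨h.2.1, h.2.2, edge_sP_of_pairEdge A h.1⟩
    obtain ⟨a, ha, ha', hP⟩ := exists_infF_of_cycle (transGen_mono hpr hm) (transGen_mono hrp hm) x u hu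
    have h1 : a ∈ langN A x.1 ↔ Even (prioN A p.1) := by
      refine acc_iff (S := infF (sN A) x.1 a) ?_ ?_
      · rw [hfst]; exact ⟨p, ha, rfl⟩
      · rw [hfst]; rintro _ ⟨y, hy, rfl⟩; exact (hP y hy).1
    have h2 : a ∈ langN A x.2 ↔ Even (prioN A r.2) := by
      refine acc_iff (S := infF (sN A) x.2 a) ?_ ?_
      · rw [hsnd]; exact ⟨r, ha', rfl⟩
      · rw [hsnd]; rintro _ ⟨y, hy, rfl⟩; exact (hP y hy).2
    have := heq a
    tauto
  · intro h
    obtain ⟨a, ha⟩ := not_forall.1 h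
    have hf := finite_range_sP A hx a
    obtain ⟨p, hp, hp'⟩ := exists_top (infF_finite hf) (infF_nonempty hf) fun y => prioN A y.1
    obtain ⟨r, hr, hr'⟩ := exists_top (infF_finite hf) (infF_nonempty hf) fun y => prioN A y.2
    have hlt : ∀ y ∈ infF (sP A) x a, y.1 < A.2.1 ∧ y.2 < A.2.1 := fun y hy => by
      obtain ⟨i, rfl⟩ := infF_subset_range _ _ _ hy
      exact runF_sP_lt A hx a i
    have h1 : a ∈ langN A x.1 ↔ Even (prioN A p.1) := by
      refine acc_iff (S := infF (sN A) x.1 a) ?_ ?_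
      · rw [hfst]; exact ⟨p, hp, rfl⟩
      · rw [hfst]; rintro _ ⟨y, hy, rfl⟩; exact hp' y hy
    have h2 : a ∈ langN A x.2 ↔ Even (prioN A r.2) := by
      refine acc_iff (S := infF (sN A) x.2 a) ?_ ?_
      · rw [hsnd]; exact ⟨r, hr, rfl⟩
      · rw [hsnd]; rintro _ ⟨y, hy, rfl⟩; exact hr' y hy
    have hm : ∀ y z, Edge (sP A) (· ∈ infF (sP A) x a) y z → pairEdgeLE A p r y z :=
      fun y z h => ⟨pairEdge_of_sP A (hlt y h.1) h.2.2, ⟨hp' y h.1, hr' y h.1⟩,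
        ⟨hp' z h.2.1, hr' z h.2.1⟩⟩
    refine ⟨p, (mem_statePairs A).2 (hlt p hp), r, (mem_statePairs A).2 (hlt r hr), ?_, by tauto,
      transGen_mono (transGen_infF hf hp hr) hm, transGen_mono (transGen_infF hf hr hp) hm⟩
    -- A visit at a positive time, since the path from `x` to `p` has to be nonempty.
    obtain ⟨j, hj, hj'⟩ := frequently_atTop.1 hp 1
    have := transGen_runF (step := sP A) (v := x) (a := a)
      (P := fun y => y.1 < A.2.1 ∧ y.2 < A.2.1) (N := 0) (i := 0)
      (fun i _ => runF_sP_lt A hx a i) le_rfl hj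
    rw [hj'] at this
    exact transGen_mono this fun y z h => pairEdge_of_sP A h.1 h.2.2

/-- Edges within `W` along which the priorities are bounded by that of `t`. -/
def loopEdge (W : List ℕ) (t x y : ℕ) : Prop :=
  (x ∈ W ∧ prioN A x ≤ prioN A t) ∧ (y ∈ W ∧ prioN A y ≤ prioN A t) ∧ ∃ s < A.1, stepN A x s = y

/-- There is a loop within `W` through the class of `x` whose highest priority is even iff `e`
holds. -/
def HasLoop (e : Prop) (W : List ℕ) (x : ℕ) : Prop :=
  ∃ t < A.2.1, (Even (prioN A t) ↔ e) ∧ ∃ b < A.2.1, ¬ Ineq A (b, x) ∧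
    Relation.TransGen (loopEdge A W t) t b ∧ Relation.TransGen (loopEdge A W t) b t

/-- The states that occur infinitely often on an input word. -/
def infA (a : Stream' (Fin A.1)) : Set ℕ := infF (sN A) A.2.2.init a

theorem infA_lt {a : Stream' (Fin A.1)} {x : ℕ} (hx : x ∈ infA A a) : x < A.2.1 :=
  infF_lt A A.2.2.init.2 a x hx

theorem infA_finite (a : Stream' (Fin A.1)) : (infA A a).Finite :=
  infF_finite (finite_range_runF A A.2.2.init.2 a)

theorem infA_nonempty (a : Stream' (Fin A.1)) : (infA A a).Nonempty :=
  infF_nonempty (finite_range_runF A A.2.2.init.2 a)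

theorem mem_language_iff {a : Stream' (Fin A.1)} {t : ℕ} (ht : t ∈ infA A a)
    (h : ∀ x ∈ infA A a, prioN A x ≤ prioN A t) :
    a ∈ A.2.2.language ↔ Even (prioN A t) := by
  rw [← langN_init]; exact acc_iff (S := infA A a) ht h

/-- The witness `t` is a state of maximal priority on the loop, so its parity decides acceptance. A
cycle found in the graph is entered from the initial state because all states are reachable. -/
theorem hasLoop_iff (e : Prop) (W : List ℕ) {x : ℕ} (hx : x < A.2.1) :
    HasLoop A e W x ↔ ∃ a : Stream' (Fin A.1), (a ∈ A.2.2.language ↔ e) ∧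
      (∀ y ∈ infA A a, y ∈ W) ∧ ∃ b ∈ infA A a, Eqv A b x := by
  constructor
  · rintro ⟨t, ht, he, b, hb, hbx, h1, h2⟩
    have hm : ∀ x y, loopEdge A W t x y →
        Edge (sN A) (fun y => y ∈ W ∧ prioN A y ≤ prioN A t) x y :=
      fun x y h => ⟨h.1, h.2.1, let ⟨s, hs, h⟩ := h.2.2; ⟨⟨s, hs⟩, h⟩⟩
    obtain ⟨u, hu⟩ := A.2.2.reachable ⟨t, ht⟩
    obtain ⟨a, ha, ha', hP⟩ := exists_infF_of_cycle (transGen_mono h1 hm) (transGen_mono h2 hm) A.2.2.init u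
      (by rw [foldl_sN, hu])
    refine ⟨a, (mem_language_iff A ha fun y hy => (hP y hy).2).trans he, fun y hy => (hP y hy).1,
      b, ha', ?_⟩
    rw [ineq_iff A ⟨hb, hx⟩, not_not] at hbx
    exact hbx
  · rintro ⟨a, he, hW, b, hb, hbx⟩
    obtain ⟨t, ht, ht'⟩ := exists_top (infA_finite A a) (infA_nonempty A a) (prioN A)
    have hf := finite_range_runF A A.2.2.init.2 a
    have hm : ∀ y z, Edge (sN A) (· ∈ infA A a) y z → loopEdge A W t y z :=
      fun y z h => ⟨⟨hW y h.1, ht' y h.1⟩, ⟨hW z h.2.1, ht' z h.2.1⟩,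
        let ⟨s, h⟩ := h.2.2; ⟨s, s.2, h⟩⟩
    refine ⟨t, infA_lt A ht, (mem_language_iff A ht ht').symm.trans he, b, infA_lt A hb, ?_,
      transGen_mono (transGen_infF hf ht hb) hm, transGen_mono (transGen_infF hf hb ht) hm⟩
    rw [ineq_iff A ⟨infA_lt A hb, hx⟩, not_not]
    exact hbx

end

/-! ### Layers of states -/

theorem length_filter_range {P : ℕ → Prop} [DecidablePred P] {N m : ℕ} (hm : m ≤ N)
    (h : ∀ r < N, P r ↔ r < m) : ((List.range N).filter fun r => P r).length = m := by
  have : (List.range N).filter (fun r => P r) = List.range m := by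
    obtain ⟨d, rfl⟩ := Nat.exists_eq_add_of_le hm
    rw [List.range_add, List.filter_append,
      List.filter_eq_self.2 fun r hr => by
        have := List.mem_range.1 hr
        simp [h r (by omega), this],
      List.filter_eq_nil_iff.2 fun r hr => by
        obtain ⟨j, hj, rfl⟩ := List.mem_map.1 hr
        have := List.mem_range.1 hj
        simp [h (m + j) (by omega)], List.append_nil]
  rw [this, List.length_range]

theorem Eqv.symm {A : Aut} {p q : ℕ} (h : Eqv A p q) : Eqv A q p := fun a => (h a).symm

theorem Eqv.trans {A : Aut} {p q r : ℕ} (h : Eqv A p q) (h' : Eqv A q r) : Eqv A p r :=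
  fun a => (h a).trans (h' a)

theorem Eqv.rfl {A : Aut} {p : ℕ} : Eqv A p p := fun _ => Iff.rfl

section
variable (A : Aut) (e : Prop)

open Classical in
/-- Repeatedly remove the states through whose classes there is no loop of a given parity, the
parity alternating from step to step. -/
noncomputable def layer : ℕ → List ℕ
  | 0 => List.range A.2.1
  | r + 1 => (layer r).filter fun x => HasLoop A (e ↔ Even r) (layer r) x

open Classical in
/-- The last layer that contains a state. -/
noncomputable def mark (N x : ℕ) : ℕ := ((List.range N).filter fun r => x ∈ layer A e (r + 1)).length

theorem layer_succ_sublist (r : ℕ) : (layer A e (r + 1)).Sublist (layer A e r) :=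
  List.filter_sublist

theorem layer_sublist {r r' : ℕ} (h : r ≤ r') : (layer A e r').Sublist (layer A e r) := by
  induction r', h using Nat.le_induction with
  | base => exact List.Sublist.refl _
  | succ r' _ ih => exact (layer_succ_sublist A e r').trans ih

theorem mem_layer_zero {x : ℕ} : x ∈ layer A e 0 ↔ x < A.2.1 := List.mem_range

theorem lt_of_mem_layer {r x : ℕ} (h : x ∈ layer A e r) : x < A.2.1 :=
  (mem_layer_zero A e).1 ((layer_sublist A e (Nat.zero_le r)).subset h)

theorem mem_layer_succ {r x : ℕ} : x ∈ layer A e (r + 1) ↔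
    x ∈ layer A e r ∧ HasLoop A (e ↔ Even r) (layer A e r) x := by
  rw [layer, List.mem_filter]; simp

/-- A loop is only required to meet the class of a state, so the condition for survival depends on
the class alone. -/
theorem mem_layer_of_eqv {r x y : ℕ} (hx : x ∈ layer A e r) (hy : y < A.2.1) (h : Eqv A x y) :
    y ∈ layer A e r := by
  induction r with
  | zero => exact (mem_layer_zero A e).2 hy
  | succ r ih =>
    rw [mem_layer_succ] at hx ⊢
    refine ⟨ih hx.1, ?_⟩
    obtain ⟨a, h1, h2, b, hb, hbx⟩ :=
      (hasLoop_iff A _ _ (lt_of_mem_layer A e hx.1)).1 hx.2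
    exact (hasLoop_iff A _ _ hy).2 ⟨a, h1, h2, b, hb, hbx.trans h⟩

variable {A e}

/-- The layers decrease, so the number of layers of positive index that contain a state is the index
of the last layer containing it. Emptiness of layer `N` ensures that the count up to `N` misses
none. -/
theorem mark_spec {N : ℕ} (hN : layer A e N = []) {x : ℕ} (hx : x < A.2.1) :
    mark A e N x < N ∧ ∀ r, x ∈ layer A e r ↔ r ≤ mark A e N x := by
  classical
  have hex : ∃ r, x ∉ layer A e r := ⟨N, by simp [hN]⟩
  have hpos : Nat.find hex ≠ 0 := fun h =>
    Nat.find_spec hex (by rw [h]; exact (mem_layer_zero A e).2 hx)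
  have hle : Nat.find hex ≤ N := Nat.find_le (by simp [hN])
  have key : ∀ r, x ∈ layer A e r ↔ r < Nat.find hex := fun r => by
    constructor
    · intro h
      by_contra hc
      exact Nat.find_spec hex ((layer_sublist A e (not_lt.1 hc)).subset h)
    · exact fun h => not_not.1 (Nat.find_min hex h)
  have hm : mark A e N x = Nat.find hex - 1 := by
    have := length_filter_range (P := fun r => x ∈ layer A e (r + 1)) (N := N)
      (m := Nat.find hex - 1) (by omega) (fun r _ => by rw [key]; omega)
    rw [← this, mark]
  rw [hm]
  exact ⟨by omega, fun r => by rw [key]; omega⟩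

theorem mark_congr {N : ℕ} {x y : ℕ} (hx : x < A.2.1) (hy : y < A.2.1) (h : Eqv A x y) :
    mark A e N x = mark A e N y := by
  classical
  unfold mark
  congr 2
  funext r
  congr 1
  exact propext ⟨fun hm => mem_layer_of_eqv A e hm hy h, fun hm => mem_layer_of_eqv A e hm hx h.symm⟩

/-- The least mark on a loop decides acceptance. -/
theorem mem_language_iff_mark {N : ℕ} (hN : layer A e N = []) {a : Stream' (Fin A.1)} {x : ℕ}
    (hx : x ∈ infA A a) (hmin : ∀ y ∈ infA A a, mark A e N x ≤ mark A e N y) :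
    a ∈ A.2.2.language ↔ ¬ (e ↔ Even (mark A e N x)) := by
  have hx' := mark_spec hN (infA_lt A hx)
  have h1 : x ∈ layer A e (mark A e N x) := (hx'.2 _).2 le_rfl
  have h2 : x ∉ layer A e (mark A e N x + 1) := fun h => by
    have := (hx'.2 _).1 h; omega
  rw [mem_layer_succ, not_and] at h2
  have h3 := h2 h1
  rw [hasLoop_iff A _ _ (infA_lt A hx)] at h3
  by_contra hc
  -- All states of the loop of `a` lie in the layer given by the least mark. With the other
  -- acceptance, this loop would witness that `x` survives to the next layer.
  refine h3 ⟨a, ?_, fun y hy => ((mark_spec hN (infA_lt A hy)).2 _).2 (hmin y hy), x, hx, Eqv.rfl⟩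
  tauto

/-- A rank function whose least value on a loop decides acceptance bounds the layers. -/
theorem le_rank_of_mem_layer {ρ : ℕ → ℕ}
    (hρ : ∀ x y, x < A.2.1 → y < A.2.1 → Eqv A x y → ρ x = ρ y)
    (hacc : ∀ (a : Stream' (Fin A.1)) (x : ℕ), x ∈ infA A a → (∀ y ∈ infA A a, ρ x ≤ ρ y) →
      (a ∈ A.2.2.language ↔ ¬ (e ↔ Even (ρ x)))) {r x : ℕ} (hx : x ∈ layer A e r) : r ≤ ρ x := by
  induction r generalizing x with
  | zero => exact Nat.zero_le _
  | succ r ih =>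
    rw [mem_layer_succ] at hx
    have h1 := ih hx.1
    by_contra hc
    have h2 : ρ x = r := by omega
    -- A state of rank `r` in layer `r + 1` has a loop inside layer `r` through its class. By
    -- induction `r` is the least rank on this loop, and then the acceptance dictated by the rank
    -- contradicts the one for which the loop was chosen.
    obtain ⟨a, ha, hW, b, hb, hbx⟩ := (hasLoop_iff A _ _ (lt_of_mem_layer A e hx.1)).1 hx.2
    have h3 : ρ b = r := (hρ b x (infA_lt A hb) (lt_of_mem_layer A e hx.1) hbx).trans h2
    have := hacc a b hb fun y hy => h3 ▸ ih (hW y hy)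
    rw [h3] at this
    tauto

theorem layer_eq_nil_of_rank {ρ : ℕ → ℕ}
    (hρ : ∀ x y, x < A.2.1 → y < A.2.1 → Eqv A x y → ρ x = ρ y)
    (hacc : ∀ (a : Stream' (Fin A.1)) (x : ℕ), x ∈ infA A a → (∀ y ∈ infA A a, ρ x ≤ ρ y) →
      (a ∈ A.2.2.language ↔ ¬ (e ↔ Even (ρ x)))) {N : ℕ} (hN : ∀ x < A.2.1, ρ x < N) :
    layer A e N = [] := by
  rw [List.eq_nil_iff_forall_not_mem]
  intro x hx
  have h1 := le_rank_of_mem_layer hρ hacc hx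
  have h2 := hN x (lt_of_mem_layer A e hx)
  omega

theorem layer_succ_congr {r r' : ℕ} (h : layer A e r = layer A e r') (hp : Even r ↔ Even r') :
    layer A e (r + 1) = layer A e (r' + 1) := by
  rw [layer, layer, h]
  exact List.filter_congr fun x _ => by rw [propext hp]

/-- The rule of removal depends on the parity of the index. If neither of the two rules removes
anything, then nothing is removed ever after; a single idle step would not suffice. -/
theorem layer_stable {r : ℕ} (h : layer A e (r + 2) = layer A e r) (j : ℕ) :
    layer A e (r + j) = layer A e r := by
  have h1 : layer A e (r + 1) = layer A e r :=
    (layer_succ_sublist A e r).antisymm (h ▸ layer_succ_sublist A e (r + 1))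
  have key : ∀ j, layer A e (r + j) = layer A e r ∧ layer A e (r + j + 1) = layer A e r := by
    intro j
    induction j with
    | zero => exact ⟨rfl, h1⟩
    | succ j ih =>
      refine ⟨ih.2, ?_⟩
      rcases Nat.even_or_odd j with hj | hj
      · refine (layer_succ_congr (r' := r + 1) (ih.2.trans h1.symm) ?_).trans h
        simp [Nat.even_add, hj]
      · refine (layer_succ_congr (r' := r) ih.2 ?_).trans h1
        rw [Nat.add_assoc, Nat.even_add]
        simp [hj.add_one]
  exact (key j).1

/-- If some layer is empty then so is an early one. -/
theorem layer_two_mul_eq_nil {M : ℕ} (h : layer A e M = []) : layer A e (2 * A.2.1) = [] := by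
  have hlen : ∀ i, (layer A e i).length ≤ A.2.1 := fun i => by
    simpa [layer] using (layer_sublist A e (Nat.zero_le i)).length_le
  -- Any two consecutive steps that change the layer remove at least one of the states.
  have : ∃ i ≤ A.2.1, layer A e (2 * (i + 1)) = layer A e (2 * i) := by
    by_contra! hc
    have key : ∀ i ≤ A.2.1 + 1, (layer A e (2 * i)).length + i ≤ A.2.1 := by
      intro i
      induction i with
      | zero => exact fun _ => hlen _
      | succ i ih =>
        intro hi
        have h1 := ih (by omega)
        have h2 := layer_sublist A e (show 2 * i ≤ 2 * (i + 1) by omega)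
        have h3 := h2.length_le
        have h4 : (layer A e (2 * (i + 1))).length ≠ (layer A e (2 * i)).length :=
          fun he => hc i (by omega) (h2.eq_of_length he)
        omega
    have := key (A.2.1 + 1) le_rfl
    omega
  obtain ⟨i, hi, hs⟩ := this
  -- The stationary layer coincides with one beyond `M`, hence is empty, and it is attained by index
  -- `2 * A.2.1`.
  have h1 : layer A e (2 * i + M) = layer A e (2 * i) := layer_stable hs M
  have h2 := layer_sublist A e (show M ≤ 2 * i + M by omega)
  have h3 := layer_sublist A e (show 2 * i ≤ 2 * A.2.1 by omega)
  rw [h, List.sublist_nil, h1] at h2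
  rwa [h2, List.sublist_nil] at h3

end

/-! ### The canonical right-congruence -/

section
variable {α Q Q' : Type}

theorem infs_append (T : DTS α Q) (u : List α) (a : Stream' α) :
    T.infs (u ++ₛ a) = infF T.step (u.foldl T.step T.init) a := by
  rw [infs_eq_infF, infF_append]

/-- Acceptance is an arbitrary condition `Φ` on the infinitely visited states, which covers the
three types of automata at once. -/
theorem canonCongr_of_foldl_eq (T : DTS α Q) (Φ : Set Q → Prop) {u v : List α}
    (h : u.foldl T.step T.init = v.foldl T.step T.init) :
    (canonCongr {a | Φ (T.infs a)}).r u v := fun a => by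
  simp only [Set.mem_ofPred_eq, infs_append, h]

theorem isomorphic_canonDTS {T : DTS α Q} {L : Set (Stream' α)}
    (h : ∀ u v, u.foldl T.step T.init = v.foldl T.step T.init ↔ (canonCongr L).r u v) :
    T.Isomorphic (canonDTS L) := by
  let f : Quotient (canonCongr L) → Q :=
    Quotient.lift (fun u => u.foldl T.step T.init) fun u v huv => (h u v).2 huv
  have hf : Function.Bijective f := by
    constructor
    · intro x y
      induction x using Quotient.ind with | _ u =>
      induction y using Quotient.ind with | _ v =>
      exact fun huv => Quotient.sound ((h u v).1 huv)
    · intro q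
      obtain ⟨u, hu⟩ := T.reachable q
      exact ⟨Quotient.mk _ u, hu⟩
  refine ⟨(Equiv.ofBijective f hf).symm, ?_, ?_⟩
  · rw [Equiv.symm_apply_eq]; rfl
  · intro q s
    obtain ⟨x, rfl⟩ := hf.2 q
    rw [Equiv.symm_apply_eq]
    have : (Equiv.ofBijective f hf).symm (f x) = x := (Equiv.ofBijective f hf).symm_apply_apply x
    rw [this]
    induction x using Quotient.ind with | _ u =>
    change _ = (u ++ [s]).foldl T.step T.init
    rw [List.foldl_append]; rfl

theorem equiv_foldl {T : DTS α Q} {L : Set (Stream' α)} (e : Q ≃ Quotient (canonCongr L))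
    (h0 : e T.init = (canonDTS L).init) (h1 : ∀ q a, e (T.step q a) = (canonDTS L).step (e q) a)
    (u : List α) : e (u.foldl T.step T.init) = Quotient.mk _ u := by
  have h2 : ∀ (u : List α) q, e (u.foldl T.step q) = u.foldl (canonStep L) (e q) := by
    intro u
    induction u with
    | nil => exact fun q => rfl
    | cons s u ih => exact fun q => by rw [List.foldl_cons, ih, h1]; rfl
  rw [h2, h0]
  exact canonStep_foldl L u []

theorem foldl_eq_of_isomorphic {T : DTS α Q} {L : Set (Stream' α)}
    (h : T.Isomorphic (canonDTS L)) {u v : List α} (huv : (canonCongr L).r u v) :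
    u.foldl T.step T.init = v.foldl T.step T.init := by
  obtain ⟨e, h0, h1⟩ := h
  apply e.injective
  rw [equiv_foldl e h0 h1, equiv_foldl e h0 h1]
  exact Quotient.sound huv

/-- Choose for each state of `T'` a word leading to it. Every word is congruent to the one chosen
for the state it reaches, so the chosen words represent all classes. -/
theorem card_le_of_isomorphic {T : DTS α Q} (T' : DTS α Q') [Finite Q'] (Φ : Set Q' → Prop)
    (h : T.Isomorphic (canonDTS {a | Φ (T'.infs a)})) : Nat.card Q ≤ Nat.card Q' := by
  obtain ⟨e, -, -⟩ := h
  rw [Nat.card_congr e]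
  choose w hw using T'.reachable
  refine Nat.card_le_card_of_surjective (fun q => Quotient.mk _ (w q)) fun x => ?_
  induction x using Quotient.ind with | _ u =>
  exact ⟨u.foldl T'.step T'.init, Quotient.sound (canonCongr_of_foldl_eq T' Φ (hw _))⟩

theorem DBA.isMinimal {A : DBA α Q} (h : A.HasIRC) : A.IsMinimal := fun _ _ B hB =>
  card_le_of_isomorphic B.toDTS (fun S => (S ∩ B.acc).Nonempty) (by
    unfold DBA.HasIRC at h; rw [← hB] at h; exact h)

theorem DCA.isMinimal {A : DCA α Q} (h : A.HasIRC) : A.IsMinimal := fun _ _ B hB =>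
  card_le_of_isomorphic B.toDTS (fun S => S ⊆ B.acc) (by
    unfold DCA.HasIRC at h; rw [← hB] at h; exact h)

theorem DPA.isMinimal {A : DPA α Q} (h : A.HasIRC) : A.IsMinimal := fun _ _ B hB =>
  card_le_of_isomorphic B.toDTS (Acc B.prio) (by
    unfold DPA.HasIRC at h; rw [← hB] at h; exact h)

end

theorem canonCongr_iff_eqv (A : Aut) (u v : List (Fin A.1)) :
    (canonCongr A.2.2.language).r u v ↔
      Eqv A (u.foldl A.2.2.step A.2.2.init : Fin A.2.1) (v.foldl A.2.2.step A.2.2.init : Fin A.2.1) := by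
  refine forall_congr' fun a => ?_
  rw [← langN_init, langN_append, langN_append, foldl_sN, foldl_sN]

theorem infA_eq (A : Aut) (a : Stream' (Fin A.1)) : infA A a = Fin.val '' A.2.2.infs a := by
  rw [infA, infF_sN, infs_eq_infF]

/-- The states of an automaton with informative right-congruence as images of the states of any
automaton for the same language. -/
theorem exists_hom (A : Aut) {Q : Type} {T : DTS (Fin A.1) Q}
    (h : T.Isomorphic (canonDTS A.2.2.language)) :
    ∃ f : ℕ → Q, (∀ x y, x < A.2.1 → y < A.2.1 → Eqv A x y → f x = f y) ∧
      ∀ a, T.infs a = f '' infA A a := by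
  choose w hw using A.2.2.reachable
  -- The state of `T` reached by some word that leads to `q` in `A`. The choice is immaterial,
  -- because congruent words reach the same state of `T`.
  let g : Fin A.2.1 → Q := fun q => (w q).foldl T.step T.init
  have hg : ∀ u : List (Fin A.1), g (u.foldl A.2.2.step A.2.2.init) = u.foldl T.step T.init := fun u =>
    foldl_eq_of_isomorphic h ((canonCongr_iff_eqv A _ _).2 (by rw [hw]; exact Eqv.rfl))
  have hg' : ∀ p q : Fin A.2.1, Eqv A p q → g p = g q := fun p q hpq =>
    foldl_eq_of_isomorphic h ((canonCongr_iff_eqv A _ _).2 (by rwa [hw, hw]))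
  have hstep : ∀ q s, g (A.2.2.step q s) = T.step (g q) s := fun q s => by
    have h1 := hg (w q ++ [s])
    rw [List.foldl_append, List.foldl_append, hw] at h1
    exact h1
  -- The value `T.init` outside the state set is a dummy: runs of `A` never leave the numbers below
  -- `A.2.1`.
  refine ⟨fun x => if hx : x < A.2.1 then g ⟨x, hx⟩ else T.init, fun x y hx hy hxy => ?_,
    fun a => ?_⟩
  · simp only [hx, hy, dif_pos]
    exact hg' _ _ hxy
  · have h1 : T.infs a = g '' A.2.2.infs a := by
      rw [infs_eq_infF, infs_eq_infF]
      have h0 : T.init = g A.2.2.init := (hg []).symm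
      rw [h0]
      exact infF_map (Set.toFinite _) fun i => hstep _ _
    rw [h1, infA_eq, Set.image_image]
    simp

/-! ### The quotient automaton -/

section
variable (A : Aut)

open Classical in
/-- The least elements of the classes of equivalent states. -/
noncomputable def reps : List ℕ := (List.range A.2.1).filter fun q => ∀ p < q, Ineq A (p, q)

open Classical in
/-- The number of the class of a state. -/
noncomputable def idx (x : ℕ) : ℕ :=
  ((List.range (reps A).length).filter fun i => ∀ j < i + 1, Ineq A ((reps A).getD j 0, x)).length

theorem mem_reps {q : ℕ} : q ∈ reps A ↔ q < A.2.1 ∧ ∀ p < q, ¬ Eqv A p q := by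
  rw [reps, List.mem_filter, List.mem_range]
  refine and_congr_right fun hq => (by simp : _ ↔ ∀ p < q, Ineq A (p, q)).trans ?_
  exact forall₂_congr fun p hp => ineq_iff A ⟨hp.trans hq, hq⟩

theorem reps_lt (i : Fin (reps A).length) : (reps A)[i] < A.2.1 :=
  ((mem_reps A).1 (List.getElem_mem i.2)).1

theorem reps_inj {i j : Fin (reps A).length} (h : Eqv A (reps A)[i] (reps A)[j]) : i = j := by
  have hlt : ∀ i j : Fin (reps A).length, i < j → ¬ Eqv A (reps A)[i] (reps A)[j] := by
    intro i j hij
    have hp : (reps A).Pairwise (· < ·) := List.pairwise_lt_range.sublist List.filter_sublist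
    exact ((mem_reps A).1 (List.getElem_mem j.2)).2 _
      (List.pairwise_iff_getElem.1 hp i j i.2 j.2 hij)
  rcases lt_trichotomy i j with h1 | h1 | h1
  · exact absurd h (hlt i j h1)
  · exact h1
  · exact absurd h.symm (hlt j i h1)

theorem exists_rep {x : ℕ} (hx : x < A.2.1) : ∃ i : Fin (reps A).length, Eqv A (reps A)[i] x := by
  classical
  have hex : ∃ p, Eqv A p x := ⟨x, Eqv.rfl⟩
  have hle : Nat.find hex ≤ x := Nat.find_min' hex Eqv.rfl
  have hmem : Nat.find hex ∈ reps A := (mem_reps A).2 ⟨by omega, fun p hp h =>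
    Nat.find_min hex hp (h.trans (Nat.find_spec hex))⟩
  obtain ⟨i, hi, h⟩ := List.getElem_of_mem hmem
  refine ⟨⟨i, hi⟩, ?_⟩
  rw [Fin.getElem_fin, h]
  exact Nat.find_spec hex

/-- The representatives up to position `r` are all inequivalent to `x` exactly as long as `r` is
below the position `i` of its own representative, so `i` positions are counted. -/
theorem idx_eq {x : ℕ} (hx : x < A.2.1) {i : Fin (reps A).length} (h : Eqv A (reps A)[i] x) :
    idx A x = i := by
  classical
  refine length_filter_range i.2.le fun r hr => ?_
  have hj : ∀ j (hj : j < (reps A).length), Ineq A ((reps A).getD j 0, x) ↔ j ≠ i := by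
    intro j hj
    have h1 : (reps A).getD j 0 = (reps A)[(⟨j, hj⟩ : Fin _)] := by
      rw [List.getD_eq_getElem _ _ hj]; rfl
    rw [h1, ineq_iff A ⟨reps_lt A _, hx⟩, not_iff_not]
    constructor
    · intro h2
      exact congrArg Fin.val (reps_inj A (h2.trans h.symm))
    · rintro rfl; exact h
  constructor
  · intro h1
    by_contra hc
    exact (hj i i.2).1 (h1 i (by omega)) rfl
  · intro h1 j h2
    exact (hj j (by omega)).2 (by omega)

theorem idx_lt {x : ℕ} (hx : x < A.2.1) : idx A x < (reps A).length := by
  obtain ⟨i, hi⟩ := exists_rep A hx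
  rw [idx_eq A hx hi]; exact i.2

/-- The representative of a class. -/
noncomputable def repF (i : Fin (reps A).length) : Fin A.2.1 := ⟨(reps A)[i], reps_lt A i⟩

/-- The class of a state. -/
noncomputable def idxF (q : Fin A.2.1) : Fin (reps A).length := ⟨idx A q, idx_lt A q.2⟩

theorem idxF_eq {q : Fin A.2.1} {i : Fin (reps A).length} (h : Eqv A (repF A i) q) :
    idxF A q = i := Fin.ext (idx_eq A q.2 h)

theorem idxF_repF (i : Fin (reps A).length) : idxF A (repF A i) = i := idxF_eq A Eqv.rfl

theorem eqv_repF_idxF (q : Fin A.2.1) : Eqv A (repF A (idxF A q)) q := by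
  obtain ⟨i, hi⟩ := exists_rep A q.2
  rw [idxF_eq A (i := i) hi]; exact hi

theorem idxF_eq_iff {p q : Fin A.2.1} : idxF A p = idxF A q ↔ Eqv A p q := by
  constructor
  · intro h
    have := eqv_repF_idxF A p
    rw [h] at this
    exact this.symm.trans (eqv_repF_idxF A q)
  · exact fun h => idxF_eq A ((eqv_repF_idxF A q).trans h.symm)

theorem idxF_step (q : Fin A.2.1) (s : Fin A.1) :
    idxF A (A.2.2.step q s) = idxF A (A.2.2.step (repF A (idxF A q)) s) := by
  rw [idxF_eq_iff, ← sN_val, ← sN_val]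
  exact (eqv_repF_idxF A q).symm.step A s

theorem foldl_idxF (u : List (Fin A.1)) (q : Fin A.2.1) :
    u.foldl (fun i s => idxF A (A.2.2.step (repF A i) s)) (idxF A q) =
      idxF A (u.foldl A.2.2.step q) := by
  induction u generalizing q with
  | nil => rfl
  | cons s u ih => rw [List.foldl_cons, List.foldl_cons, ← ih, ← idxF_step]

/-- The transition graph on the classes of equivalent states. -/
noncomputable def quotDTS : DTS (Fin A.1) (Fin (reps A).length) where
  init := idxF A A.2.2.init
  step i s := idxF A (A.2.2.step (repF A i) s)
  reachable i := by
    obtain ⟨u, hu⟩ := A.2.2.reachable (repF A i)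
    exact ⟨u, by rw [foldl_idxF, hu, idxF_repF]⟩

theorem quotDTS_isomorphic : (quotDTS A).Isomorphic (canonDTS A.2.2.language) :=
  isomorphic_canonDTS fun u v => by
    rw [canonCongr_iff_eqv, ← idxF_eq_iff]
    simp only [quotDTS, foldl_idxF]

theorem quotDTS_infs (a : Stream' (Fin A.1)) : (quotDTS A).infs a = idxF A '' A.2.2.infs a := by
  rw [infs_eq_infF, infs_eq_infF]
  exact infF_map (step' := (quotDTS A).step) (Set.toFinite _) fun _ => idxF_step A _ _

variable {A} {e : Prop} {N : ℕ}

/-- The mark of a class. -/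
noncomputable def markF (A : Aut) (e : Prop) (N : ℕ) (i : Fin (reps A).length) : ℕ :=
  mark A e N (repF A i)

theorem markF_lt (hN : layer A e N = []) (i : Fin (reps A).length) : markF A e N i < N :=
  (mark_spec hN (repF A i).2).1

/-- Marks are constant on classes and the loop in the quotient is the image of the loop in `A`, so
both have the same least mark. -/
theorem exists_min_markF (hN : layer A e N = []) (a : Stream' (Fin A.1)) :
    ∃ i ∈ (quotDTS A).infs a, (∀ j ∈ (quotDTS A).infs a, markF A e N i ≤ markF A e N j) ∧
      (a ∈ A.2.2.language ↔ ¬ (e ↔ Even (markF A e N i))) := by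
  have hm : ∀ q : Fin A.2.1, markF A e N (idxF A q) = mark A e N q := fun q =>
    mark_congr (repF A _).2 q.2 (eqv_repF_idxF A q)
  obtain ⟨x, hx, hmin⟩ := Set.exists_min_image _ (mark A e N) (infA_finite A a) (infA_nonempty A a)
  have h := mem_language_iff_mark hN hx hmin
  rw [infA_eq] at hx
  obtain ⟨q, hq, rfl⟩ := hx
  rw [quotDTS_infs]
  refine ⟨_, ⟨q, hq, rfl⟩, ?_, by rwa [hm]⟩
  rintro _ ⟨p, hp, rfl⟩
  rw [hm, hm]
  exact hmin p (by rw [infA_eq]; exact ⟨p, hp, rfl⟩)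

/-- The Büchi automaton with informative right-congruence, if there is one. -/
noncomputable def outDBA (A : Aut) : FinDBA A.1 :=
  ⟨(reps A).length, { toDTS := quotDTS A, acc := {i | markF A False 2 i = 0} }⟩

/-- The co-Büchi automaton with informative right-congruence, if there is one. -/
noncomputable def outDCA (A : Aut) : FinDCA A.1 :=
  ⟨(reps A).length, { toDTS := quotDTS A, acc := {i | markF A True 2 i = 1} }⟩

/-- The parity automaton with informative right-congruence, if there is one. -/
noncomputable def outDPA (A : Aut) : FinDPA A.1 :=
  ⟨(reps A).length,
    { toDTS := quotDTS A, prio := fun i => 2 * A.2.1 - markF A False (2 * A.2.1) i }⟩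

/-- For `e = False` a loop is accepting iff its least mark is even. The marks are 0 and 1, so this
means that a mark 0 occurs. -/
theorem outDBA_language (hN : layer A False 2 = []) : (outDBA A).2.language = A.2.2.language := by
  ext a
  obtain ⟨i, hi, hmin, h⟩ := exists_min_markF hN a
  have hlt := markF_lt hN i
  have hev : Even (markF A False 2 i) ↔ markF A False 2 i = 0 := by
    interval_cases markF A False 2 i <;> simp
  rw [h, false_iff, not_not, hev]
  constructor
  · rintro ⟨j, hj, hj'⟩
    have h1 : markF A False 2 j = 0 := hj'
    have := hmin j hj
    omega
  · exact fun h0 => ⟨i, hi, h0⟩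

/-- For `e = True` a loop is accepting iff its least mark is odd. The marks are 0 and 1, so this
means that all marks on it are 1. -/
theorem outDCA_language (hN : layer A True 2 = []) : (outDCA A).2.language = A.2.2.language := by
  ext a
  obtain ⟨i, hi, hmin, h⟩ := exists_min_markF hN a
  have hlt := markF_lt hN i
  have hev : ¬ Even (markF A True 2 i) ↔ markF A True 2 i = 1 := by
    interval_cases markF A True 2 i <;> simp
  rw [h, true_iff, hev]
  constructor
  · exact fun h1 => h1 hi
  · intro h1 j hj
    have h2 := markF_lt hN j
    have h3 := hmin j hj
    change markF A True 2 j = 1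
    omega

/-- Subtraction from the even number `2 * A.2.1`, which exceeds all marks, reverses their order and
keeps their parity; the highest priority sits at the least mark. -/
theorem outDPA_language (hN : layer A False (2 * A.2.1) = []) :
    (outDPA A).2.language = A.2.2.language := by
  ext a
  obtain ⟨i, hi, hmin, h⟩ := exists_min_markF hN a
  have hlt := markF_lt hN i
  rw [h, false_iff, not_not]
  refine (acc_iff (S := (quotDTS A).infs a)
    (prio := fun i => 2 * A.2.1 - markF A False (2 * A.2.1) i) hi ?_).trans ?_
  · intro j hj
    have := hmin j hj
    omega
  · rw [Nat.even_sub hlt.le]; simp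

theorem outDBA_hasIRC (hN : layer A False 2 = []) : (outDBA A).2.HasIRC := by
  rw [DBA.HasIRC, outDBA_language hN]; exact quotDTS_isomorphic A

theorem outDCA_hasIRC (hN : layer A True 2 = []) : (outDCA A).2.HasIRC := by
  rw [DCA.HasIRC, outDCA_language hN]; exact quotDTS_isomorphic A

theorem outDPA_hasIRC (hN : layer A False (2 * A.2.1) = []) : (outDPA A).2.HasIRC := by
  rw [DPA.HasIRC, outDPA_language hN]; exact quotDTS_isomorphic A

theorem mem_IB_iff : A.2.2.language ∈ IB (Fin A.1) ↔ layer A False 2 = [] := by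
  constructor
  · rintro ⟨Q, _, C, hC, hirc⟩
    classical
    rw [DBA.HasIRC, hC] at hirc
    obtain ⟨f, hf, hinf⟩ := exists_hom A hirc
    -- Rank 0 on accepting states: the least rank on a loop is even iff the loop contains an
    -- accepting state.
    refine layer_eq_nil_of_rank (ρ := fun x => if f x ∈ C.acc then 0 else 1)
      (fun x y hx hy hxy => by simp only [hf x y hx hy hxy]) (fun a x hx hmin => ?_)
      fun x _ => by split_ifs <;> omega
    have h1 : a ∈ A.2.2.language ↔ ∃ y ∈ infA A a, f y ∈ C.acc := by
      rw [← hC, DBA.language, Set.mem_ofPred_eq, hinf]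
      constructor
      · rintro ⟨_, ⟨y, hy, rfl⟩, h⟩; exact ⟨y, hy, h⟩
      · rintro ⟨y, hy, h⟩; exact ⟨_, ⟨y, hy, rfl⟩, h⟩
    rw [h1]
    by_cases hx' : f x ∈ C.acc
    · simpa [hx'] using ⟨x, hx, hx'⟩
    · simp only [hx', if_false] at hmin ⊢
      simp only [Nat.not_even_one, iff_self, not_true, iff_false]
      rintro ⟨y, hy, hy'⟩
      have := hmin y hy
      simp [hy'] at this
  · exact fun hN => ⟨_, inferInstance, (outDBA A).2, outDBA_language hN, outDBA_hasIRC hN⟩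

theorem mem_IC_iff : A.2.2.language ∈ IC (Fin A.1) ↔ layer A True 2 = [] := by
  constructor
  · rintro ⟨Q, _, C, hC, hirc⟩
    classical
    rw [DCA.HasIRC, hC] at hirc
    obtain ⟨f, hf, hinf⟩ := exists_hom A hirc
    -- Rank 1 on the states of `C.acc`: the least rank on a loop is odd iff the loop stays inside
    -- this set.
    refine layer_eq_nil_of_rank (ρ := fun x => if f x ∈ C.acc then 1 else 0)
      (fun x y hx hy hxy => by simp only [hf x y hx hy hxy]) (fun a x hx hmin => ?_)
      fun x _ => by split_ifs <;> omega
    have h1 : a ∈ A.2.2.language ↔ ∀ y ∈ infA A a, f y ∈ C.acc := by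
      rw [← hC, DCA.language, Set.mem_ofPred_eq, hinf, Set.image_subset_iff]
      rfl
    rw [h1]
    by_cases hx' : f x ∈ C.acc
    · simp only [hx', if_true] at hmin ⊢
      simp only [Nat.not_even_one, iff_false, not_true, not_false_iff, iff_true]
      intro y hy
      by_contra hc
      have := hmin y hy
      simp [hc] at this
    · simpa [hx'] using ⟨x, hx, hx'⟩
  · exact fun hN => ⟨_, inferInstance, (outDCA A).2, outDCA_language hN, outDCA_hasIRC hN⟩

theorem mem_IP_iff : A.2.2.language ∈ IP (Fin A.1) ↔ layer A False (2 * A.2.1) = [] := by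
  constructor
  · rintro ⟨Q, _, C, hC, hirc⟩
    rw [DPA.HasIRC, hC] at hirc
    obtain ⟨f, hf, hinf⟩ := exists_hom A hirc
    obtain ⟨M, hM⟩ := (Set.finite_range C.prio).bddAbove
    have hM : ∀ q, C.prio q ≤ M := fun q => hM ⟨q, rfl⟩
    -- Subtracting priorities from `2 * M` turns the highest priority into the least rank of the
    -- same parity. The priorities of `C` are unrelated to the size of `A`, so emptiness is first
    -- obtained at index `2 * M + 1` and then moved down to `2 * A.2.1`.
    refine layer_two_mul_eq_nil (M := 2 * M + 1) <|
      layer_eq_nil_of_rank (ρ := fun x => 2 * M - C.prio (f x))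
      (fun x y hx hy hxy => by simp only [hf x y hx hy hxy]) (fun a x hx hmin => ?_)
      fun x _ => by omega
    rw [← hC, false_iff, not_not, Nat.even_sub (by have := hM (f x); omega)]
    refine (acc_iff (S := C.infs a) (p := f x) ?_ ?_).trans (by simp)
    · rw [hinf]; exact ⟨x, hx, rfl⟩
    · rw [hinf]
      rintro _ ⟨y, hy, rfl⟩
      have := hmin y hy
      have := hM (f x)
      have := hM (f y)
      omega
  · exact fun hN => ⟨_, inferInstance, (outDPA A).2, outDPA_language hN, outDPA_hasIRC hN⟩

end

/-! ### The algorithms run in polynomial time -/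

section
variable {α : Type} [Enc α]

@[fun_prop]
theorem PT.statePairs {f : α → Aut} (hf : PT f) : PT fun a => statePairs (f a) := by
  have : PT StackProg.statePairs :=
    PT.flatMap (f := fun A : Aut => List.range A.2.1)
      (h := fun (A : Aut) i => (List.range A.2.1).map fun j => (i, j))
      (PT.map (f := fun x : Aut × ℕ => List.range x.1.2.1) (h := fun (x : Aut × ℕ) j => (x.2, j))
        (by fun_prop) (by fun_prop)) (by fun_prop)
  exact this.comp hf

@[fun_prop]
theorem PT.pairEdge {f : α → Aut} {x y : α → ℕ × ℕ} (hf : PT f) (hx : PT x) (hy : PT y) :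
    PT fun a => pairEdge (f a) (x a) (y a) := by
  unfold StackProg.pairEdge
  fun_prop

@[fun_prop]
theorem PT.ineq {f : α → Aut} {x : α → ℕ × ℕ} (hf : PT f) (hx : PT x) :
    PT fun a => Ineq (f a) (x a) := by
  have h1 : PT fun y : (Aut × ℕ × ℕ) × ℕ × ℕ =>
      Relation.TransGen (StackProg.pairEdge y.1.1) y.1.2 y.2 :=
    PT.transGen (V := fun y : (Aut × ℕ × ℕ) × ℕ × ℕ => StackProg.statePairs y.1.1)
      (r := fun y : (Aut × ℕ × ℕ) × ℕ × ℕ => StackProg.pairEdge y.1.1) (by fun_prop) (by fun_prop) (fun _ _ _ => pairEdge_mem _) PT.eq_pair (by fun_prop)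
      (by fun_prop)
  have h2 : PT fun y : Aut × (ℕ × ℕ) × (ℕ × ℕ) × (ℕ × ℕ) × ℕ × ℕ =>
      Relation.TransGen (pairEdgeLE y.1 y.2.1 y.2.2.1) y.2.2.2.1 y.2.2.2.2 :=
    PT.transGen (V := fun y : Aut × (ℕ × ℕ) × (ℕ × ℕ) × (ℕ × ℕ) × ℕ × ℕ => StackProg.statePairs y.1)
      (r := fun y : Aut × (ℕ × ℕ) × (ℕ × ℕ) × (ℕ × ℕ) × ℕ × ℕ => pairEdgeLE y.1 y.2.1 y.2.2.1) (by fun_prop)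
      (by unfold pairEdgeLE; fun_prop) (fun _ _ _ h => pairEdge_mem _ h.1) PT.eq_pair (by fun_prop)
      (by fun_prop)
  -- The same statement with every argument depending on a common input.
  have h3 : ∀ {δ : Type} [Enc δ] {f : δ → Aut} {p r x y : δ → ℕ × ℕ}, PT f → PT p → PT r → PT x →
      PT y → PT fun d => Relation.TransGen (pairEdgeLE (f d) (p d) (r d)) (x d) (y d) :=
    fun {δ} _ {f p r x y} hf hp hr hx hy => h2.comp (f := fun d => (f d, p d, r d, x d, y d))
      (by fun_prop)
  have h4 : PT fun z : ((Aut × ℕ × ℕ) × ℕ × ℕ) × ℕ × ℕ =>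
      Relation.TransGen (StackProg.pairEdge z.1.1.1) z.1.1.2 z.1.2 ∧
        (Even (prioN z.1.1.1 z.1.2.1) ↔ ¬ Even (prioN z.1.1.1 z.2.2)) ∧
        Relation.TransGen (pairEdgeLE z.1.1.1 z.1.2 z.2) z.1.2 z.2 ∧
        Relation.TransGen (pairEdgeLE z.1.1.1 z.1.2 z.2) z.2 z.1.2 := by
    refine PT.and ?_ (PT.and (by fun_prop) (PT.and ?_ ?_))
    · exact h1.comp (f := fun z : ((Aut × ℕ × ℕ) × ℕ × ℕ) × ℕ × ℕ => z.1) (by fun_prop)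
    · exact h3 (by fun_prop) (by fun_prop) (by fun_prop) (by fun_prop) (by fun_prop)
    · exact h3 (by fun_prop) (by fun_prop) (by fun_prop) (by fun_prop) (by fun_prop)
  have h5 := PT.exists_mem (f := fun y : (Aut × ℕ × ℕ) × ℕ × ℕ => StackProg.statePairs y.1.1)
    (p := fun y r => Relation.TransGen (StackProg.pairEdge y.1.1) y.1.2 y.2 ∧
      (Even (prioN y.1.1 y.2.1) ↔ ¬ Even (prioN y.1.1 r.2)) ∧
      Relation.TransGen (pairEdgeLE y.1.1 y.2 r) y.2 r ∧
      Relation.TransGen (pairEdgeLE y.1.1 y.2 r) r y.2) h4 (by fun_prop)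
  have h6 := PT.exists_mem (f := fun y : Aut × ℕ × ℕ => StackProg.statePairs y.1)
    (p := fun y p => ∃ r ∈ StackProg.statePairs y.1,
      Relation.TransGen (StackProg.pairEdge y.1) y.2 p ∧
        (Even (prioN y.1 p.1) ↔ ¬ Even (prioN y.1 r.2)) ∧
        Relation.TransGen (pairEdgeLE y.1 p r) p r ∧
        Relation.TransGen (pairEdgeLE y.1 p r) r p) h5 (by fun_prop)
  have : PT fun y : Aut × ℕ × ℕ => Ineq y.1 y.2 := h6
  exact this.comp (hf.pair hx)

@[fun_prop]
theorem PT.hasLoop {f : α → Aut} {e : α → Prop} {W : α → List ℕ} {x : α → ℕ} (hf : PT f)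
    (he : PT e) (hW : PT W) (hx : PT x) : PT fun a => HasLoop (f a) (e a) (W a) (x a) := by
  have h2 : PT fun y : Aut × List ℕ × ℕ × ℕ × ℕ =>
      Relation.TransGen (loopEdge y.1 y.2.1 y.2.2.1) y.2.2.2.1 y.2.2.2.2 :=
    PT.transGen (V := fun y : Aut × List ℕ × ℕ × ℕ × ℕ => y.2.1)
      (r := fun y : Aut × List ℕ × ℕ × ℕ × ℕ => loopEdge y.1 y.2.1 y.2.2.1) (by fun_prop)
      (by unfold loopEdge; fun_prop) (fun _ _ _ h => h.2.1.1) (by fun_prop) (by fun_prop)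
      (by fun_prop)
  have h3 : ∀ {δ : Type} [Enc δ] {f : δ → Aut} {W : δ → List ℕ} {t x y : δ → ℕ}, PT f → PT W →
      PT t → PT x → PT y → PT fun d => Relation.TransGen (loopEdge (f d) (W d) (t d)) (x d) (y d) :=
    fun {δ} _ {f W t x y} hf hW ht hx hy => h2.comp (f := fun d => (f d, W d, t d, x d, y d))
      (by fun_prop)
  unfold HasLoop
  refine PT.exists_lt (PT.and (by fun_prop) (PT.exists_lt (PT.and (by fun_prop) (PT.and ?_ ?_))
    (by fun_prop))) (by fun_prop)
  · exact h3 (by fun_prop) (by fun_prop) (by fun_prop) (by fun_prop) (by fun_prop)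
  · exact h3 (by fun_prop) (by fun_prop) (by fun_prop) (by fun_prop) (by fun_prop)

@[fun_prop]
theorem PT.layer {f : α → Aut} {N : α → ℕ} (e : Prop) (hf : PT f) (hN : PT N) :
    PT fun a => layer (f a) e (N a) := by
  classical
  have key : ∀ (A : Aut) n, (List.range n).foldl (fun W r => W.filter fun x =>
      HasLoop A (e ↔ Even r) W x) (List.range A.2.1) = StackProg.layer A e n := by
    intro A n
    induction n with
    | zero => rfl
    | succ n ih =>
      rw [List.range_succ, List.foldl_append, ih, StackProg.layer]
      exact List.filter_congr fun _ _ => by congr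
  have : PT fun a => (List.range (N a)).foldl (fun W r => W.filter fun x =>
      HasLoop (f a) (e ↔ Even r) W x) (List.range (f a).2.1) := by
    refine PT.foldl (h := fun a (W : List ℕ) r => W.filter fun x => HasLoop (f a) (e ↔ Even r) W x)
      (PT.filter (p := fun (y : α × List ℕ × ℕ) x => HasLoop (f y.1) (e ↔ Even y.2.2) y.2.1 x)
        (by fun_prop) (by fun_prop)) (by fun_prop) (by fun_prop)
      (PT.range (f := fun a => (f a).2.1) (by fun_prop)).bd fun a l₁ l₂ hl => ?_
    have h1 : l₁ = List.range l₁.length := by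
      have := congrArg (List.take l₁.length) hl
      rw [List.take_left, List.take_range, min_eq_left] at this
      · exact this.symm
      · have := congrArg List.length hl
        rw [List.length_range, List.length_append] at this
        omega
    rw [h1, key]
    -- Each intermediate value is a layer, so the list of all states bounds its size.
    exact sz_sublist (layer_sublist _ _ (Nat.zero_le _))
  simpa only [key] using this

@[fun_prop]
theorem PT.mark {f : α → Aut} {N x : α → ℕ} (e : Prop) (hf : PT f) (hN : PT N) (hx : PT x) :
    PT fun a => mark (f a) e (N a) (x a) :=
  (PT.filter (p := fun a r => x a ∈ StackProg.layer (f a) e (r + 1)) (by fun_prop)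
    (by fun_prop)).length

@[fun_prop]
theorem PT.reps {f : α → Aut} (hf : PT f) : PT fun a => reps (f a) := by
  classical
  exact PT.filter (p := fun a q => ∀ p < q, Ineq (f a) (p, q))
    (f := fun a => List.range (f a).2.1) (by fun_prop) (by fun_prop)

@[fun_prop]
theorem PT.idx {f : α → Aut} {x : α → ℕ} (hf : PT f) (hx : PT x) :
    PT fun a => idx (f a) (x a) := by
  classical
  exact (PT.filter (p := fun a i => ∀ j < i + 1, Ineq (f a) ((StackProg.reps (f a)).getD j 0, x a))
    (f := fun a => List.range (StackProg.reps (f a)).length) (by fun_prop) (by fun_prop)).length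

end

/-- The description of the quotient automaton with marks `m`. -/
noncomputable def descr (A : Aut) (m : ℕ → ℕ) : List ℕ :=
  A.1 :: (reps A).length :: idx A A.2.2.init ::
    (reps A).flatMap fun q => m q :: (List.range A.1).map fun s => idx A (stepN A q s)

theorem PT.descr {m : Aut → ℕ → ℕ} (hm : PT fun x : Aut × ℕ => m x.1 x.2) :
    PT fun A : Aut => descr A (m A) := by
  unfold StackProg.descr
  refine PT.cons (by fun_prop) (PT.cons (by fun_prop) (PT.cons (by fun_prop) ?_))
  refine PT.flatMap (h := fun (A : Aut) q =>
    m A q :: (List.range A.1).map fun s => StackProg.idx A (StackProg.stepN A q s))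
    (PT.cons hm ?_) (by fun_prop)
  exact PT.map (h := fun (x : Aut × ℕ) s => StackProg.idx x.1 (StackProg.stepN x.1 x.2 s))
    (by fun_prop) (by fun_prop)

/-- The right-hand side involves only natural numbers and the list of representatives, which makes
the output accessible to `PT`. -/
theorem encodeMarked_quotDTS (A : Aut) (m : ℕ → ℕ) :
    encodeMarked (quotDTS A) (fun i => m (repF A i)) = trList (descr A m) := by
  rw [encodeMarked, descr]
  congr 4
  have h1 : reps A = (List.finRange (reps A).length).map fun i => (repF A i : ℕ) := by
    conv_lhs => rw [← List.map_get_finRange (reps A)]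
    rfl
  conv_rhs => rw [h1, List.flatMap_map]
  congr 1
  funext i
  congr 1
  rw [← List.map_coe_finRange_eq_range, List.map_map]
  refine List.map_congr_left fun s _ => ?_
  rw [Function.comp_apply, stepN_val]
  rfl

open Classical in
theorem encodeDBA_outDBA (A : Aut) : encodeDBA (outDBA A) =
    trList (descr A fun q => if mark A False 2 q = 0 then 1 else 0) := by
  rw [← encodeMarked_quotDTS]
  change encodeMarked (quotDTS A) (bit {i | markF A False 2 i = 0}) = _
  congr 1
  funext i
  unfold bit
  congr!

open Classical in
theorem encodeDCA_outDCA (A : Aut) : encodeDCA (outDCA A) =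
    trList (descr A fun q => if mark A True 2 q = 1 then 1 else 0) := by
  rw [← encodeMarked_quotDTS]
  change encodeMarked (quotDTS A) (bit {i | markF A True 2 i = 1}) = _
  congr 1
  funext i
  unfold bit
  congr!

theorem encodeDPA_outDPA (A : Aut) : encodeDPA (outDPA A) =
    trList (descr A fun q => 2 * A.2.1 - mark A False (2 * A.2.1) q) := by
  rw [← encodeMarked_quotDTS]
  rfl

/-- A machine that outputs a quotient automaton if its input has a polynomial-time property. -/
theorem polyTime_output {Y : ℕ → Type} (e : ∀ k, Y k → List Γ') (c : Aut → Prop)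
    [DecidablePred c] (hc : PT c) (g : ∀ A : Aut, Y A.1) (m : Aut → ℕ → ℕ)
    (hm : PT fun x : Aut × ℕ => m x.1 x.2) (hg : ∀ A, e _ (g A) = trList (descr A (m A))) :
    PolyTimeComputable (fun A : Aut => encodeDPA A.2)
      (fun B : Σ k, Option (Y k) => encodeOption (e B.1) B.2)
      (fun A => ⟨A.1, if c A then some (g A) else none⟩) := by
  refine polyTimeComputable_of_PT (fun _ => rfl) ?_
  have h1 := PT.trList (PT.descr hm)
  have h2 : PT fun A : Aut => (if c A then trList (descr A (m A)) else []).reverse := by fun_prop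
  refine cast (congrArg PT (funext fun A => ?_)) h2
  by_cases h : c A <;> simp [h, encodeOption, hg]

end StackProg

/-! ### Decision, construction and minimality for the three classes -/

open StackProg

theorem mainTheorem3 :
    -- membership of the language of a given DPA in the three classes
    (PolyTimeDecidable (fun A : Σ k, FinDPA k => encodeDPA A.2)
        (fun A => A.2.2.language ∈ IB (Fin A.1)) ∧
      PolyTimeDecidable (fun A : Σ k, FinDPA k => encodeDPA A.2)
        (fun A => A.2.2.language ∈ IC (Fin A.1)) ∧
      PolyTimeDecidable (fun A : Σ k, FinDPA k => encodeDPA A.2)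
        (fun A => A.2.2.language ∈ IP (Fin A.1))) ∧
    -- construction of a DBA with informative right-congruence
    (∃ f : ∀ k, FinDPA k → Option (FinDBA k),
      PolyTimeComputable (fun A : Σ k, FinDPA k => encodeDPA A.2)
        (fun B : Σ k, Option (FinDBA k) => encodeOption encodeDBA B.2)
        (fun A => ⟨A.1, f A.1 A.2⟩) ∧
      ∀ (k : ℕ) (A : FinDPA k),
        (A.2.language ∈ IB (Fin k) → ∃ B : FinDBA k, f k A = some B ∧
          B.2.language = A.2.language ∧ B.2.HasIRC ∧ B.2.IsMinimal) ∧
        (A.2.language ∉ IB (Fin k) → f k A = none)) ∧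
    -- construction of a DCA with informative right-congruence
    (∃ f : ∀ k, FinDPA k → Option (FinDCA k),
      PolyTimeComputable (fun A : Σ k, FinDPA k => encodeDPA A.2)
        (fun B : Σ k, Option (FinDCA k) => encodeOption encodeDCA B.2)
        (fun A => ⟨A.1, f A.1 A.2⟩) ∧
      ∀ (k : ℕ) (A : FinDPA k),
        (A.2.language ∈ IC (Fin k) → ∃ B : FinDCA k, f k A = some B ∧
          B.2.language = A.2.language ∧ B.2.HasIRC ∧ B.2.IsMinimal) ∧
        (A.2.language ∉ IC (Fin k) → f k A = none)) ∧
    -- construction of a DPA with informative right-congruence, hence DPA minimization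
    (∃ f : ∀ k, FinDPA k → Option (FinDPA k),
      PolyTimeComputable (fun A : Σ k, FinDPA k => encodeDPA A.2)
        (fun B : Σ k, Option (FinDPA k) => encodeOption encodeDPA B.2)
        (fun A => ⟨A.1, f A.1 A.2⟩) ∧
      ∀ (k : ℕ) (A : FinDPA k),
        (A.2.language ∈ IP (Fin k) → ∃ B : FinDPA k, f k A = some B ∧
          B.2.language = A.2.language ∧ B.2.HasIRC ∧ B.2.IsMinimal) ∧
        (A.2.language ∉ IP (Fin k) → f k A = none)) := by
  classical
  -- The common criterion: membership in each of the three classes is emptiness of a layer whose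
  -- index is 2 or twice the number of states.
  have hnil : ∀ (e : Prop) {N : Aut → ℕ}, PT N → PT fun A => layer A e (N A) = [] := by
    intro e N hN
    have : PT fun A => ¬ layer A e (N A) ≠ [] := by fun_prop
    simpa only [not_not] using this
  have hB : PT fun A : Aut => A.2.2.language ∈ IB (Fin A.1) := by
    simp only [mem_IB_iff]; exact hnil _ (by fun_prop)
  have hC : PT fun A : Aut => A.2.2.language ∈ IC (Fin A.1) := by
    simp only [mem_IC_iff]; exact hnil _ (by fun_prop)
  have hP : PT fun A : Aut => A.2.2.language ∈ IP (Fin A.1) := by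
    simp only [mem_IP_iff]; exact hnil _ (by fun_prop)
  refine ⟨⟨polyTimeDecidable_of_PT (fun _ => rfl) hB, polyTimeDecidable_of_PT (fun _ => rfl) hC,
    polyTimeDecidable_of_PT (fun _ => rfl) hP⟩,
    ⟨fun k A => if A.2.language ∈ IB (Fin k) then some (outDBA ⟨k, A⟩) else none, ?_, ?_⟩,
    ⟨fun k A => if A.2.language ∈ IC (Fin k) then some (outDCA ⟨k, A⟩) else none, ?_, ?_⟩,
    ⟨fun k A => if A.2.language ∈ IP (Fin k) then some (outDPA ⟨k, A⟩) else none, ?_, ?_⟩⟩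
  · refine polyTime_output (Y := FinDBA) (fun _ => encodeDBA) _ hB outDBA
      (fun A q => if mark A False 2 q = 0 then 1 else 0) (by fun_prop)
      fun A => (encodeDBA_outDBA A).trans (by congr!)
  · intro k A
    refine ⟨fun h => ?_, fun h => if_neg h⟩
    have hN := (mem_IB_iff (A := ⟨k, A⟩)).1 h
    exact ⟨_, if_pos h, outDBA_language hN, outDBA_hasIRC hN, DBA.isMinimal (outDBA_hasIRC hN)⟩
  · refine polyTime_output (Y := FinDCA) (fun _ => encodeDCA) _ hC outDCA
      (fun A q => if mark A True 2 q = 1 then 1 else 0) (by fun_prop)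
      fun A => (encodeDCA_outDCA A).trans (by congr!)
  · intro k A
    refine ⟨fun h => ?_, fun h => if_neg h⟩
    have hN := (mem_IC_iff (A := ⟨k, A⟩)).1 h
    exact ⟨_, if_pos h, outDCA_language hN, outDCA_hasIRC hN, DCA.isMinimal (outDCA_hasIRC hN)⟩
  · refine polyTime_output (Y := FinDPA) (fun _ => encodeDPA) _ hP outDPA
      (fun A q => 2 * A.2.1 - mark A False (2 * A.2.1) q) (by fun_prop)
      fun A => (encodeDPA_outDPA A).trans (by congr!)
  · intro k A
    refine ⟨fun h => ?_, fun h => if_neg h⟩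
    have hN := (mem_IP_iff (A := ⟨k, A⟩)).1 h
    exact ⟨_, if_pos h, outDPA_language hN, outDPA_hasIRC hN, DPA.isMinimal (outDPA_hasIRC hN)⟩
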